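/- Setting. Let $\alpha_1,\alpha_2,h_\pm\in\mathbb R$, $\boldsymbol u_o\in\mathbb C^2\setminus\{0\}$, $u_o=\|\boldsymbol u_o\|$, $\boldsymbol u_\pm=\boldsymbol u_o e^{ih_\pm}$. Let $\boldsymbol u:\mathbb R^2\to\mathbb C^2$ be a $C^3$ solution of $$i\boldsymbol u_t+\alpha_1\left[\boldsymbol u_{xx}+2\boldsymbol u(\|\boldsymbol u\|^2-u_o^2)\right]+i\alpha_2\left[\boldsymbol u_{xxx}+3\boldsymbol u_x\|\boldsymbol u\|^2+3\boldsymbol u\boldsymbol u^\dagger\boldsymbol u_x\right]=0$$ such that $\boldsymbol u\to\boldsymbol u_\pm$, $\boldsymbol u_x\to 0$, $\boldsymbol u_{xx}\to0$ as $x\to\pm\infty$, locally uniformly in $t$, and $\boldsymbol u(\cdot,t)-\boldsymbol u_-\in L^1(-\infty,a)$, $\boldsymbol u(\cdot,t)-\boldsymbol u_+\in L^1(a,\infty)$ for all $t,a$. Put $$\lambda=\tfrac12\left(z+\tfrac{u_o^2}{z}\right),\quad k=\tfrac12\left(z-\tfrac{u_o^2}{z}\right),\quad \mu=1+\tfrac{u_o^2}{z^2},\quad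 \Theta=\mathrm{diag}(-\lambda,k,\lambda),\quad U[v]=\begin{pmatrix}0&-v^\dagger\\ v&0\end{pmatrix},$$ $$G_\pm(z)=\begin{pmatrix}1&0&iu_o/z\\ i\boldsymbol u_\pm/z&\boldsymbol u_\pm^\perp/u_o&\boldsymbol u_\pm/u_o\end{pmatrix},\quad (\nu_1,\nu_2)^\perp=(\nu_2,-\nu_1)^\dagger,\quad H=\mathrm{diag}(h_1,h_2,-h_1),$$ $h_1=-\lambda x+2\lambda[\alpha_1k+\alpha_2(-2k^2+u_o^2)]t$, $h_2=kx-[\alpha_1(k^2+\lambda^2)-4\alpha_2k^3]t$. Let $\Xi_1=\{|z|>u_o,\mathrm{Im}\,z>0\}$, $\Xi_2=\{|z|>u_o,\mathrm{Im}\,z<0\}$, $\Xi_3=\{|z|<u_o,\mathrm{Im}\,z<0\}$, $\Xi_4=\{|z|<u_o,\mathrm{Im}\,z>0\}$, $\Xi^+=\Xi_1\cup\Xi_3$, $\Xi^-=\Xi_2\cup\Xi_4$, $\Sigma_j=\overline{\Xi}_j\cap\overline{\Xi}_{j+1}$ ($\Xi_5=\Xi_1$), $\Sigma=\bigcup_j\Sigma_j=\mathbb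 R\cup\{|z|=u_o\}$. The columns $\phi_{\pm,l}(z,x,t)$ of the modified Jost eigenfunctions are the continuous solutions, bounded near $\pm\infty$, of $$\phi_{\pm,l}(x)=G_{\pm,l}+\int_{\pm\infty}^xG_\pm e^{i(x-y)(\Theta-\theta_l)}G_\pm^{-1}\left(U[\boldsymbol u(y,t)]-U[\boldsymbol u_\pm]\right)\phi_{\pm,l}(y)\,dy ,$$ where $\theta_l$ is the $l$-th diagonal entry of $\Theta$. The columns $\tilde\phi_{\pm,l}$ of the modified adjoint eigenfunctions are defined in the same way with $G_\pm^*(z^*)$, $-\Theta$, $U^*$ in place of $G_\pm(z)$, $\Theta$, $U$. Put $\varphi_\pm=\phi_\pm e^{iH}$, $\tilde\varphi_\pm=\tilde\phi_\pm e^{-iH}$. With $d=(\mu,1,\mu)$, the scattering coefficients are $$s_{jl}=\tilde\varphi_{+,j}^T\varphi_{-,l}/d_j,\qquad b_{jl}=\tilde\varphi_{-,j}^T\varphi_{+,l}/d_j\qquad\text{at }(x,t)=(0,0),$$ wherever the two columns exist (on $\mathbb R\setminus\{0\}$ for all $j,l$; also, on $\overline\Xi_1$ for $s_{11}$, $\mathrm{Im}\,z\le0$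 for $s_{22}$, $\overline\Xi_4$ for $s_{33}$, $\overline\Xi_2$ for $b_{11}$, $\mathrm{Im}\,z\ge0$ for $b_{22}$, $\overline\Xi_3$ for $b_{33}$, apart from $0,\pm iu_o$). Let $\beta_1=s_{21}/s_{11}$, $\beta_2=s_{31}/s_{11}$, $\beta_3=s_{32}/s_{22}$, and $$\rho_1=e^{ih_2}\tilde\varphi_{+,1}\times\tilde\varphi_{-,2},\quad \rho_2=e^{ih_2}\tilde\varphi_{-,1}\times\tilde\varphi_{+,2},\quad \rho_3=e^{ih_2}\tilde\varphi_{+,2}\times\tilde\varphi_{-,3},\quad \rho_4=e^{ih_2}\tilde\varphi_{-,2}\times\tilde\varphi_{+,3},$$ $\chi_{1,2}=\rho_{1,2}e^{ih_1}$, $\chi_{3,4}=\rho_{3,4}e^{-ih_1}$. Write $\beta_j=\beta_j(z)$, $\hat\beta_j=\beta_j(-u_o^2/z)$, $\beta_j^{\frown}=\beta_j^*(z^*)$, $\beta_j^{\smile}=\beta_j^*(-u_o^2/z^*)$. Lemma. On $\mathbb R\setminus\{0\}$ one has $\varphi_-=\varphi_+S$ and $\varphi_+=\varphi_-B$ for all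 $x,t$, with $S=(s_{jl})$, $B=(b_{jl})$. Define, for $z\in\Xi_j$, $M=M_j$ with $$M_1=\left(\tfrac{\phi_{-,1}}{s_{11}},\phi_{+,2},\tfrac{\chi_1}{b_{22}}\right),\quad M_2=\left(\phi_{+,1},\tfrac{\phi_{-,2}}{s_{22}},\tfrac{\chi_2}{b_{11}}\right),\quad M_3=\left(\tfrac{\chi_3}{b_{33}},\tfrac{\phi_{-,2}}{s_{22}},\phi_{+,3}\right),\quad M_4=\left(\tfrac{\chi_4}{b_{22}},\phi_{+,2},\tfrac{\phi_{-,3}}{s_{33}}\right).$$ Then, where the denominators of $M_j$ do not vanish, $M_j=P_je^{-iH}D_j^{-1}$ with $D_j$ the diagonal matrix of these denominators and $P_1=(\varphi_{-,1},\varphi_{+,2},\rho_1)$, $P_2=(\varphi_{+,1},\varphi_{-,2},\rho_2)$, $P_3=(\rho_3,\varphi_{-,2},\varphi_{+,3})$, $P_4=(\rho_4,\varphi_{+,2},\varphi_{-,3})$. Each $M_j$ is meromorphic in $\Xi_j$, and analytic where its denominators do not vanish. At every $z\in\Sigma_j\setminus\{0,\pm iu_o\}$ at which the denominators of the $M_i$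 of the two adjacent regions do not vanish, $M$ has limits $M^\pm(z)$ from the adjacent region in $\Xi^\pm$, given by the same formulas at $z$, and $$M^+=M^-\left[I-e^{iH}Ve^{-iH}\right],$$ where $$V=\begin{pmatrix}\Lambda_1&\Lambda_2&\Lambda_3\\-\beta_1&0&\mu\beta_3^{\frown}\\\beta_1\beta_3-\beta_2&\beta_3&-\mu\beta_3^{\frown}\beta_3\end{pmatrix}\text{ on }\Sigma_1,\qquad V=\begin{pmatrix}\beta_2^{\smile}\beta_2^{\frown}&0&-\beta_2^{\frown}\\0&0&0\\\beta_2^{\smile}&0&0\end{pmatrix}\text{ on }\Sigma_2,$$ $$V=\begin{pmatrix}-\beta_2^{\smile}\hat\beta_2&\Lambda_4&\hat\beta_2\\\Lambda_5&\Lambda_6&\Lambda_7\\\beta_2^{\smile}&-\beta_3&0\end{pmatrix}\text{ on }\Sigma_3,\qquad V=\begin{pmatrix}\beta_2\hat\beta_2&0&\hat\beta_2\\0&0&0\\-\beta_2&0&0\end{pmatrix}\text{ on }\Sigma_4,$$ $\Lambda_1=\beta_1\beta_2^{\frown}\beta_3-\beta_2\beta_2^{\frown}-\frac{iz}{u_o}\beta_1\hat\beta_3$,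 $\Lambda_2=\beta_3\beta_2^{\frown}-\frac{iz}{u_o}\hat\beta_3$, $\Lambda_3=-\beta_2^{\frown}-\mu\beta_2^{\frown}\beta_3\beta_3^{\frown}+\frac{iz}{u_o}\mu\beta_3^{\frown}\hat\beta_3$, $\Lambda_4=\beta_3\hat\beta_2-\frac{z}{iu_o}\hat\beta_3$, $\Lambda_5=\frac{u_o}{iz}\beta_2^{\smile}\hat\beta_1+\frac{z\mu}{iu_o}\beta_3^{\smile}+\frac{z\mu}{iu_o}\beta_2^{\smile}\hat\beta_2\beta_3^{\smile}$, $\Lambda_6=-\left(\frac{u_o}{iz}\beta_3\hat\beta_1+\frac{z^2\mu}{u_o^2}\hat\beta_3\beta_3^{\smile}+\frac{z\mu}{iu_o}\beta_3\hat\beta_2\beta_3^{\smile}\right)$, $\Lambda_7=\frac{iz\mu}{u_o}\hat\beta_2\beta_3^{\smile}+\frac{iu_o}{z}\hat\beta_1$. If moreover $e^{u_o|x|}(\boldsymbol u(\cdot,0)-\boldsymbol u_-)\in L^1(-\infty,a)$ and $e^{u_o|x|}(\boldsymbol u(\cdot,0)-\boldsymbol u_+)\in L^1(a,\infty)$ for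 all $a$, then also $\varphi_-=\varphi_+S$, $\varphi_+=\varphi_-B$ for $|z|=u_o$, $z\ne\pm iu_o$, $t=0$ and all $x$, and at the points of $\Sigma_4\setminus\{\pm iu_o\}$ at which the denominators of $M_1$ and $M_4$ do not vanish the expressions $$\Lambda_8=\tfrac{z\mu}{iu_o}\beta_3^{\smile}-\tfrac{z\mu}{iu_o}\beta_2\hat\beta_2\beta_3^{\smile}-\beta_1+\tfrac{iu_o}{z}\beta_2\hat\beta_1,\qquad \Lambda_9=\tfrac{iz\mu}{u_o}\hat\beta_2\beta_3^{\smile}+\tfrac{iu_o}{z}\hat\beta_1+\mu\beta_3^{\frown}$$ for the entries $V_{21}$, $V_{23}$ of $V$ on $\Sigma_4$ vanish, as in the matrix given above. -/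

import Mathlib

open MeasureTheory Filter Topology Complex ComplexConjugate
open scoped Matrix

noncomputable section

/-- The space `ℂ²` with its Hermitian norm, in which the potential takes values. -/
abbrev C2 : Type := EuclideanSpace ℂ (Fin 2)

/-- Column vectors with three complex components. -/
abbrev C3 : Type := Fin 3 → ℂ

/-- Complex `3 × 3` matrices. -/
abbrev Mat3 : Type := Matrix (Fin 3) (Fin 3) ℂ

/-- The matrix with columns `a`, `b`, `c`. -/
def cols (a b c : C3) : Mat3 := (Matrix.of ![a, b, c])ᵀ

/-- The matrix `U` built from a vector `v ∈ ℂ²`: first row `(0, -v†)`, first column `(0, v)`,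
zero elsewhere. -/
def potMatrix (v : C2) : Mat3 :=
  !![0, -conj (v 0), -conj (v 1);
     v 0, 0, 0;
     v 1, 0, 0]

/-- The eigenvector matrix of `-ikσ + U_±`, for the limit `v = u_±` of the potential:
its columns are `(1, i v / z)`, `(0, v^⊥ / ‖v‖)` and `(i ‖v‖ / z, v / ‖v‖)`,
where `v^⊥ = (v₂, -v₁)†`. -/
def eigMatrix (v : C2) (z : ℂ) : Mat3 :=
  !![1, 0, I * ‖v‖ / z;
     I * v 0 / z, conj (v 1) / ‖v‖, v 0 / ‖v‖;
     I * v 1 / z, -conj (v 0) / ‖v‖, v 1 / ‖v‖]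

/-- The kernel `G e^{i s (Θ - θ_l)} G⁻¹`, with `Θ = diag(θ_1, θ_2, θ_3)`, which occurs in the
`l`-th column of the Volterra equation for a modified Jost eigenfunction. -/
def jostKernel (G : Mat3) (θ : Fin 3 → ℂ) (l : Fin 3) (s : ℝ) : Mat3 :=
  G * Matrix.diagonal (fun j => exp (I * s * (θ j - θ l))) * G⁻¹

/-- `f` is the `l`-th column of the modified Jost eigenfunction normalized at `x → -∞`: the
continuous solution, bounded near `-∞`, of
`f(x) = G_l + ∫_{-∞}^x G e^{i(x-y)(Θ-θ_l)} G⁻¹ Q(y) f(y) dy`. -/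
structure IsLeftJost (G : Mat3) (θ : Fin 3 → ℂ) (Q : ℝ → Mat3) (l : Fin 3) (f : ℝ → C3) :
    Prop where
  continuous : Continuous f
  bounded : ∀ a : ℝ, ∃ C : ℝ, ∀ x ≤ a, ‖f x‖ ≤ C
  volterra : ∀ x : ℝ,
    f x = Gᵀ l + ∫ y in Set.Iic x, (jostKernel G θ l (x - y) * Q y) *ᵥ f y

/-- The same for the normalization at `x → +∞`:
`f(x) = G_l - ∫_x^{∞} G e^{i(x-y)(Θ-θ_l)} G⁻¹ Q(y) f(y) dy`. -/
structure IsRightJost (G : Mat3) (θ : Fin 3 → ℂ) (Q : ℝ → Mat3) (l : Fin 3) (f : ℝ → C3) :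
    Prop where
  continuous : Continuous f
  bounded : ∀ a : ℝ, ∃ C : ℝ, ∀ x ≥ a, ‖f x‖ ≤ C
  volterra : ∀ x : ℝ,
    f x = Gᵀ l - ∫ y in Set.Ioi x, (jostKernel G θ l (x - y) * Q y) *ᵥ f y

/-- The solution of the Volterra equation normalized at `-∞`. -/
def leftJost (G : Mat3) (θ : Fin 3 → ℂ) (Q : ℝ → Mat3) (l : Fin 3) : ℝ → C3 :=
  Classical.epsilon (IsLeftJost G θ Q l)

/-- The solution of the Volterra equation normalized at `+∞`. -/
def rightJost (G : Mat3) (θ : Fin 3 → ℂ) (Q : ℝ → Mat3) (l : Fin 3) : ℝ → C3 :=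
  Classical.epsilon (IsRightJost G θ Q l)

/-- The data of the problem: the dispersion constants `α₁`, `α₂`, the background vector `u_o`,
the phases `h_-`, `h_+` at infinity, and a function `u(x,t)` with values in `ℂ²`. -/
structure HirotaData where
  α₁ : ℝ
  α₂ : ℝ
  uo : C2
  hm : ℝ
  hp : ℝ
  u : ℝ → ℝ → C2

namespace HirotaData

variable (D : HirotaData)

/-- The limit `u_- = u_o e^{i h_-}`. -/
def um : C2 := exp (I * D.hm) • D.uo

/-- The limit `u_+ = u_o e^{i h_+}`. -/
def up : C2 := exp (I * D.hp) • D.uo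

/-- The amplitude `‖u_o‖` of the background. -/
def u0 : ℝ := ‖D.uo‖

/-- The `n`-th partial derivative of `u` with respect to `x`. -/
def ux (n : ℕ) (x t : ℝ) : C2 := iteratedDeriv n (fun y => D.u y t) x

/-- `u` is a classical solution of the focusing two-component Hirota equation with the nonzero
boundary conditions `u → u_±` as `x → ±∞`, with `u - u_±` integrable at `±∞`. The limits of
`u`, `u_x`, `u_xx` as `x → ±∞` are locally uniform in `t`. -/
structure IsSolution : Prop where
  smooth : ContDiff ℝ 3 (fun p : ℝ × ℝ => D.u p.1 p.2)
  equation : ∀ x t : ℝ,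
    I • deriv (fun s => D.u x s) t
      + (D.α₁ : ℂ) • (D.ux 2 x t + (2 * ((‖D.u x t‖ : ℂ) ^ 2 - (D.u0 : ℂ) ^ 2)) • D.u x t)
      + (I * D.α₂) • (D.ux 3 x t + (3 * (‖D.u x t‖ : ℂ) ^ 2) • D.ux 1 x t
          + (3 * inner ℂ (D.u x t) (D.ux 1 x t)) • D.u x t) = 0
  limit_left : TendstoLocallyUniformly D.u (fun _ => D.um) atBot
  limit_right : TendstoLocallyUniformly D.u (fun _ => D.up) atTop
  limit_ux_left : TendstoLocallyUniformly (D.ux 1) (fun _ => 0) atBot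
  limit_ux_right : TendstoLocallyUniformly (D.ux 1) (fun _ => 0) atTop
  limit_uxx_left : TendstoLocallyUniformly (D.ux 2) (fun _ => 0) atBot
  limit_uxx_right : TendstoLocallyUniformly (D.ux 2) (fun _ => 0) atTop
  integrable_left : ∀ t a : ℝ, IntegrableOn (fun x => D.u x t - D.um) (Set.Iic a)
  integrable_right : ∀ t a : ℝ, IntegrableOn (fun x => D.u x t - D.up) (Set.Ici a)

/-- Exponential decay of `u(·,0) - u_±` at the rate `‖u_o‖`. -/
structure ExpDecay : Prop where
  left : ∀ a : ℝ,
    IntegrableOn (fun x => Real.exp (D.u0 * |x|) • (D.u x 0 - D.um)) (Set.Iic a)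
  right : ∀ a : ℝ,
    IntegrableOn (fun x => Real.exp (D.u0 * |x|) • (D.u x 0 - D.up)) (Set.Ici a)

/-! ### Uniformization -/

/-- `λ = (z + u_o²/z)/2`. -/
def lam (z : ℂ) : ℂ := (z + (D.u0 : ℂ) ^ 2 / z) / 2

/-- `k = (z - u_o²/z)/2`. -/
def kk (z : ℂ) : ℂ := (z - (D.u0 : ℂ) ^ 2 / z) / 2

/-- `μ = 1 + u_o²/z²`. -/
def mu (z : ℂ) : ℂ := 1 + (D.u0 : ℂ) ^ 2 / z ^ 2

/-- The diagonal entries `(-λ, k, λ)` of `ϖ₁`. -/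
def theta (z : ℂ) : Fin 3 → ℂ := ![-D.lam z, D.kk z, D.lam z]

/-- The phase `h₁`. -/
def h1 (z : ℂ) (x t : ℝ) : ℂ :=
  -D.lam z * x
    + 2 * D.lam z * (D.α₁ * D.kk z + D.α₂ * (-2 * D.kk z ^ 2 + (D.u0 : ℂ) ^ 2)) * t

/-- The phase `h₂`. -/
def h2 (z : ℂ) (x t : ℝ) : ℂ :=
  D.kk z * x - (D.α₁ * (D.kk z ^ 2 + D.lam z ^ 2) - 4 * D.α₂ * D.kk z ^ 3) * t

/-- The diagonal entries `(h₁, h₂, -h₁)` of `H`. -/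
def hh (z : ℂ) (x t : ℝ) : Fin 3 → ℂ := ![D.h1 z x t, D.h2 z x t, -D.h1 z x t]

/-- `e^{iH}`. -/
def expH (z : ℂ) (x t : ℝ) : Mat3 := Matrix.diagonal (fun l => exp (I * D.hh z x t l))

/-- `e^{-iH}`. -/
def expNegH (z : ℂ) (x t : ℝ) : Mat3 := Matrix.diagonal (fun l => exp (-I * D.hh z x t l))

/-- The regions `Ξ₁, …, Ξ₄`, numbered from `0`. -/
def region : Fin 4 → Set ℂ :=
  ![{z | D.u0 < ‖z‖ ∧ 0 < z.im}, {z | D.u0 < ‖z‖ ∧ z.im < 0},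
    {z | ‖z‖ < D.u0 ∧ z.im < 0}, {z | ‖z‖ < D.u0 ∧ 0 < z.im}]

/-- The arcs `Σ_j`, the common boundary of `Ξ_j` and `Ξ_{j+1}` (indices modulo `4`). -/
def arc (j : Fin 4) : Set ℂ := closure (D.region j) ∩ closure (D.region (j + 1))

/-! ### Jost eigenfunctions -/

/-- Column `l` of the modified Jost eigenfunction `ϕ_-`. -/
def phiM (z : ℂ) (x t : ℝ) (l : Fin 3) : C3 :=
  leftJost (eigMatrix D.um z) (D.theta z) (fun y => potMatrix (D.u y t) - potMatrix D.um) l x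

/-- Column `l` of the modified Jost eigenfunction `ϕ_+`. -/
def phiP (z : ℂ) (x t : ℝ) (l : Fin 3) : C3 :=
  rightJost (eigMatrix D.up z) (D.theta z) (fun y => potMatrix (D.u y t) - potMatrix D.up) l x

/-- Column `l` of the modified Jost eigenfunction of the adjoint problem, whose potential is
`U^*`, whose asymptotic eigenvector matrix is `G_-^*(z^*)` and whose exponents are `-ϖ₁`;
normalized at `-∞`. -/
def adjM (z : ℂ) (x t : ℝ) (l : Fin 3) : C3 :=
  leftJost ((eigMatrix D.um (conj z)).map conj) (-D.theta z)
    (fun y => (potMatrix (D.u y t) - potMatrix D.um).map conj) l x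

/-- The same, normalized at `+∞`. -/
def adjP (z : ℂ) (x t : ℝ) (l : Fin 3) : C3 :=
  rightJost ((eigMatrix D.up (conj z)).map conj) (-D.theta z)
    (fun y => (potMatrix (D.u y t) - potMatrix D.up).map conj) l x

/-- Column `l` of the Jost eigenfunction `φ_- = ϕ_- e^{iH}`. -/
def jostM (z : ℂ) (x t : ℝ) (l : Fin 3) : C3 := exp (I * D.hh z x t l) • D.phiM z x t l

/-- Column `l` of the Jost eigenfunction `φ_+ = ϕ_+ e^{iH}`. -/
def jostP (z : ℂ) (x t : ℝ) (l : Fin 3) : C3 := exp (I * D.hh z x t l) • D.phiP z x t l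

/-- Column `l` of the adjoint Jost eigenfunction normalized at `-∞`. -/
def adjJostM (z : ℂ) (x t : ℝ) (l : Fin 3) : C3 := exp (-I * D.hh z x t l) • D.adjM z x t l

/-- Column `l` of the adjoint Jost eigenfunction normalized at `+∞`. -/
def adjJostP (z : ℂ) (x t : ℝ) (l : Fin 3) : C3 := exp (-I * D.hh z x t l) • D.adjP z x t l

/-- The matrix `φ_-`. -/
def JostM (z : ℂ) (x t : ℝ) : Mat3 :=
  cols (D.jostM z x t 0) (D.jostM z x t 1) (D.jostM z x t 2)

/-- The matrix `φ_+`. -/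
def JostP (z : ℂ) (x t : ℝ) : Mat3 :=
  cols (D.jostP z x t 0) (D.jostP z x t 1) (D.jostP z x t 2)

/-! ### Scattering and reflection coefficients -/

/-- The diagonal entries `(μ, 1, μ)` of the matrix which the Jost eigenfunctions of the adjoint
problem, transposed, times those of the original problem are equal to. -/
def dd (z : ℂ) : Fin 3 → ℂ := ![D.mu z, 1, D.mu z]

/-- The scattering coefficient `s_{jl}`, the coefficient of `φ_{+,j}` in `φ_{-,l}`, read off by
pairing `φ_{-,l}` with the `j`-th adjoint eigenfunction. It makes sense wherever the two
eigenfunctions do: for all `j`, `l` on the real axis, for `j = l` also in the region to which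
`s_{ll}` extends analytically. -/
def s (j l : Fin 3) (z : ℂ) : ℂ := (D.adjJostP z 0 0 j ⬝ᵥ D.jostM z 0 0 l) / D.dd z j

/-- The scattering coefficient `b_{jl}`, the coefficient of `φ_{-,j}` in `φ_{+,l}`. -/
def b (j l : Fin 3) (z : ℂ) : ℂ := (D.adjJostM z 0 0 j ⬝ᵥ D.jostP z 0 0 l) / D.dd z j

/-- The scattering matrix `S`. -/
def S (z : ℂ) : Mat3 := Matrix.of fun j l => D.s j l z

/-- The scattering matrix `B`. -/
def B (z : ℂ) : Mat3 := Matrix.of fun j l => D.b j l z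

/-- `β₁ = s₂₁ / s₁₁`. -/
def beta1 (z : ℂ) : ℂ := D.s 1 0 z / D.s 0 0 z

/-- `β₂ = s₃₁ / s₁₁`. -/
def beta2 (z : ℂ) : ℂ := D.s 2 0 z / D.s 0 0 z

/-- `β₃ = s₃₂ / s₂₂`. -/
def beta3 (z : ℂ) : ℂ := D.s 2 1 z / D.s 1 1 z

/-- `f̂(z) = f(-u_o²/z)`. -/
def hat (f : ℂ → ℂ) (z : ℂ) : ℂ := f (-(D.u0 : ℂ) ^ 2 / z)

/-- `f(z^*)^*`. -/
def frown (f : ℂ → ℂ) (z : ℂ) : ℂ := conj (f (conj z))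

/-- `f(-u_o²/z^*)^*`. -/
def smile (f : ℂ → ℂ) (z : ℂ) : ℂ := conj (f (-(D.u0 : ℂ) ^ 2 / conj z))

/-! ### Auxiliary eigenfunctions -/

/-- The auxiliary eigenfunctions `ρ₁, …, ρ₄`. -/
def rho (z : ℂ) (x t : ℝ) : Fin 4 → C3 :=
  ![exp (I * D.h2 z x t) • crossProduct (D.adjJostP z x t 0) (D.adjJostM z x t 1),
    exp (I * D.h2 z x t) • crossProduct (D.adjJostM z x t 0) (D.adjJostP z x t 1),
    exp (I * D.h2 z x t) • crossProduct (D.adjJostP z x t 1) (D.adjJostM z x t 2),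
    exp (I * D.h2 z x t) • crossProduct (D.adjJostM z x t 1) (D.adjJostP z x t 2)]

/-- The modified auxiliary eigenfunctions `χ₁, …, χ₄`. -/
def chi (z : ℂ) (x t : ℝ) : Fin 4 → C3 :=
  ![exp (I * D.h1 z x t) • D.rho z x t 0, exp (I * D.h1 z x t) • D.rho z x t 1,
    exp (-I * D.h1 z x t) • D.rho z x t 2, exp (-I * D.h1 z x t) • D.rho z x t 3]

/-! ### The Riemann-Hilbert problem -/

/-- The matrices `P₁, …, P₄`. -/
def P (z : ℂ) (x t : ℝ) : Fin 4 → Mat3 :=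
  ![cols (D.jostM z x t 0) (D.jostP z x t 1) (D.rho z x t 0),
    cols (D.jostP z x t 0) (D.jostM z x t 1) (D.rho z x t 1),
    cols (D.rho z x t 2) (D.jostM z x t 1) (D.jostP z x t 2),
    cols (D.rho z x t 3) (D.jostP z x t 1) (D.jostM z x t 2)]

/-- The denominators of the three columns of `M₁, …, M₄`. -/
def den (z : ℂ) : Fin 4 → C3 :=
  ![![D.s 0 0 z, 1, D.b 1 1 z], ![1, D.s 1 1 z, D.b 0 0 z],
    ![D.b 2 2 z, D.s 1 1 z, 1], ![D.b 1 1 z, 1, D.s 2 2 z]]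

/-- The matrices `M₁, …, M₄`. -/
def M (j : Fin 4) (z : ℂ) (x t : ℝ) : Mat3 :=
  (![cols ((D.s 0 0 z)⁻¹ • D.phiM z x t 0) (D.phiP z x t 1) ((D.b 1 1 z)⁻¹ • D.chi z x t 0),
    cols (D.phiP z x t 0) ((D.s 1 1 z)⁻¹ • D.phiM z x t 1) ((D.b 0 0 z)⁻¹ • D.chi z x t 1),
    cols ((D.b 2 2 z)⁻¹ • D.chi z x t 2) ((D.s 1 1 z)⁻¹ • D.phiM z x t 1) (D.phiP z x t 2),
    cols ((D.b 1 1 z)⁻¹ • D.chi z x t 3) (D.phiP z x t 1)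
      ((D.s 2 2 z)⁻¹ • D.phiM z x t 2)] : Fin 4 → Mat3) j

/-- `z` is not a zero of any of the denominators of `M_j`. -/
def Regular (j : Fin 4) (z : ℂ) : Prop := ∀ l, D.den z j l ≠ 0

/-- The index of the one of the two regions adjacent to `Σ_j` which belongs to
`Ξ⁺ = Ξ₁ ∪ Ξ₃`. -/
def plusSide : Fin 4 → Fin 4 := ![0, 2, 2, 0]

/-- The index of the one of the two regions adjacent to `Σ_j` which belongs to
`Ξ⁻ = Ξ₂ ∪ Ξ₄`. -/
def minusSide : Fin 4 → Fin 4 := ![1, 1, 3, 3]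

/-- The jump matrix on the real points with `‖z‖ ≥ u_o`. -/
def V1 (z : ℂ) : Mat3 :=
  let m := D.mu z
  let r := I * z / D.u0
  let β₁ := D.beta1 z
  let β₂ := D.beta2 z
  let β₃ := D.beta3 z
  let β₃h := D.hat D.beta3 z
  let β₂f := frown D.beta2 z
  let β₃f := frown D.beta3 z
  !![β₁ * β₂f * β₃ - β₂ * β₂f - r * β₁ * β₃h,
      β₃ * β₂f - r * β₃h,
      -β₂f - m * β₂f * β₃ * β₃f + r * m * β₃f * β₃h;
     -β₁, 0, m * β₃f;
     β₁ * β₃ - β₂, β₃, -(m * β₃f * β₃)]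

/-- The jump matrix on the lower semicircle. -/
def V2 (z : ℂ) : Mat3 :=
  let β₂f := frown D.beta2 z
  let β₂s := D.smile D.beta2 z
  !![β₂s * β₂f, 0, -β₂f;
     0, 0, 0;
     β₂s, 0, 0]

/-- The jump matrix on the real points with `‖z‖ ≤ u_o`. -/
def V3 (z : ℂ) : Mat3 :=
  let m := D.mu z
  let q := z / (I * D.u0)
  let p := D.u0 / (I * z)
  let β₃ := D.beta3 z
  let β₁h := D.hat D.beta1 z
  let β₂h := D.hat D.beta2 z
  let β₃h := D.hat D.beta3 z
  let β₂s := D.smile D.beta2 z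
  let β₃s := D.smile D.beta3 z
  !![-(β₂s * β₂h), β₃ * β₂h - q * β₃h, β₂h;
     p * β₂s * β₁h + q * m * β₃s + q * m * β₂s * β₂h * β₃s,
      -(p * β₃ * β₁h + z ^ 2 * m / (D.u0 : ℂ) ^ 2 * β₃h * β₃s + q * m * β₃ * β₂h * β₃s),
      I * z * m / D.u0 * β₂h * β₃s + I * D.u0 / z * β₁h;
     β₂s, -β₃, 0]

/-- The jump matrix on the upper semicircle. -/
def V4 (z : ℂ) : Mat3 :=
  let β₂ := D.beta2 z
  let β₂h := D.hat D.beta2 z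
  !![β₂ * β₂h, 0, β₂h;
     0, 0, 0;
     -β₂, 0, 0]

/-- The jump matrices on `Σ₁, …, Σ₄`. -/
def V (j : Fin 4) (z : ℂ) : Mat3 := (![D.V1 z, D.V2 z, D.V3 z, D.V4 z] : Fin 4 → Mat3) j

/-- The combination `Λ₈` of reflection coefficients. -/
def Lambda8 (z : ℂ) : ℂ :=
  z * D.mu z / (I * D.u0) * D.smile D.beta3 z
    - z * D.mu z / (I * D.u0) * D.beta2 z * D.hat D.beta2 z * D.smile D.beta3 z
    - D.beta1 z + I * D.u0 / z * D.beta2 z * D.hat D.beta1 z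

/-- The combination `Λ₉` of reflection coefficients. -/
def Lambda9 (z : ℂ) : ℂ :=
  I * z * D.mu z / D.u0 * D.hat D.beta2 z * D.smile D.beta3 z
    + I * D.u0 / z * D.hat D.beta1 z + D.mu z * frown D.beta3 z

end HirotaData

end

/-!
The Hirota equation is the zero curvature equation of a Lax pair `ϕ_x = Xϕ`, `ϕ_t = Tϕ`
(`zeroCurvature_of_hirota`), and the lemma is linear algebra of solutions of this pair, once the
solutions are under control.

*Analysis.* The Neumann series of the Volterra equation converges locally uniformly in `x` and in
the spectral parameter, so the modified Jost eigenfunctions exist, are unique, continuous up to the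
boundary of their regions, and holomorphic inside (`LeftAdmissible.isLeftJost_tsum`,
`differentiableOn_leftJost`). They are characterized by the `x`-equation together with their
normalization at `±∞` (`LeftAdmissible.eq_of_hasDerivAt`), and uniqueness has three consequences. By
the zero curvature equation, the `t`-equation carries the eigenfunction at one time to a solution of
the `x`-equation with the same normalization at nearby times, so the eigenfunctions solve the
`t`-equation as well (`hasDerivAt_leftJost_time`). The involution `z ↦ -u_o²/z` permutes the
eigenfunctions up to factors (`JostAt.hat`). The vector product of two adjoint eigenfunctions is, up
to a factor, the third eigenfunction (`JostAt.cross`). The potential decays at a rate `κ` which is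
`0` in general, and `u_o` for the part of the lemma which assumes exponential decay: on the circle
this rate compensates the growth of the kernel.

*Pairings.* The adjoint eigenfunctions are complex conjugates of eigenfunctions at `z^*`, and solve
the adjoint Lax pair. So their pairings with eigenfunctions are constant in `x` and `t`: they are
the diagonal matrix `diag(μ, 1, μ)` for equal normalizations (`JostAt.pairing`), and the scattering
coefficients for different ones (`FlowP.pairing`, `FlowM.pairing`). This gives `φ_- = φ_+ S` and
`φ_+ = φ_- B` wherever all eigenfunctions exist (`Full.scattering`), and the symmetries of the
scattering coefficients (`s_zhat`, `conj_s_conj`).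

*Jumps.* A jump relation follows as soon as the columns of both matrices are expressed in three
common vectors (`jump_of_coords`). On the real line these are the eigenfunctions normalized at `+∞`;
the auxiliary eigenfunctions are expanded by pairing (`Full.rho_eq`). On the circle only some of the
eigenfunctions exist, but the identity
`(a · (b × c)) v = (a · v) b × c + (b · v) c × a + (c · v) a × b`,
with adjoint eigenfunctions `a`, `b`, `c`, still relates the eigenfunctions to the auxiliary ones
(`jostM_eq_rho`, `jostP_eq_rho`). Where all eigenfunctions exist on the circle, the second
coordinates of the first of these relations say that `Λ₈` and `Λ₉` vanish (`lambda_eq_zero`).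
-/

noncomputable section

/-! ### Entry sums and entrywise derivatives of matrices -/

/-- The sum of the absolute values of the entries, used as a submultiplicative norm on `Mat3`. -/
def entrySum (A : Mat3) : ℝ := ∑ i, ∑ j, ‖A i j‖

lemma entrySum_nonneg (A : Mat3) : 0 ≤ entrySum A :=
  Finset.sum_nonneg fun _ _ => Finset.sum_nonneg fun _ _ => norm_nonneg _

lemma norm_entry_le_entrySum (A : Mat3) (i j : Fin 3) : ‖A i j‖ ≤ entrySum A := by
  refine le_trans ?_ (Finset.single_le_sum (f := fun i => ∑ j, ‖A i j‖)
    (fun _ _ => Finset.sum_nonneg fun _ _ => norm_nonneg _) (Finset.mem_univ i))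
  exact Finset.single_le_sum (f := fun j => ‖A i j‖) (fun _ _ => norm_nonneg _) (Finset.mem_univ j)

lemma norm_mulVec_le (A : Mat3) (v : C3) : ‖A *ᵥ v‖ ≤ entrySum A * ‖v‖ := by
  refine (pi_norm_le_iff_of_nonneg (mul_nonneg (entrySum_nonneg A) (norm_nonneg v))).2 fun i => ?_
  calc ‖(A *ᵥ v) i‖ ≤ ∑ j, ‖A i j * v j‖ := by
        rw [Matrix.mulVec, dotProduct]
        exact norm_sum_le _ _
    _ ≤ ∑ j, ‖A i j‖ * ‖v‖ := by
        refine Finset.sum_le_sum fun j _ => ?_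
        rw [norm_mul]
        gcongr
        exact norm_le_pi_norm v j
    _ = (∑ j, ‖A i j‖) * ‖v‖ := by rw [Finset.sum_mul]
    _ ≤ entrySum A * ‖v‖ := by
        gcongr
        exact Finset.single_le_sum (f := fun i => ∑ j, ‖A i j‖)
          (fun _ _ => Finset.sum_nonneg fun _ _ => norm_nonneg _) (Finset.mem_univ i)

lemma entrySum_mul_le (A B : Mat3) : entrySum (A * B) ≤ entrySum A * entrySum B := by
  have h : ∀ i j, ‖(A * B) i j‖ ≤ ∑ k, ‖A i k‖ * ‖B k j‖ := fun i j => by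
    rw [Matrix.mul_apply]
    exact (norm_sum_le _ _).trans (le_of_eq (by simp))
  calc entrySum (A * B) ≤ ∑ i, ∑ j, ∑ k, ‖A i k‖ * ‖B k j‖ :=
        Finset.sum_le_sum fun i _ => Finset.sum_le_sum fun j _ => h i j
    _ = ∑ i, ∑ k, ‖A i k‖ * ∑ j, ‖B k j‖ := by
        refine Finset.sum_congr rfl fun i _ => ?_
        rw [Finset.sum_comm]
        simp [Finset.mul_sum]
    _ ≤ ∑ i, ∑ k, ‖A i k‖ * entrySum B := by
        refine Finset.sum_le_sum fun i _ => Finset.sum_le_sum fun k _ => ?_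
        gcongr
        exact Finset.single_le_sum (f := fun i => ∑ j, ‖B i j‖)
          (fun _ _ => Finset.sum_nonneg fun _ _ => norm_nonneg _) (Finset.mem_univ k)
    _ = entrySum A * entrySum B := by simp only [entrySum, Finset.sum_mul]

lemma entrySum_neg (A : Mat3) : entrySum (-A) = entrySum A := by simp [entrySum]

lemma continuous_entrySum : Continuous entrySum := by
  unfold entrySum
  fun_prop

lemma continuous_mat3_iff {α : Type*} [TopologicalSpace α] {A : α → Mat3} :
    Continuous A ↔ ∀ i j, Continuous fun x => A x i j :=
  ⟨fun h i j => h.matrix_elem i j, fun h => continuous_matrix h⟩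

/-- `A *ᵥ ·` as a continuous linear map. -/
def mulVecCLM (A : Mat3) : C3 →L[ℂ] C3 := LinearMap.toContinuousLinearMap A.mulVecLin

lemma mulVec_integral (A : Mat3) {f : ℝ → C3} {s : Set ℝ} (hf : IntegrableOn f s) :
    A *ᵥ ∫ y in s, f y = ∫ y in s, A *ᵥ f y :=
  ((mulVecCLM A).integral_comp_comm hf).symm

/-- The derivative of a matrix-valued function, taken entry by entry. -/
def HasMatDerivAt (A : ℝ → Mat3) (A' : Mat3) (x : ℝ) : Prop :=
  ∀ i j, HasDerivAt (fun y => A y i j) (A' i j) x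

lemma HasMatDerivAt.mulVec {A : ℝ → Mat3} {A' : Mat3} {v : ℝ → C3} {v' : C3} {x : ℝ}
    (hA : HasMatDerivAt A A' x) (hv : HasDerivAt v v' x) :
    HasDerivAt (fun y => A y *ᵥ v y) (A' *ᵥ v x + A x *ᵥ v') x := by
  rw [hasDerivAt_pi] at hv ⊢
  intro i
  have : HasDerivAt (fun y => ∑ j, A y i j * v y j) (∑ j, (A' i j * v x j + A x i j * v' j)) x :=
    HasDerivAt.fun_sum fun j _ => (hA i j).mul (hv j)
  simpa [Matrix.mulVec, dotProduct, Finset.sum_add_distrib] using this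

lemma HasMatDerivAt.mul {A B : ℝ → Mat3} {A' B' : Mat3} {x : ℝ}
    (hA : HasMatDerivAt A A' x) (hB : HasMatDerivAt B B' x) :
    HasMatDerivAt (fun y => A y * B y) (A' * B x + A x * B') x := by
  intro i j
  have : HasDerivAt (fun y => ∑ k, A y i k * B y k j) (∑ k, (A' i k * B x k j + A x i k * B' k j))
      x := HasDerivAt.fun_sum fun k _ => (hA i k).mul (hB k j)
  simpa [Matrix.mul_apply, Finset.sum_add_distrib] using this

lemma HasMatDerivAt.add {A B : ℝ → Mat3} {A' B' : Mat3} {x : ℝ}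
    (hA : HasMatDerivAt A A' x) (hB : HasMatDerivAt B B' x) :
    HasMatDerivAt (fun y => A y + B y) (A' + B') x :=
  fun i j => (hA i j).add (hB i j)

lemma HasMatDerivAt.sub {A B : ℝ → Mat3} {A' B' : Mat3} {x : ℝ}
    (hA : HasMatDerivAt A A' x) (hB : HasMatDerivAt B B' x) :
    HasMatDerivAt (fun y => A y - B y) (A' - B') x :=
  fun i j => (hA i j).sub (hB i j)

lemma HasMatDerivAt.smul {A : ℝ → Mat3} {A' : Mat3} {x : ℝ} (c : ℂ)
    (hA : HasMatDerivAt A A' x) : HasMatDerivAt (fun y => c • A y) (c • A') x :=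
  fun i j => (hA i j).const_mul c

lemma hasMatDerivAt_const (A : Mat3) (x : ℝ) : HasMatDerivAt (fun _ => A) 0 x :=
  fun i j => hasDerivAt_const x (A i j)

lemma HasMatDerivAt.continuousAt {A : ℝ → Mat3} {A' : Mat3} {x : ℝ} (hA : HasMatDerivAt A A' x) :
    ContinuousAt A x :=
  tendsto_pi_nhds.2 fun i => tendsto_pi_nhds.2 fun j => (hA i j).continuousAt

/-! ### The kernel of the Volterra equation -/

section Kernel

variable {G : Mat3} {θ : Fin 3 → ℂ} {l : Fin 3}

lemma jostKernel_zero (hG : IsUnit G.det) : jostKernel G θ l 0 = 1 := by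
  simp [jostKernel, Matrix.mul_nonsing_inv _ hG]

lemma jostKernel_add (hG : IsUnit G.det) (s t : ℝ) :
    jostKernel G θ l (s + t) = jostKernel G θ l s * jostKernel G θ l t := by
  unfold jostKernel
  set Ds := Matrix.diagonal fun j => exp (I * s * (θ j - θ l))
  set Dt := Matrix.diagonal fun j => exp (I * t * (θ j - θ l))
  have h : (Matrix.diagonal fun j => exp (I * ↑(s + t) * (θ j - θ l))) = Ds * Dt := by
    simp only [Ds, Dt, Matrix.diagonal_mul_diagonal, ← Complex.exp_add]
    congr 1
    ext j
    congr 1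
    push_cast
    ring
  rw [h, show G * Ds * G⁻¹ * (G * Dt * G⁻¹) = G * Ds * (G⁻¹ * G) * Dt * G⁻¹ by
    simp only [Matrix.mul_assoc], Matrix.nonsing_inv_mul _ hG]
  simp only [Matrix.mul_assoc, Matrix.mul_one]

/-- The generator of the kernel: the matrix of the modified `x`-equation with constant
potential. -/
def jostGen (G : Mat3) (θ : Fin 3 → ℂ) (l : Fin 3) : Mat3 :=
  G * Matrix.diagonal (fun j => I * (θ j - θ l)) * G⁻¹

lemma hasMatDerivAt_jostKernel (hG : IsUnit G.det) (s : ℝ) :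
    HasMatDerivAt (jostKernel G θ l) (jostGen G θ l * jostKernel G θ l s) s := by
  have hd : HasMatDerivAt (fun s : ℝ => Matrix.diagonal fun j => exp (I * s * (θ j - θ l)))
      (Matrix.diagonal (fun j => I * (θ j - θ l)) *
        Matrix.diagonal fun j => exp (I * s * (θ j - θ l))) s := by
    intro i j
    rw [Matrix.diagonal_mul_diagonal]
    by_cases hij : i = j
    · subst hij
      simp only [Matrix.diagonal_apply_eq]
      have h1 : HasDerivAt (fun s : ℝ => I * (s : ℂ) * (θ i - θ l)) (I * 1 * (θ i - θ l)) s :=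
        ((Complex.ofRealCLM.hasDerivAt (x := s)).const_mul I).mul_const _
      convert h1.cexp using 1
      ring
    · simp only [Matrix.diagonal_apply_ne _ hij]
      exact hasDerivAt_const _ _
  have := ((hasMatDerivAt_const G s).mul hd).mul (hasMatDerivAt_const G⁻¹ s)
  unfold jostKernel jostGen
  convert this using 1
  simp only [Matrix.zero_mul, zero_add, Matrix.mul_zero, add_zero]
  rw [show ∀ E F : Mat3, G * E * G⁻¹ * (G * F * G⁻¹) = G * E * (G⁻¹ * G) * F * G⁻¹ from
    fun E F => by simp only [Matrix.mul_assoc], Matrix.nonsing_inv_mul _ hG]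
  simp only [Matrix.mul_assoc, Matrix.one_mul]

lemma continuous_jostKernel (hG : IsUnit G.det) : Continuous (jostKernel G θ l) :=
  continuous_iff_continuousAt.2 fun s => (hasMatDerivAt_jostKernel hG s).continuousAt

lemma transpose_eq_mulVec_single (G : Mat3) (l : Fin 3) : Gᵀ l = G *ᵥ Pi.single l 1 := by
  ext i
  simp

lemma jostKernel_mulVec_col (hG : IsUnit G.det) (s : ℝ) : jostKernel G θ l s *ᵥ Gᵀ l = Gᵀ l := by
  rw [transpose_eq_mulVec_single, jostKernel, Matrix.mulVec_mulVec, Matrix.mul_assoc,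
    Matrix.nonsing_inv_mul _ hG, Matrix.mul_one, ← Matrix.mulVec_mulVec,
    Matrix.diagonal_mulVec_single]
  simp

lemma norm_exp_I_mul (s : ℝ) (w : ℂ) : ‖exp (I * s * w)‖ = Real.exp (-(s * w.im)) := by
  rw [Complex.norm_exp]
  congr 1
  simp

lemma entrySum_jostKernel_le {κ : ℝ} (hκ : ∀ j, -κ ≤ (θ j - θ l).im) {s : ℝ} (hs : 0 ≤ s) :
    entrySum (jostKernel G θ l s) ≤ 3 * (entrySum G * entrySum G⁻¹) * Real.exp (κ * s) := by
  have hd : entrySum (Matrix.diagonal fun j => exp (I * s * (θ j - θ l))) ≤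
      3 * Real.exp (κ * s) := by
    have h : ∀ j, ‖exp (I * s * (θ j - θ l))‖ ≤ Real.exp (κ * s) := fun j => by
      rw [norm_exp_I_mul, Real.exp_le_exp]
      nlinarith [hκ j]
    have h0 := h 0
    have h1 := h 1
    have h2 := h 2
    simp only [entrySum, Fin.sum_univ_three, Matrix.diagonal_apply]
    simp
    linarith
  calc entrySum (jostKernel G θ l s)
      ≤ entrySum G * (3 * Real.exp (κ * s)) * entrySum G⁻¹ := by
        refine (entrySum_mul_le _ _).trans ?_
        refine mul_le_mul_of_nonneg_right ?_ (entrySum_nonneg _)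
        exact (entrySum_mul_le _ _).trans (mul_le_mul_of_nonneg_left hd (entrySum_nonneg _))
    _ = _ := by ring

end Kernel

/-! ### The Volterra equation -/

/-- The conditions under which the Volterra equation normalized at `-∞` has a unique solution:
the exponentials in the kernel grow at most at the rate `κ`, and the potential decays
integrably at that rate. -/
structure LeftAdmissible (G : Mat3) (θ : Fin 3 → ℂ) (Q : ℝ → Mat3) (l : Fin 3) (κ : ℝ) :
    Prop where
  det : IsUnit G.det
  rate_nonneg : 0 ≤ κ
  rate : ∀ j, -κ ≤ (θ j - θ l).im
  cont : Continuous Q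
  integ : ∀ a : ℝ, IntegrableOn (fun y => Real.exp (κ * |y|) * entrySum (Q y)) (Set.Iic a)

/-- The integrable majorant of the kernel of the Volterra equation for `y ≤ x ≤ a`, where `C`
bounds the factors `G`, `G⁻¹`. -/
def weight (C κ : ℝ) (Q : ℝ → Mat3) (a y : ℝ) : ℝ :=
  C * Real.exp (κ * |a|) * (Real.exp (κ * |y|) * entrySum (Q y))

/-- The integral of the majorant up to `x`. -/
def weightInt (C κ : ℝ) (Q : ℝ → Mat3) (a x : ℝ) : ℝ := ∫ y in Set.Iic x, weight C κ Q a y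

/-- The terms of the Neumann series of the Volterra equation normalized at `-∞`. -/
def jostIter (G : Mat3) (θ : Fin 3 → ℂ) (Q : ℝ → Mat3) (l : Fin 3) : ℕ → ℝ → C3
  | 0, _ => Gᵀ l
  | n + 1, x => ∫ y in Set.Iic x, (jostKernel G θ l (x - y) * Q y) *ᵥ jostIter G θ Q l n y

section Volterra

variable {G : Mat3} {θ : Fin 3 → ℂ} {Q : ℝ → Mat3} {l : Fin 3} {κ C : ℝ}

lemma weight_nonneg (hC : 0 ≤ C) (a y : ℝ) : 0 ≤ weight C κ Q a y := by
  unfold weight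
  have := entrySum_nonneg (Q y)
  positivity

lemma LeftAdmissible.continuous_weight (h : LeftAdmissible G θ Q l κ) (C a : ℝ) :
    Continuous (weight C κ Q a) := by
  unfold weight
  have := continuous_entrySum.comp h.cont
  fun_prop

lemma LeftAdmissible.integrableOn_weight (h : LeftAdmissible G θ Q l κ) (C a b : ℝ) :
    IntegrableOn (weight C κ Q a) (Set.Iic b) := (h.integ b).const_mul _

lemma weightInt_nonneg (hC : 0 ≤ C) (a x : ℝ) : 0 ≤ weightInt C κ Q a x :=
  integral_nonneg fun _ => weight_nonneg hC _ _

lemma hasDerivAt_integral_Iic {E : Type*} [NormedAddCommGroup E] [NormedSpace ℝ E]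
    [CompleteSpace E] {f : ℝ → E} (hf : Continuous f) (hi : ∀ a, IntegrableOn f (Set.Iic a))
    (x : ℝ) : HasDerivAt (fun x => ∫ y in Set.Iic x, f y) (f x) x := by
  have h : (fun x => ∫ y in Set.Iic x, f y) =
      fun x => (∫ y in Set.Iic 0, f y) + ∫ y in (0)..x, f y := by
    ext x
    rw [← intervalIntegral.integral_Iic_sub_Iic (hi 0) (hi x)]
    abel
  rw [h]
  exact (intervalIntegral.integral_hasDerivAt_right (hf.intervalIntegrable _ _)
    (hf.stronglyMeasurableAtFilter _ _) hf.continuousAt).const_add _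

lemma tendsto_integral_Iic_atBot {E : Type*} [NormedAddCommGroup E] [NormedSpace ℝ E]
    [CompleteSpace E] {f : ℝ → E} {a : ℝ} (hi : IntegrableOn f (Set.Iic a)) :
    Tendsto (fun x => ∫ y in Set.Iic x, f y) atBot (𝓝 0) := by
  have h1 := intervalIntegral_tendsto_integral_Iic a hi tendsto_id
  have h2 : Tendsto (fun x => (∫ y in Set.Iic a, f y) - ∫ y in x..a, f y) atBot (𝓝 0) := by
    simpa using (tendsto_const_nhds (x := ∫ y in Set.Iic a, f y)).sub h1
  refine h2.congr' ?_
  filter_upwards [eventually_le_atBot a] with x hx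
  rw [← intervalIntegral.integral_Iic_sub_Iic (hi.mono_set (Set.Iic_subset_Iic.2 hx)) hi]
  abel

lemma integrableOn_Iic_of_continuous {E : Type*} [NormedAddCommGroup E]
    {f : ℝ → E} (hf : Continuous f) {a : ℝ} (hi : IntegrableOn f (Set.Iic a)) (b : ℝ) :
    IntegrableOn f (Set.Iic b) := by
  refine (hi.union (hf.integrableOn_Icc (a := a) (b := b))).mono_set fun y hy => ?_
  rcases le_total y a with h | h
  · exact Or.inl h
  · exact Or.inr ⟨h, hy⟩

lemma LeftAdmissible.integral_weight_pow (h : LeftAdmissible G θ Q l κ) (hC : 0 ≤ C) (a : ℝ)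
    (n : ℕ) (x : ℝ) :
    IntegrableOn (fun y => weight C κ Q a y * (weightInt C κ Q a y ^ n / n.factorial))
      (Set.Iic x) ∧
    ∫ y in Set.Iic x, weight C κ Q a y * (weightInt C κ Q a y ^ n / n.factorial) =
      weightInt C κ Q a x ^ (n + 1) / (n + 1).factorial := by
  have hW : ∀ x, HasDerivAt (weightInt C κ Q a) (weight C κ Q a x) x :=
    hasDerivAt_integral_Iic (h.continuous_weight C a) (h.integrableOn_weight C a)
  have hWc : Continuous (weightInt C κ Q a) :=
    continuous_iff_continuousAt.2 fun x => (hW x).continuousAt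
  have hmono : ∀ y ≤ x, weightInt C κ Q a y ≤ weightInt C κ Q a x := fun y hy =>
    setIntegral_mono_set (h.integrableOn_weight C a x)
      (Eventually.of_forall fun _ => weight_nonneg hC _ _)
      (Set.Iic_subset_Iic.2 hy).eventuallyLE
  have hint : IntegrableOn (fun y => weight C κ Q a y * (weightInt C κ Q a y ^ n / n.factorial))
      (Set.Iic x) := by
    refine Integrable.mono' ((h.integrableOn_weight C a x).mul_const
      (weightInt C κ Q a x ^ n / n.factorial)) ?_ ?_
    · have := h.continuous_weight C a
      exact Continuous.aestronglyMeasurable (by fun_prop)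
    · refine (ae_restrict_iff' measurableSet_Iic).2 (Eventually.of_forall fun y hy => ?_)
      have h0 := weightInt_nonneg (κ := κ) (Q := Q) hC a y
      have h1 := weight_nonneg (κ := κ) (Q := Q) hC a y
      have h2 := hmono y hy
      rw [Real.norm_of_nonneg (by positivity)]
      gcongr
  refine ⟨hint, ?_⟩
  have hd : ∀ y, HasDerivAt (fun y => weightInt C κ Q a y ^ (n + 1) / (n + 1).factorial)
      (weight C κ Q a y * (weightInt C κ Q a y ^ n / n.factorial)) y := fun y => by
    refine (((hW y).fun_pow (n + 1)).div_const ((n + 1).factorial : ℝ)).congr_deriv ?_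
    rw [Nat.factorial_succ]
    have : (n.factorial : ℝ) ≠ 0 := by positivity
    push_cast
    field_simp
  have hlim : Tendsto (fun y => weightInt C κ Q a y ^ (n + 1) / (n + 1).factorial) atBot (𝓝 0) := by
    have := ((tendsto_integral_Iic_atBot (h.integrableOn_weight C a 0)).pow (n + 1)).div_const
      ((n + 1).factorial : ℝ)
    simpa [weightInt] using this
  rw [integral_Iic_of_hasDerivAt_of_tendsto' (fun y _ => hd y) hint hlim, sub_zero]

lemma LeftAdmissible.norm_kernel_le (h : LeftAdmissible G θ Q l κ)
    (hC : 3 * (entrySum G * entrySum G⁻¹) ≤ C) {a x y : ℝ} (hx : x ≤ a) (hy : y ≤ x) (v : C3) :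
    ‖(jostKernel G θ l (x - y) * Q y) *ᵥ v‖ ≤ weight C κ Q a y * ‖v‖ := by
  refine (norm_mulVec_le _ _).trans (mul_le_mul_of_nonneg_right ?_ (norm_nonneg v))
  refine (entrySum_mul_le _ _).trans ?_
  have h1 := entrySum_jostKernel_le (G := G) h.rate (sub_nonneg.2 hy)
  have h2 : Real.exp (κ * (x - y)) ≤ Real.exp (κ * |a|) * Real.exp (κ * |y|) := by
    rw [← Real.exp_add, Real.exp_le_exp, ← mul_add]
    exact mul_le_mul_of_nonneg_left (by linarith [le_abs_self a, neg_abs_le y]) h.rate_nonneg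
  have h0 : 0 ≤ 3 * (entrySum G * entrySum G⁻¹) := by
    have := entrySum_nonneg G
    have := entrySum_nonneg G⁻¹
    positivity
  calc entrySum (jostKernel G θ l (x - y)) * entrySum (Q y)
      ≤ (C * (Real.exp (κ * |a|) * Real.exp (κ * |y|))) * entrySum (Q y) := by
        refine mul_le_mul_of_nonneg_right (h1.trans ?_) (entrySum_nonneg _)
        exact mul_le_mul hC h2 (Real.exp_pos _).le (h0.trans hC)
    _ = weight C κ Q a y := by unfold weight; ring

lemma LeftAdmissible.continuous_integrand (h : LeftAdmissible G θ Q l κ) {f : ℝ → C3}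
    (hf : Continuous f) (x : ℝ) :
    Continuous fun y => (jostKernel G θ l (x - y) * Q y) *ᵥ f y := by
  have h1 := (continuous_jostKernel (θ := θ) (l := l) h.det).comp
    (continuous_const.sub continuous_id : Continuous fun y => x - y)
  exact (h1.matrix_mul h.cont).matrix_mulVec hf

/-- One step of the Neumann series. -/
lemma LeftAdmissible.norm_step_le (h : LeftAdmissible G θ Q l κ)
    (hC : 3 * (entrySum G * entrySum G⁻¹) ≤ C) {a : ℝ} {f : ℝ → C3} (hf : Continuous f)
    {B : ℝ} {n : ℕ} (hB : ∀ y ≤ a, ‖f y‖ ≤ B * (weightInt C κ Q a y ^ n / n.factorial))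
    {x : ℝ} (hx : x ≤ a) :
    IntegrableOn (fun y => (jostKernel G θ l (x - y) * Q y) *ᵥ f y) (Set.Iic x) ∧
    ∫ y in Set.Iic x, ‖(jostKernel G θ l (x - y) * Q y) *ᵥ f y‖ ≤
      B * (weightInt C κ Q a x ^ (n + 1) / (n + 1).factorial) := by
  have hC0 : 0 ≤ C := le_trans (by
    have := entrySum_nonneg G
    have := entrySum_nonneg G⁻¹
    positivity) hC
  obtain ⟨hi, he⟩ := h.integral_weight_pow hC0 a n x
  have hi' := hi.const_mul B
  have hle : ∀ y ∈ Set.Iic x, ‖(jostKernel G θ l (x - y) * Q y) *ᵥ f y‖ ≤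
      B * (weight C κ Q a y * (weightInt C κ Q a y ^ n / n.factorial)) := fun y hy => by
    refine (h.norm_kernel_le hC hx hy _).trans ?_
    have := mul_le_mul_of_nonneg_left (hB y (le_trans hy hx))
      (weight_nonneg (κ := κ) (Q := Q) hC0 a y)
    linarith
  have hint : IntegrableOn (fun y => (jostKernel G θ l (x - y) * Q y) *ᵥ f y) (Set.Iic x) :=
    Integrable.mono' hi' (h.continuous_integrand hf x).aestronglyMeasurable
      ((ae_restrict_iff' measurableSet_Iic).2 (Eventually.of_forall hle))
  refine ⟨hint, ?_⟩
  rw [← he, ← integral_const_mul]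
  exact setIntegral_mono_on hint.norm hi' measurableSet_Iic hle

lemma LeftAdmissible.integrableOn_kernel (h : LeftAdmissible G θ Q l κ) {f : ℝ → C3}
    (hf : Continuous f) (hb : ∀ a : ℝ, ∃ C : ℝ, ∀ x ≤ a, ‖f x‖ ≤ C) (x : ℝ) :
    IntegrableOn (fun y => (jostKernel G θ l (x - y) * Q y) *ᵥ f y) (Set.Iic x) := by
  obtain ⟨B, hB⟩ := hb x
  exact (h.norm_step_le le_rfl hf (n := 0) (B := B) (by simpa using hB) le_rfl).1

/-- The derivative of the integral term of the Volterra equation. The kernel is factored by its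
group property, so that only the upper limit of the integral depends on `x`. -/
lemma LeftAdmissible.hasDerivAt_integral (h : LeftAdmissible G θ Q l κ) {f : ℝ → C3}
    (hf : Continuous f) (hb : ∀ a : ℝ, ∃ C : ℝ, ∀ x ≤ a, ‖f x‖ ≤ C) (x : ℝ) :
    HasDerivAt (fun x => ∫ y in Set.Iic x, (jostKernel G θ l (x - y) * Q y) *ᵥ f y)
      (jostGen G θ l *ᵥ (∫ y in Set.Iic x, (jostKernel G θ l (x - y) * Q y) *ᵥ f y)
        + Q x *ᵥ f x) x := by
  set g : ℝ → C3 := fun y => (jostKernel G θ l (0 - y) * Q y) *ᵥ f y with hg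
  have hgc : Continuous g := h.continuous_integrand hf 0
  have hgi : ∀ a, IntegrableOn g (Set.Iic a) :=
    integrableOn_Iic_of_continuous hgc (h.integrableOn_kernel hf hb 0)
  have hfac : ∀ x y, (jostKernel G θ l (x - y) * Q y) *ᵥ f y = jostKernel G θ l x *ᵥ g y := by
    intro x y
    rw [hg, sub_eq_add_neg, jostKernel_add h.det]
    simp [Matrix.mulVec_mulVec, Matrix.mul_assoc]
  have hint : ∀ x, ∫ y in Set.Iic x, (jostKernel G θ l (x - y) * Q y) *ᵥ f y =
      jostKernel G θ l x *ᵥ ∫ y in Set.Iic x, g y := fun x => by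
    simp only [hfac, mulVec_integral _ (hgi x)]
  have hd := (hasMatDerivAt_jostKernel (θ := θ) (l := l) h.det x).mulVec
    (hasDerivAt_integral_Iic hgc hgi x)
  simp only [hint]
  convert hd using 1
  rw [← hfac, sub_self, jostKernel_zero h.det, Matrix.one_mul, Matrix.mulVec_mulVec]

lemma LeftAdmissible.jostIter_props (h : LeftAdmissible G θ Q l κ) (n : ℕ) :
    Continuous (jostIter G θ Q l n) ∧
    ∀ C, 3 * (entrySum G * entrySum G⁻¹) ≤ C → ∀ a, ∀ x ≤ a, ‖jostIter G θ Q l n x‖ ≤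
      ‖Gᵀ l‖ * (weightInt C κ Q a x ^ n / n.factorial) := by
  induction n with
  | zero =>
    refine ⟨continuous_const, fun C hC a x _ => ?_⟩
    simp [jostIter]
  | succ n ih =>
    have hb : ∀ a : ℝ, ∃ C : ℝ, ∀ x ≤ a, ‖jostIter G θ Q l n x‖ ≤ C := fun a => by
      set C := 3 * (entrySum G * entrySum G⁻¹)
      have hC0 : 0 ≤ C := by
        have := entrySum_nonneg G
        have := entrySum_nonneg G⁻¹
        positivity
      refine ⟨‖Gᵀ l‖ * (weightInt C κ Q a a ^ n / n.factorial), fun x hx => ?_⟩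
      refine (ih.2 C le_rfl a x hx).trans ?_
      have h1 := weightInt_nonneg (κ := κ) (Q := Q) hC0 a x
      have : weightInt C κ Q a x ≤ weightInt C κ Q a a :=
        setIntegral_mono_set (h.integrableOn_weight C a a)
          (Eventually.of_forall fun _ => weight_nonneg hC0 _ _)
          (Set.Iic_subset_Iic.2 hx).eventuallyLE
      gcongr
    refine ⟨continuous_iff_continuousAt.2 fun x =>
      (h.hasDerivAt_integral ih.1 hb x).continuousAt, fun C hC a x hx => ?_⟩
    exact (norm_integral_le_integral_norm _).trans
      (h.norm_step_le hC ih.1 (ih.2 C hC a) hx).2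

/-- A bound of the terms of the Neumann series which is uniform on half-lines. -/
lemma LeftAdmissible.norm_jostIter_le (h : LeftAdmissible G θ Q l κ)
    (hC : 3 * (entrySum G * entrySum G⁻¹) ≤ C) {a x : ℝ} (hx : x ≤ a) (n : ℕ) :
    ‖jostIter G θ Q l n x‖ ≤ ‖Gᵀ l‖ * (weightInt C κ Q a a ^ n / n.factorial) := by
  have hC0 : 0 ≤ C := le_trans (by
    have := entrySum_nonneg G
    have := entrySum_nonneg G⁻¹
    positivity) hC
  refine ((h.jostIter_props n).2 C hC a x hx).trans ?_
  have h1 := weightInt_nonneg (κ := κ) (Q := Q) hC0 a x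
  have : weightInt C κ Q a x ≤ weightInt C κ Q a a :=
    setIntegral_mono_set (h.integrableOn_weight C a a)
      (Eventually.of_forall fun _ => weight_nonneg hC0 _ _)
      (Set.Iic_subset_Iic.2 hx).eventuallyLE
  gcongr

lemma summable_weightInt (B C κ : ℝ) (Q : ℝ → Mat3) (a x : ℝ) :
    Summable fun n : ℕ => B * (weightInt C κ Q a x ^ n / n.factorial) :=
  (Real.summable_pow_div_factorial _).mul_left _

/-- The Neumann series solves the Volterra equation. -/
theorem LeftAdmissible.isLeftJost_tsum (h : LeftAdmissible G θ Q l κ) :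
    IsLeftJost G θ Q l fun x => ∑' n, jostIter G θ Q l n x := by
  set C := 3 * (entrySum G * entrySum G⁻¹) with hCdef
  have hsum : ∀ a, Summable fun n : ℕ => ‖Gᵀ l‖ * (weightInt C κ Q a a ^ n / n.factorial) :=
    fun a => summable_weightInt _ _ _ _ _ _
  have hs : ∀ x, Summable fun n => jostIter G θ Q l n x := fun x =>
    Summable.of_norm_bounded (hsum x) fun n => h.norm_jostIter_le le_rfl le_rfl n
  refine ⟨?_, fun a => ?_, fun x => ?_⟩
  · refine continuous_iff_continuousAt.2 fun x => ?_
    have : ContinuousOn (fun x => ∑' n, jostIter G θ Q l n x) (Set.Iic (x + 1)) :=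
      continuousOn_tsum (fun n => (h.jostIter_props n).1.continuousOn) (hsum (x + 1))
        fun n y hy => h.norm_jostIter_le le_rfl hy n
    exact this.continuousAt (Iic_mem_nhds (by linarith))
  · exact ⟨_, fun x hx => tsum_of_norm_bounded (hsum a).hasSum
      fun n => h.norm_jostIter_le le_rfl hx n⟩
  · have hstep := fun n => h.norm_step_le le_rfl (h.jostIter_props n).1
      ((h.jostIter_props n).2 C le_rfl x) le_rfl
    have hnorm : Summable fun n => ∫ y in Set.Iic x,
        ‖(jostKernel G θ l (x - y) * Q y) *ᵥ jostIter G θ Q l n y‖ :=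
      Summable.of_nonneg_of_le (fun n => integral_nonneg fun _ => norm_nonneg _)
        (fun n => (hstep n).2) ((summable_nat_add_iff 1).2 (summable_weightInt _ C κ Q x x))
    have hint := hasSum_integral_of_summable_integral_norm (fun n => (hstep n).1) hnorm
    have hcongr : ∀ y, ∑' n, (jostKernel G θ l (x - y) * Q y) *ᵥ jostIter G θ Q l n y =
        (jostKernel G θ l (x - y) * Q y) *ᵥ ∑' n, jostIter G θ Q l n y := fun y =>
      ((mulVecCLM (jostKernel G θ l (x - y) * Q y)).map_tsum (hs y)).symm
    simp only [hcongr] at hint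
    rw [(hs x).tsum_eq_zero_add, ← hint.tsum_eq]
    rfl

/-- The difference of two solutions, which are bounded on half-lines, satisfies the homogeneous
equation; iterating it bounds the difference by the terms of an exponential series. -/
theorem LeftAdmissible.unique (h : LeftAdmissible G θ Q l κ) {f g : ℝ → C3}
    (hf : IsLeftJost G θ Q l f) (hg : IsLeftJost G θ Q l g) : f = g := by
  set C := 3 * (entrySum G * entrySum G⁻¹)
  have hdc : Continuous fun x => f x - g x := hf.continuous.sub hg.continuous
  have hd : ∀ x, f x - g x = ∫ y in Set.Iic x, (jostKernel G θ l (x - y) * Q y) *ᵥ (f y - g y) := by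
    intro x
    rw [hf.volterra x, hg.volterra x, add_sub_add_left_eq_sub, ← integral_sub
      (h.integrableOn_kernel hf.continuous hf.bounded x)
      (h.integrableOn_kernel hg.continuous hg.bounded x)]
    simp only [Matrix.mulVec_sub]
  ext1 a
  obtain ⟨B₁, h₁⟩ := hf.bounded a
  obtain ⟨B₂, h₂⟩ := hg.bounded a
  have key : ∀ n : ℕ, ∀ x ≤ a,
      ‖f x - g x‖ ≤ (B₁ + B₂) * (weightInt C κ Q a x ^ n / n.factorial) := by
    intro n
    induction n with
    | zero =>
      intro x hx
      simpa using (norm_sub_le _ _).trans (add_le_add (h₁ x hx) (h₂ x hx))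
    | succ n ih =>
      intro x hx
      rw [hd x]
      exact (norm_integral_le_integral_norm _).trans (h.norm_step_le le_rfl hdc ih hx).2
  have hlim : Tendsto (fun n : ℕ => (B₁ + B₂) * (weightInt C κ Q a a ^ n / n.factorial)) atTop
      (𝓝 0) := (summable_weightInt _ C κ Q a a).tendsto_atTop_zero
  have := ge_of_tendsto' hlim fun n => key n a le_rfl
  exact sub_eq_zero.1 (norm_le_zero_iff.1 this)

theorem LeftAdmissible.leftJost_spec (h : LeftAdmissible G θ Q l κ) :
    IsLeftJost G θ Q l (leftJost G θ Q l) :=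
  Classical.epsilon_spec ⟨_, h.isLeftJost_tsum⟩

theorem LeftAdmissible.eq_leftJost (h : LeftAdmissible G θ Q l κ) {f : ℝ → C3}
    (hf : IsLeftJost G θ Q l f) : f = leftJost G θ Q l :=
  h.unique hf h.leftJost_spec

theorem LeftAdmissible.leftJost_eq_tsum (h : LeftAdmissible G θ Q l κ) :
    leftJost G θ Q l = fun x => ∑' n, jostIter G θ Q l n x :=
  (h.eq_leftJost h.isLeftJost_tsum).symm

theorem LeftAdmissible.hasDerivAt (h : LeftAdmissible G θ Q l κ) (x : ℝ) :
    HasDerivAt (leftJost G θ Q l) ((jostGen G θ l + Q x) *ᵥ leftJost G θ Q l x) x := by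
  have hs := h.leftJost_spec
  have hd := (h.hasDerivAt_integral hs.continuous hs.bounded x).const_add (Gᵀ l)
  have hgen : jostGen G θ l *ᵥ Gᵀ l = 0 := by
    rw [transpose_eq_mulVec_single, jostGen, Matrix.mulVec_mulVec, Matrix.mul_assoc,
      Matrix.nonsing_inv_mul _ h.det, Matrix.mul_one, ← Matrix.mulVec_mulVec,
      Matrix.diagonal_mulVec_single]
    simp
  rw [show leftJost G θ Q l = fun x => Gᵀ l +
    ∫ y in Set.Iic x, (jostKernel G θ l (x - y) * Q y) *ᵥ leftJost G θ Q l y from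
    funext hs.volterra]
  refine hd.congr_deriv ?_
  beta_reduce
  rw [← hs.volterra x, Matrix.add_mulVec]
  congr 1
  conv_rhs => rw [hs.volterra x]
  rw [Matrix.mulVec_add, hgen, zero_add]

/-- The eigenfunction approaches its normalization faster than `e^{-κ|x|}`. -/
theorem LeftAdmissible.tendsto (h : LeftAdmissible G θ Q l κ) :
    Tendsto (fun x => Real.exp (κ * |x|) * ‖leftJost G θ Q l x - Gᵀ l‖) atBot (𝓝 0) := by
  set C := 3 * (entrySum G * entrySum G⁻¹)
  have hs := h.leftJost_spec
  obtain ⟨B, hB⟩ := hs.bounded 0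
  have hlim : Tendsto (fun x => C * B * ∫ y in Set.Iic x, Real.exp (κ * |y|) * entrySum (Q y))
      atBot (𝓝 0) := by
    simpa using (tendsto_integral_Iic_atBot (h.integ 0)).const_mul (C * B)
  refine squeeze_zero' (Eventually.of_forall fun x => by positivity) ?_ hlim
  filter_upwards [eventually_le_atBot 0] with x hx
  have hle : ∀ y ∈ Set.Iic x, ‖(jostKernel G θ l (x - y) * Q y) *ᵥ leftJost G θ Q l y‖ ≤
      C * B * Real.exp (-(κ * |x|)) * (Real.exp (κ * |y|) * entrySum (Q y)) := fun y hy => by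
    have hyx : y ≤ x := hy
    refine (norm_mulVec_le _ _).trans ?_
    have h1 := entrySum_jostKernel_le (G := G) h.rate (sub_nonneg.2 hyx)
    have h2 : Real.exp (κ * (x - y)) = Real.exp (-(κ * |x|)) * Real.exp (κ * |y|) := by
      rw [← Real.exp_add, abs_of_nonpos hx, abs_of_nonpos (hyx.trans hx)]
      congr 1
      ring
    rw [h2] at h1
    calc entrySum (jostKernel G θ l (x - y) * Q y) * ‖leftJost G θ Q l y‖
        ≤ (C * (Real.exp (-(κ * |x|)) * Real.exp (κ * |y|)) * entrySum (Q y)) * B := by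
          refine mul_le_mul ((entrySum_mul_le _ _).trans ?_) (hB y (hyx.trans hx)) (norm_nonneg _)
            ?_
          · exact mul_le_mul_of_nonneg_right h1 (entrySum_nonneg _)
          · have := entrySum_nonneg (Q y)
            have := entrySum_nonneg G
            have := entrySum_nonneg G⁻¹
            positivity
      _ = _ := by ring
  have hnorm : ‖leftJost G θ Q l x - Gᵀ l‖ ≤ C * B * Real.exp (-(κ * |x|)) *
      ∫ y in Set.Iic x, Real.exp (κ * |y|) * entrySum (Q y) := by
    rw [hs.volterra x, add_sub_cancel_left, ← integral_const_mul]
    refine (norm_integral_le_integral_norm _).trans ?_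
    exact setIntegral_mono_on (h.integrableOn_kernel hs.continuous hs.bounded x).norm
      ((h.integ x).const_mul _) measurableSet_Iic hle
  calc Real.exp (κ * |x|) * ‖leftJost G θ Q l x - Gᵀ l‖
      ≤ Real.exp (κ * |x|) * (C * B * Real.exp (-(κ * |x|)) *
        ∫ y in Set.Iic x, Real.exp (κ * |y|) * entrySum (Q y)) := by gcongr
    _ = (Real.exp (κ * |x|) * Real.exp (-(κ * |x|))) * (C * B *
        ∫ y in Set.Iic x, Real.exp (κ * |y|) * entrySum (Q y)) := by ring
    _ = _ := by rw [← Real.exp_add]; simp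

lemma LeftAdmissible.tendsto_normalization (h : LeftAdmissible G θ Q l κ) :
    Tendsto (leftJost G θ Q l) atBot (𝓝 (Gᵀ l)) := by
  refine tendsto_iff_norm_sub_tendsto_zero.2 ?_
  refine squeeze_zero (fun _ => norm_nonneg _) (fun x => ?_) h.tendsto
  have : 1 ≤ Real.exp (κ * |x|) := Real.one_le_exp (mul_nonneg h.rate_nonneg (abs_nonneg x))
  nlinarith [norm_nonneg (leftJost G θ Q l x - Gᵀ l)]

/-- A solution of the differential equation which approaches the normalization faster than
`e^{-κ|x|}` solves the Volterra equation. -/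
theorem LeftAdmissible.eq_of_hasDerivAt (h : LeftAdmissible G θ Q l κ) {f : ℝ → C3}
    (hd : ∀ x, HasDerivAt f ((jostGen G θ l + Q x) *ᵥ f x) x)
    (hlim : Tendsto (fun x => Real.exp (κ * |x|) * ‖f x - Gᵀ l‖) atBot (𝓝 0)) :
    f = leftJost G θ Q l := by
  refine h.eq_leftJost ?_
  have hc : Continuous f := continuous_iff_continuousAt.2 fun x => (hd x).continuousAt
  have hb : ∀ a : ℝ, ∃ C : ℝ, ∀ x ≤ a, ‖f x‖ ≤ C := fun a => by
    obtain ⟨b, hb⟩ := eventually_atBot.1 (hlim.eventually_le_const (show (0 : ℝ) < 1 by norm_num))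
    obtain ⟨C, hC⟩ := (isCompact_Icc (a := b) (b := a)).exists_bound_of_continuousOn hc.continuousOn
    refine ⟨max C (1 + ‖Gᵀ l‖), fun x hx => ?_⟩
    rcases le_total x b with hxb | hxb
    · refine le_max_of_le_right ?_
      have h1 := hb x hxb
      have h2 : 1 ≤ Real.exp (κ * |x|) := Real.one_le_exp (mul_nonneg h.rate_nonneg (abs_nonneg x))
      have h3 : ‖f x - Gᵀ l‖ ≤ 1 := by nlinarith [norm_nonneg (f x - Gᵀ l)]
      have h4 := norm_add_le (f x - Gᵀ l) (Gᵀ l)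
      rw [sub_add_cancel] at h4
      linarith
    · exact le_max_of_le_left (hC x ⟨hxb, hx⟩)
  refine ⟨hc, hb, fun x => ?_⟩
  -- variation of constants: the integrand of the Volterra equation is a derivative
  have hder : ∀ y, HasDerivAt (fun y => jostKernel G θ l (x - y) *ᵥ f y)
      ((jostKernel G θ l (x - y) * Q y) *ᵥ f y) y := fun y => by
    have hk : HasMatDerivAt (fun y => jostKernel G θ l (x - y))
        (-(jostGen G θ l * jostKernel G θ l (x - y))) y := fun i j => by
      refine (HasDerivAt.scomp (h := fun y => x - y) y
        (hasMatDerivAt_jostKernel (θ := θ) (l := l) h.det (x - y) i j)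
        ((hasDerivAt_id y).const_sub x)).congr_deriv ?_
      simp
    refine (hk.mulVec (hd y)).congr_deriv ?_
    have hcomm : jostGen G θ l * jostKernel G θ l (x - y) =
        jostKernel G θ l (x - y) * jostGen G θ l := by
      unfold jostGen jostKernel
      rw [show ∀ E F : Mat3, G * E * G⁻¹ * (G * F * G⁻¹) = G * E * (G⁻¹ * G) * F * G⁻¹ from
        fun E F => by simp only [Matrix.mul_assoc],
        show ∀ E F : Mat3, G * E * G⁻¹ * (G * F * G⁻¹) = G * E * (G⁻¹ * G) * F * G⁻¹ from
        fun E F => by simp only [Matrix.mul_assoc], Matrix.nonsing_inv_mul _ h.det]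
      simp only [Matrix.mul_one, Matrix.mul_assoc G, Matrix.diagonal_mul_diagonal]
      congr 3
      ext j
      ring
    rw [hcomm, Matrix.add_mulVec, Matrix.mulVec_add, Matrix.neg_mulVec, Matrix.mulVec_mulVec,
      Matrix.mulVec_mulVec]
    abel
  have hlim' : Tendsto (fun y => jostKernel G θ l (x - y) *ᵥ f y) atBot (𝓝 (Gᵀ l)) := by
    refine tendsto_iff_norm_sub_tendsto_zero.2 ?_
    have hlim2 : Tendsto (fun y => (3 * (entrySum G * entrySum G⁻¹) * Real.exp (κ * |x|)) *
        (Real.exp (κ * |y|) * ‖f y - Gᵀ l‖)) atBot (𝓝 0) := by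
      simpa using hlim.const_mul _
    refine squeeze_zero' (Eventually.of_forall fun _ => norm_nonneg _) ?_ hlim2
    filter_upwards [eventually_le_atBot x] with y hy
    conv_lhs => rw [← jostKernel_mulVec_col (θ := θ) (l := l) h.det (x - y)]
    rw [← Matrix.mulVec_sub]
    refine (norm_mulVec_le _ _).trans ?_
    have h1 := entrySum_jostKernel_le (G := G) h.rate (sub_nonneg.2 hy)
    have h2 : Real.exp (κ * (x - y)) ≤ Real.exp (κ * |x|) * Real.exp (κ * |y|) := by
      rw [← Real.exp_add, Real.exp_le_exp, ← mul_add]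
      exact mul_le_mul_of_nonneg_left (by linarith [le_abs_self x, neg_abs_le y]) h.rate_nonneg
    have h3 := entrySum_nonneg G
    have h4 := entrySum_nonneg G⁻¹
    calc entrySum (jostKernel G θ l (x - y)) * ‖f y - Gᵀ l‖
        ≤ (3 * (entrySum G * entrySum G⁻¹) * (Real.exp (κ * |x|) * Real.exp (κ * |y|))) *
          ‖f y - Gᵀ l‖ := by
          refine mul_le_mul_of_nonneg_right (h1.trans ?_) (norm_nonneg _)
          gcongr
      _ = _ := by ring
  rw [integral_Iic_of_hasDerivAt_of_tendsto' (fun y _ => hder y) (h.integrableOn_kernel hc hb x)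
    hlim', sub_self, jostKernel_zero h.det, Matrix.one_mulVec]
  abel

end Volterra

/-! ### Dependence on the spectral parameter -/

/-- An integral of holomorphic functions with an integrable bound is holomorphic; the bound of the
derivative that differentiation under the integral asks for comes from Cauchy's estimate. -/
lemma differentiableOn_integral_of_norm_le {F : ℂ → ℝ → C3} {U : Set ℂ} (hU : IsOpen U)
    {s : Set ℝ} (hs : MeasurableSet s) {b : ℝ → ℝ} (hb : IntegrableOn b s)
    (hF : ∀ y ∈ s, DifferentiableOn ℂ (fun z => F z y) U)
    (hm : ∀ z ∈ U, AEStronglyMeasurable (F z) (volume.restrict s))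
    (hle : ∀ z ∈ U, ∀ y ∈ s, ‖F z y‖ ≤ b y) :
    DifferentiableOn ℂ (fun z => ∫ y in s, F z y) U := by
  intro z₀ hz₀
  obtain ⟨ε, hε, hball⟩ := Metric.isOpen_iff.1 hU z₀ hz₀
  set r := ε / 2
  have hr : 0 < r := half_pos hε
  have hmemU : ∀ z ∈ Metric.ball z₀ r, ∀ w ∈ Metric.ball z r, w ∈ U := fun z hz w hw => by
    refine hball ?_
    have h1 := Metric.mem_ball.1 hz
    have h2 := Metric.mem_ball.1 hw
    have := dist_triangle w z z₀
    refine Metric.mem_ball.2 ?_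
    simp only [r] at h1 h2
    linarith
  have hderiv : ∀ y ∈ s, ∀ z ∈ Metric.ball z₀ r,
      HasDerivAt (fun z => F z y) (deriv (fun z => F z y) z) z := fun y hy z hz =>
    ((hF y hy).differentiableAt (hU.mem_nhds (hmemU z hz z (Metric.mem_ball_self hr)))).hasDerivAt
  have hbd : ∀ y ∈ s, ∀ z ∈ Metric.ball z₀ r, ‖deriv (fun z => F z y) z‖ ≤ b y / (r / 2) := by
    intro y hy z hz
    have hcl : Metric.closedBall z (r / 2) ⊆ Metric.ball z r :=
      Metric.closedBall_subset_ball (by linarith)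
    refine Complex.norm_deriv_le_of_forall_mem_sphere_norm_le (by positivity) ?_ fun w hw => ?_
    · refine DifferentiableOn.diffContOnCl ((hF y hy).mono ?_)
      exact Metric.closure_ball_subset_closedBall.trans fun w hw => hmemU z hz w (hcl hw)
    · exact hle w (hmemU z hz w (hcl (Metric.sphere_subset_closedBall hw))) y hy
  have hmeas' : AEStronglyMeasurable (fun y => deriv (fun z => F z y) z₀) (volume.restrict s) := by
    -- the derivative is a limit of difference quotients along a sequence, hence measurable
    have hseq : Tendsto (fun n : ℕ => z₀ + ((r / (n + 2) : ℝ) : ℂ)) atTop (𝓝[≠] z₀) := by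
      refine tendsto_nhdsWithin_iff.2 ⟨?_, Eventually.of_forall fun n => ?_⟩
      · have : Tendsto (fun n : ℕ => r / ((n : ℝ) + 2)) atTop (𝓝 0) :=
          tendsto_const_nhds.div_atTop (tendsto_atTop_add_const_right _ _
            tendsto_natCast_atTop_atTop)
        simpa using ((Complex.continuous_ofReal.tendsto 0).comp this).const_add z₀
      · have : (0 : ℝ) < r / (n + 2) := by positivity
        simp only [Set.mem_compl_iff, Set.mem_singleton_iff, add_eq_left]
        exact_mod_cast this.ne'
    refine aestronglyMeasurable_of_tendsto_ae atTop (f := fun (n : ℕ) y =>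
      slope (fun z => F z y) z₀ (z₀ + ((r / (n + 2) : ℝ) : ℂ))) (fun n => ?_) ?_
    · have h1 : z₀ + ((r / (n + 2) : ℝ) : ℂ) ∈ U := by
        refine hmemU z₀ (Metric.mem_ball_self hr) _ ?_
        rw [Metric.mem_ball, dist_eq_norm, add_sub_cancel_left, Complex.norm_real,
          Real.norm_of_nonneg (by positivity)]
        exact div_lt_self hr (by have := Nat.cast_nonneg (α := ℝ) n; linarith)
      simp only [slope_def_module]
      exact AEStronglyMeasurable.const_smul ((hm _ h1).sub (hm z₀ hz₀))
        ((z₀ + ((r / (n + 2) : ℝ) : ℂ) - z₀)⁻¹ : ℂ)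
    · refine (ae_restrict_iff' hs).2 (Eventually.of_forall fun y hy => ?_)
      exact (hderiv y hy z₀ (Metric.mem_ball_self hr)).tendsto_slope.comp hseq
  refine DifferentiableAt.differentiableWithinAt ?_
  refine (hasDerivAt_integral_of_dominated_loc_of_deriv_le (F := F)
    (F' := fun z y => deriv (fun z => F z y) z) (bound := fun y => b y / (r / 2))
    (Metric.ball_mem_nhds z₀ hr) ?_ ?_ hmeas' ?_ (hb.div_const _) ?_).2.differentiableAt
  · filter_upwards [hU.mem_nhds hz₀] with z hz using hm z hz
  · exact Integrable.mono' hb (hm z₀ hz₀)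
      ((ae_restrict_iff' hs).2 (Eventually.of_forall fun y hy => hle z₀ hz₀ y hy))
  · exact (ae_restrict_iff' hs).2 (Eventually.of_forall hbd)
  · exact (ae_restrict_iff' hs).2 (Eventually.of_forall hderiv)

lemma jostKernel_mul_mulVec_apply (G : Mat3) (θ : Fin 3 → ℂ) (l : Fin 3) (s : ℝ) (q : Mat3)
    (v : C3) (i : Fin 3) : ((jostKernel G θ l s * q) *ᵥ v) i =
      ∑ j, (∑ m, (∑ k, G i k * exp (I * s * (θ k - θ l)) * G⁻¹ k m) * q m j) * v j := by
  simp [Matrix.mulVec, dotProduct, Matrix.mul_apply, jostKernel, Matrix.diagonal_apply]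

section Parameter

variable {G : ℂ → Mat3} {θ : ℂ → Fin 3 → ℂ} {Q : ℝ → Mat3} {l : Fin 3} {A : Set ℂ}

lemma norm_integrand_jostIter_le {B C a x y : ℝ}
    (adm : ∀ z ∈ A, LeftAdmissible (G z) (θ z) Q l 0)
    (hC : ∀ z ∈ A, 3 * (entrySum (G z) * entrySum (G z)⁻¹) ≤ C)
    (hB : ∀ z ∈ A, ‖(G z)ᵀ l‖ ≤ B) (n : ℕ) {z : ℂ} (hz : z ∈ A) (hx : x ≤ a) (hy : y ≤ x) :
    ‖(jostKernel (G z) (θ z) l (x - y) * Q y) *ᵥ jostIter (G z) (θ z) Q l n y‖ ≤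
      weight C 0 Q a y * (B * (weightInt C 0 Q a a ^ n / n.factorial)) := by
  have hC0 : 0 ≤ C := le_trans (by
    have := entrySum_nonneg (G z)
    have := entrySum_nonneg (G z)⁻¹
    positivity) (hC z hz)
  refine ((adm z hz).norm_kernel_le (hC z hz) hx hy _).trans ?_
  refine mul_le_mul_of_nonneg_left ?_ (weight_nonneg hC0 _ _)
  refine ((adm z hz).norm_jostIter_le (hC z hz) (hy.trans hx) n).trans ?_
  have := weightInt_nonneg (κ := 0) (Q := Q) hC0 a a
  exact mul_le_mul_of_nonneg_right (hB z hz) (by positivity)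

lemma continuousOn_jostIter {B C a : ℝ}
    (hG : ∀ i j, ContinuousOn (fun z => G z i j) A)
    (hGi : ∀ i j, ContinuousOn (fun z => (G z)⁻¹ i j) A)
    (hθ : ∀ i, ContinuousOn (fun z => θ z i) A)
    (adm : ∀ z ∈ A, LeftAdmissible (G z) (θ z) Q l 0)
    (hC : ∀ z ∈ A, 3 * (entrySum (G z) * entrySum (G z)⁻¹) ≤ C)
    (hB : ∀ z ∈ A, ‖(G z)ᵀ l‖ ≤ B) (n : ℕ) :
    ∀ x ≤ a, ContinuousOn (fun z => jostIter (G z) (θ z) Q l n x) A := by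
  induction n with
  | zero => exact fun x _ => continuousOn_pi.2 fun i => hG i l
  | succ n ih =>
    intro x hx z₀ hz₀
    refine continuousWithinAt_of_dominated
      (bound := fun y => weight C 0 Q a y * (B * (weightInt C 0 Q a a ^ n / n.factorial)))
      ?_ ?_ (((adm z₀ hz₀).integrableOn_weight C a x).mul_const _) ?_
    · filter_upwards [self_mem_nhdsWithin] with z hz
      exact ((adm z hz).continuous_integrand ((adm z hz).jostIter_props n).1 x).aestronglyMeasurable
    · filter_upwards [self_mem_nhdsWithin] with z hz
      exact (ae_restrict_iff' measurableSet_Iic).2 (Eventually.of_forall fun y hy =>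
        norm_integrand_jostIter_le adm hC hB n hz hx hy)
    · refine (ae_restrict_iff' measurableSet_Iic).2 (Eventually.of_forall fun y hy => ?_)
      refine ContinuousOn.continuousWithinAt ?_ hz₀
      refine continuousOn_pi.2 fun i => ?_
      have hv := continuousOn_pi.1 (ih y (le_trans hy hx))
      simp only [jostKernel_mul_mulVec_apply]
      exact continuousOn_finsetSum _ fun j _ => (continuousOn_finsetSum _ fun m _ =>
        (continuousOn_finsetSum _ fun k _ => ((hG i k).mul (ContinuousOn.cexp
          (continuousOn_const.mul ((hθ k).sub (hθ l))))).mul (hGi k m)).mul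
          continuousOn_const).mul (hv j)

lemma differentiableOn_jostIter {B C a : ℝ} (hA : IsOpen A)
    (hG : ∀ i j, DifferentiableOn ℂ (fun z => G z i j) A)
    (hGi : ∀ i j, DifferentiableOn ℂ (fun z => (G z)⁻¹ i j) A)
    (hθ : ∀ i, DifferentiableOn ℂ (fun z => θ z i) A)
    (adm : ∀ z ∈ A, LeftAdmissible (G z) (θ z) Q l 0)
    (hC : ∀ z ∈ A, 3 * (entrySum (G z) * entrySum (G z)⁻¹) ≤ C)
    (hB : ∀ z ∈ A, ‖(G z)ᵀ l‖ ≤ B) (n : ℕ) :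
    ∀ x ≤ a, DifferentiableOn ℂ (fun z => jostIter (G z) (θ z) Q l n x) A := by
  induction n with
  | zero => exact fun x _ => differentiableOn_pi.2 fun i => hG i l
  | succ n ih =>
    intro x hx
    rcases A.eq_empty_or_nonempty with rfl | ⟨z₁, hz₁⟩
    · exact differentiableOn_empty
    refine differentiableOn_integral_of_norm_le hA measurableSet_Iic
      (b := fun y => weight C 0 Q a y * (B * (weightInt C 0 Q a a ^ n / n.factorial)))
      (((adm z₁ hz₁).integrableOn_weight C a x).mul_const _) ?_ ?_ ?_
    · intro y hy
      refine differentiableOn_pi.2 fun i => ?_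
      have hv := differentiableOn_pi.1 (ih y (le_trans hy hx))
      simp only [jostKernel_mul_mulVec_apply]
      exact DifferentiableOn.fun_sum fun j _ => (DifferentiableOn.fun_sum fun m _ =>
        (DifferentiableOn.fun_sum fun k _ => ((hG i k).mul (DifferentiableOn.cexp
          ((differentiableOn_const _).mul ((hθ k).sub (hθ l))))).mul (hGi k m)).mul
          (differentiableOn_const _)).mul (hv j)
    · intro z hz
      exact ((adm z hz).continuous_integrand ((adm z hz).jostIter_props n).1 x).aestronglyMeasurable
    · intro z hz y hy
      exact norm_integrand_jostIter_le adm hC hB n hz hx hy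

/-- The neighbourhood on which the factors of the kernel are bounded. -/
lemma exists_bound_nhdsWithin
    (hG : ∀ i j, ContinuousOn (fun z => G z i j) A)
    (hGi : ∀ i j, ContinuousOn (fun z => (G z)⁻¹ i j) A) {z₀ : ℂ} (hz₀ : z₀ ∈ A) :
    ∃ B C : ℝ, ∀ᶠ z in 𝓝[A] z₀, 3 * (entrySum (G z) * entrySum (G z)⁻¹) ≤ C ∧ ‖(G z)ᵀ l‖ ≤ B := by
  have h1 : ContinuousOn (fun z => 3 * (entrySum (G z) * entrySum (G z)⁻¹)) A := by
    have h : ∀ F : ℂ → Mat3, (∀ i j, ContinuousOn (fun z => F z i j) A) →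
        ContinuousOn (fun z => entrySum (F z)) A := fun F hF =>
      continuousOn_finsetSum _ fun i _ => continuousOn_finsetSum _ fun j _ => (hF i j).norm
    exact continuousOn_const.mul ((h _ hG).mul (h _ hGi))
  have h2 : ContinuousOn (fun z => ‖(G z)ᵀ l‖) A :=
    (continuousOn_pi.2 fun i => hG i l).norm
  refine ⟨‖(G z₀)ᵀ l‖ + 1, 3 * (entrySum (G z₀) * entrySum (G z₀)⁻¹) + 1, ?_⟩
  filter_upwards [(h1 z₀ hz₀).eventually_le_const (lt_add_one _),
    (h2 z₀ hz₀).eventually_le_const (lt_add_one _)] with z hz hz' using ⟨hz, hz'⟩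

/-- The eigenfunctions depend continuously on the spectral parameter, up to the boundary of the
set on which they exist. -/
theorem continuousOn_leftJost
    (hG : ∀ i j, ContinuousOn (fun z => G z i j) A)
    (hGi : ∀ i j, ContinuousOn (fun z => (G z)⁻¹ i j) A)
    (hθ : ∀ i, ContinuousOn (fun z => θ z i) A)
    (adm : ∀ z ∈ A, LeftAdmissible (G z) (θ z) Q l 0) (x : ℝ) :
    ContinuousOn (fun z => leftJost (G z) (θ z) Q l x) A := by
  intro z₀ hz₀
  obtain ⟨B, C, hev⟩ := exists_bound_nhdsWithin (l := l) hG hGi hz₀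
  set A' := A ∩ {z | 3 * (entrySum (G z) * entrySum (G z)⁻¹) ≤ C ∧ ‖(G z)ᵀ l‖ ≤ B} with hA'
  have hmem : A' ∈ 𝓝[A] z₀ := inter_mem self_mem_nhdsWithin hev
  have hz₀' : z₀ ∈ A' := mem_of_mem_nhdsWithin hz₀ hmem
  have hsub : A' ⊆ A := Set.inter_subset_left
  have hcont : ContinuousOn (fun z => ∑' n, jostIter (G z) (θ z) Q l n x) A' := by
    refine continuousOn_tsum (fun n =>
      continuousOn_jostIter (a := x) (fun i j => (hG i j).mono hsub)
      (fun i j => (hGi i j).mono hsub) (fun i => (hθ i).mono hsub) (fun z hz => adm z (hsub hz))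
      (fun z hz => hz.2.1) (fun z hz => hz.2.2) n x le_rfl)
      (summable_weightInt B C 0 Q x x) fun n z hz => ?_
    refine ((adm z (hsub hz)).norm_jostIter_le hz.2.1 le_rfl n).trans ?_
    have hC0 : 0 ≤ C := le_trans (by
      have := entrySum_nonneg (G z)
      have := entrySum_nonneg (G z)⁻¹
      positivity) hz.2.1
    have := weightInt_nonneg (κ := 0) (Q := Q) hC0 x x
    exact mul_le_mul_of_nonneg_right hz.2.2 (by positivity)
  have hcont' : ContinuousOn (fun z => leftJost (G z) (θ z) Q l x) A' :=
    hcont.congr fun z hz => by rw [(adm z (hsub hz)).leftJost_eq_tsum]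
  exact (hcont' z₀ hz₀').mono_of_mem_nhdsWithin hmem

/-- The eigenfunctions are holomorphic in the interior of the set on which they exist. -/
theorem differentiableOn_leftJost (hA : IsOpen A)
    (hG : ∀ i j, DifferentiableOn ℂ (fun z => G z i j) A)
    (hGi : ∀ i j, DifferentiableOn ℂ (fun z => (G z)⁻¹ i j) A)
    (hθ : ∀ i, DifferentiableOn ℂ (fun z => θ z i) A)
    (adm : ∀ z ∈ A, LeftAdmissible (G z) (θ z) Q l 0) (x : ℝ) :
    DifferentiableOn ℂ (fun z => leftJost (G z) (θ z) Q l x) A := by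
  intro z₀ hz₀
  obtain ⟨B, C, hev⟩ := exists_bound_nhdsWithin (l := l) (fun i j => (hG i j).continuousOn)
    (fun i j => (hGi i j).continuousOn) hz₀
  rw [hA.nhdsWithin_eq hz₀] at hev
  set A' := interior (A ∩ {z | 3 * (entrySum (G z) * entrySum (G z)⁻¹) ≤ C ∧ ‖(G z)ᵀ l‖ ≤ B})
    with hA'
  have hz₀' : z₀ ∈ A' := mem_interior_iff_mem_nhds.2 (inter_mem (hA.mem_nhds hz₀) hev)
  have hsub : A' ⊆ A := interior_subset.trans Set.inter_subset_left
  have hbd : ∀ z ∈ A', 3 * (entrySum (G z) * entrySum (G z)⁻¹) ≤ C ∧ ‖(G z)ᵀ l‖ ≤ B :=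
    fun z hz => (interior_subset hz).2
  have hdiff : DifferentiableOn ℂ (fun z => ∑' n, jostIter (G z) (θ z) Q l n x) A' := by
    refine Complex.differentiableOn_tsum_of_summable_norm (summable_weightInt B C 0 Q x x)
      (fun n => differentiableOn_jostIter (a := x) isOpen_interior (fun i j => (hG i j).mono hsub)
      (fun i j => (hGi i j).mono hsub) (fun i => (hθ i).mono hsub) (fun z hz => adm z (hsub hz))
      (fun z hz => (hbd z hz).1) (fun z hz => (hbd z hz).2) n x le_rfl) isOpen_interior
      fun n z hz => ?_
    refine ((adm z (hsub hz)).norm_jostIter_le (hbd z hz).1 le_rfl n).trans ?_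
    have hC0 : 0 ≤ C := le_trans (by
      have := entrySum_nonneg (G z)
      have := entrySum_nonneg (G z)⁻¹
      positivity) (hbd z hz).1
    have := weightInt_nonneg (κ := 0) (Q := Q) hC0 x x
    exact mul_le_mul_of_nonneg_right (hbd z hz).2 (by positivity)
  have hdiff' : DifferentiableOn ℂ (fun z => leftJost (G z) (θ z) Q l x) A' :=
    hdiff.congr fun z hz => by rw [(adm z (hsub hz)).leftJost_eq_tsum]
  exact (hdiff'.differentiableAt (isOpen_interior.mem_nhds hz₀')).differentiableWithinAt

end Parameter

/-! ### Normalization at `+∞` -/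

/-- The conditions for the normalization at `+∞`, which the reflection `x ↦ -x` turns into the
normalization at `-∞`. -/
abbrev RightAdmissible (G : Mat3) (θ : Fin 3 → ℂ) (Q : ℝ → Mat3) (l : Fin 3) (κ : ℝ) : Prop :=
  LeftAdmissible G (-θ) (fun y => -Q (-y)) l κ

section Reflection

variable {G : Mat3} {θ : Fin 3 → ℂ} {Q : ℝ → Mat3} {l : Fin 3} {κ : ℝ}

lemma jostKernel_neg (s : ℝ) : jostKernel G (-θ) l s = jostKernel G θ l (-s) := by
  unfold jostKernel
  congr 3
  ext j
  congr 1
  push_cast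
  simp only [Pi.neg_apply]
  ring

lemma jostGen_neg : jostGen G (-θ) l = -jostGen G θ l := by
  unfold jostGen
  rw [← Matrix.neg_mul, ← Matrix.mul_neg, Matrix.diagonal_neg]
  congr 3
  ext j
  simp only [Pi.neg_apply]
  ring

lemma isRightJost_iff {f : ℝ → C3} :
    IsRightJost G θ Q l f ↔ IsLeftJost G (-θ) (fun y => -Q (-y)) l fun x => f (-x) := by
  have hint : ∀ x : ℝ, ∫ y in Set.Iic x, (jostKernel G (-θ) l (x - y) * -Q (-y)) *ᵥ f (-y) =
      -∫ y in Set.Ioi (-x), (jostKernel G θ l (-x - y) * Q y) *ᵥ f y := fun x => by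
    rw [← integral_comp_neg_Iic x fun y => (jostKernel G θ l (-x - y) * Q y) *ᵥ f y,
      ← integral_neg]
    congr 1
    ext1 y
    rw [jostKernel_neg, Matrix.mul_neg, Matrix.neg_mulVec]
    congr 4
    ring
  constructor
  · intro h
    refine ⟨h.continuous.comp continuous_neg, fun a => ?_, fun x => ?_⟩
    · obtain ⟨C, hC⟩ := h.bounded (-a)
      exact ⟨C, fun x hx => hC _ (neg_le_neg hx)⟩
    · rw [hint, h.volterra, sub_eq_add_neg]
  · intro h
    refine ⟨?_, fun a => ?_, fun x => ?_⟩
    · simpa [Function.comp_def] using h.continuous.comp continuous_neg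
    · obtain ⟨C, hC⟩ := h.bounded (-a)
      exact ⟨C, fun x hx => by simpa using hC (-x) (neg_le_neg hx)⟩
    · have := h.volterra (-x)
      simp only [neg_neg] at this
      rw [this, hint, neg_neg, sub_eq_add_neg]

theorem RightAdmissible.rightJost_eq (h : RightAdmissible G θ Q l κ) :
    rightJost G θ Q l = fun x => leftJost G (-θ) (fun y => -Q (-y)) l (-x) := by
  have h1 : IsRightJost G θ Q l fun x => leftJost G (-θ) (fun y => -Q (-y)) l (-x) :=
    isRightJost_iff.2 (by simpa using h.leftJost_spec)
  have h2 : IsRightJost G θ Q l (rightJost G θ Q l) := Classical.epsilon_spec ⟨_, h1⟩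
  have h3 := h.eq_leftJost (isRightJost_iff.1 h2)
  ext1 x
  simpa using congrFun h3 (-x)

theorem RightAdmissible.hasDerivAt (h : RightAdmissible G θ Q l κ) (x : ℝ) :
    HasDerivAt (rightJost G θ Q l) ((jostGen G θ l + Q x) *ᵥ rightJost G θ Q l x) x := by
  rw [h.rightJost_eq]
  refine (HasDerivAt.scomp (h := fun y : ℝ => -y) x (LeftAdmissible.hasDerivAt h (-x))
    (hasDerivAt_id x).neg).congr_deriv ?_
  rw [jostGen_neg, neg_neg, ← neg_add, Matrix.neg_mulVec]
  simp

theorem RightAdmissible.tendsto (h : RightAdmissible G θ Q l κ) :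
    Tendsto (fun x => Real.exp (κ * |x|) * ‖rightJost G θ Q l x - Gᵀ l‖) atTop (𝓝 0) := by
  rw [h.rightJost_eq]
  simpa [Function.comp_def] using (LeftAdmissible.tendsto h).comp tendsto_neg_atTop_atBot

theorem RightAdmissible.eq_of_hasDerivAt (h : RightAdmissible G θ Q l κ) {f : ℝ → C3}
    (hd : ∀ x, HasDerivAt f ((jostGen G θ l + Q x) *ᵥ f x) x)
    (hlim : Tendsto (fun x => Real.exp (κ * |x|) * ‖f x - Gᵀ l‖) atTop (𝓝 0)) :
    f = rightJost G θ Q l := by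
  have : (fun x => f (-x)) = leftJost G (-θ) (fun y => -Q (-y)) l := by
    refine LeftAdmissible.eq_of_hasDerivAt h (fun x => ?_) ?_
    · refine (HasDerivAt.scomp (h := fun y : ℝ => -y) x (hd (-x))
        (hasDerivAt_id x).neg).congr_deriv ?_
      rw [jostGen_neg, ← neg_add, Matrix.neg_mulVec]
      simp
    · simpa [Function.comp_def] using hlim.comp tendsto_neg_atBot_atTop
  rw [h.rightJost_eq, ← this]
  simp

end Reflection

/-! ### Evolution in time of the eigenfunctions -/

/-- A two-sided Gronwall estimate on a short interval. -/
lemma norm_le_of_norm_deriv_le {f f' : ℝ → C3} {t₀ δ M ε : ℝ} (hδ : 0 ≤ δ) (hM : 0 ≤ M)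
    (hMδ : M * δ ≤ 1 / 2)
    (hd : ∀ t ∈ Set.Icc (t₀ - δ) (t₀ + δ), HasDerivAt f (f' t) t)
    (hb : ∀ t ∈ Set.Icc (t₀ - δ) (t₀ + δ), ‖f' t‖ ≤ M * ‖f t‖ + ε) :
    ∀ t ∈ Set.Icc (t₀ - δ) (t₀ + δ), ‖f t‖ ≤ 2 * (‖f t₀‖ + δ * ε) := by
  have h0 : t₀ ∈ Set.Icc (t₀ - δ) (t₀ + δ) := ⟨by linarith, by linarith⟩
  obtain ⟨t₁, ht₁, hmax⟩ := (isCompact_Icc (a := t₀ - δ) (b := t₀ + δ)).exists_isMaxOn ⟨t₀, h0⟩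
    (f := fun t => ‖f t‖) (fun t ht => (hd t ht).continuousAt.norm.continuousWithinAt)
  have hbd : ∀ t ∈ Set.Icc (t₀ - δ) (t₀ + δ), ‖f' t‖ ≤ M * ‖f t₁‖ + ε := fun t ht =>
    (hb t ht).trans (by gcongr; exact hmax ht)
  have hpos : 0 ≤ M * ‖f t₁‖ + ε := (norm_nonneg _).trans (hbd t₀ h0)
  have hmv := (convex_Icc (t₀ - δ) (t₀ + δ)).norm_image_sub_le_of_norm_hasDerivWithin_le
    (fun t ht => (hd t ht).hasDerivWithinAt) hbd h0 ht₁
  have hdist : ‖t₁ - t₀‖ ≤ δ := by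
    rw [Real.norm_eq_abs, abs_le]
    exact ⟨by linarith [ht₁.1], by linarith [ht₁.2]⟩
  have h1 : ‖f t₁‖ ≤ ‖f t₀‖ + (M * ‖f t₁‖ + ε) * δ := by
    have h2 := norm_add_le (f t₁ - f t₀) (f t₀)
    rw [sub_add_cancel] at h2
    have h3 := mul_le_mul_of_nonneg_left hdist hpos
    linarith
  have h4 : M * ‖f t₁‖ * δ ≤ ‖f t₁‖ / 2 := by nlinarith [norm_nonneg (f t₁)]
  intro t ht
  have h5 : ‖f t‖ ≤ ‖f t₁‖ := hmax ht
  nlinarith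

/-- A linear system has solutions on a time interval whose length depends only on the size of
its coefficients. -/
lemma exists_solution_linear {A : ℝ → Mat3} {t₀ δ M : ℝ} (hδ : 0 < δ) (hM : 0 ≤ M)
    (hMδ : M * δ ≤ 1 / 4) (hA : Continuous A)
    (hb : ∀ t ∈ Set.Icc (t₀ - 2 * δ) (t₀ + 2 * δ), entrySum (A t) ≤ M) (v : C3) :
    ∃ f : ℝ → C3, f t₀ = v ∧
      ∀ t ∈ Set.Icc (t₀ - δ) (t₀ + δ), HasDerivAt f (A t *ᵥ f t) t := by
  have hmem : t₀ ∈ Set.Icc (t₀ - 2 * δ) (t₀ + 2 * δ) := ⟨by linarith, by linarith⟩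
  have hPL : IsPicardLindelof (fun t x => A t *ᵥ x) (⟨t₀, hmem⟩ : Set.Icc (t₀ - 2 * δ) (t₀ + 2 * δ))
      v ‖v‖₊ 0 (⟨M, hM⟩ * (2 * ‖v‖₊)) ⟨M, hM⟩ := by
    refine ⟨fun t ht => ?_, fun x _ => ?_, fun t ht x hx => ?_, ?_⟩
    · refine LipschitzOnWith.of_dist_le_mul fun x _ y _ => ?_
      rw [dist_eq_norm, dist_eq_norm, ← Matrix.mulVec_sub]
      exact (norm_mulVec_le _ _).trans (mul_le_mul_of_nonneg_right (hb t ht) (norm_nonneg _))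
    · exact (hA.matrix_mulVec continuous_const).continuousOn
    · refine (norm_mulVec_le _ _).trans ?_
      have h1 : ‖x‖ ≤ 2 * ‖v‖ := by
        have h2 := norm_add_le (x - v) v
        rw [sub_add_cancel] at h2
        have h3 : ‖x - v‖ ≤ ‖v‖ := by simpa [dist_eq_norm] using hx
        linarith
      exact mul_le_mul (hb t ht) h1 (norm_nonneg _) hM
    · have h1 : max (t₀ + 2 * δ - t₀) (t₀ - (t₀ - 2 * δ)) = 2 * δ := by
        rw [max_eq_left] <;> ring_nf
        exact le_rfl
      simp only [h1]
      have := norm_nonneg v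
      change M * (2 * ‖v‖) * (2 * δ) ≤ ‖v‖ - 0
      nlinarith [mul_nonneg (sub_nonneg.2 hMδ) this]
  obtain ⟨f, hf0, hf⟩ := hPL.exists_eq_forall_mem_Icc_hasDerivWithinAt₀
  refine ⟨f, hf0, fun t ht => ?_⟩
  exact (hf t ⟨by linarith [ht.1], by linarith [ht.2]⟩).hasDerivAt
    (Icc_mem_nhds (by linarith [ht.1]) (by linarith [ht.2]))

/-- Differentiability in the first variable with a jointly continuous derivative is uniform with
respect to the second variable in a compact set. -/
lemma eventually_entrySum_sub_le {T Tx : ℝ → ℝ → Mat3}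
    (hTx : ∀ x t, HasMatDerivAt (fun x => T x t) (Tx x t) x)
    (hTxc : Continuous fun p : ℝ × ℝ => Tx p.1 p.2) {K : Set ℝ} (hK : IsCompact K) (x : ℝ)
    {c : ℝ} (hc : 0 < c) :
    ∀ᶠ y in 𝓝 x, ∀ t ∈ K,
      entrySum (T y t - T x t - ((y - x : ℝ) : ℂ) • Tx x t) ≤ c * |y - x| := by
  have h1 : ∀ᶠ y in 𝓝 x, ∀ t ∈ K, entrySum (Tx y t - Tx x t) ≤ c / 9 := by
    refine hK.eventually_forall_of_forall_eventually fun t _ => ?_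
    have hcont : Continuous fun p : ℝ × ℝ => entrySum (Tx p.1 p.2 - Tx x p.2) :=
      continuous_entrySum.comp (hTxc.sub (hTxc.comp (continuous_const.prodMk continuous_snd)))
    refine (hcont.tendsto (x, t)).eventually_le_const ?_
    simp only [sub_self]
    simp only [entrySum, Matrix.zero_apply, norm_zero, Finset.sum_const_zero]
    positivity
  obtain ⟨ε, hε, hball⟩ := Metric.eventually_nhds_iff_ball.1 h1
  filter_upwards [Metric.ball_mem_nhds x hε] with y hy t ht
  have hentry : ∀ i j, ‖(T y t - T x t - ((y - x : ℝ) : ℂ) • Tx x t) i j‖ ≤ c / 9 * |y - x| := by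
    intro i j
    have hd : ∀ w ∈ Metric.ball x ε, HasDerivWithinAt
        (fun w => T w t i j - ((w - x : ℝ) : ℂ) * Tx x t i j) (Tx w t i j - Tx x t i j)
        (Metric.ball x ε) w := fun w _ => by
      have h2 : HasDerivAt (fun w : ℝ => ((w - x : ℝ) : ℂ)) 1 w := by
        simpa using ((hasDerivAt_id w).sub_const x).ofReal_comp
      exact ((hTx w t i j).fun_sub ((h2.mul_const (Tx x t i j)).congr_deriv
        (one_mul _))).hasDerivWithinAt
    have := (convex_ball x ε).norm_image_sub_le_of_norm_hasDerivWithin_le hd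
      (C := c / 9) (fun w hw => (norm_entry_le_entrySum (Tx w t - Tx x t) i j).trans
        (hball w hw t ht)) (Metric.mem_ball_self hε) hy
    simp only [Real.norm_eq_abs] at this
    refine le_trans (le_of_eq ?_) this
    congr 1
    simp only [Matrix.sub_apply, Matrix.smul_apply, smul_eq_mul, sub_self, Complex.ofReal_zero,
      zero_mul, sub_zero]
    ring
  calc entrySum (T y t - T x t - ((y - x : ℝ) : ℂ) • Tx x t)
      ≤ ∑ _i : Fin 3, ∑ _j : Fin 3, c / 9 * |y - x| :=
        Finset.sum_le_sum fun i _ => Finset.sum_le_sum fun j _ => hentry i j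
    _ = c * |y - x| := by
        simp only [Finset.sum_const, Finset.card_univ, Fintype.card_fin, nsmul_eq_mul]
        push_cast
        ring

lemma eventually_entrySum_sub_le_const {T : ℝ → ℝ → Mat3}
    (hT : Continuous fun p : ℝ × ℝ => T p.1 p.2) {K : Set ℝ} (hK : IsCompact K) (x : ℝ)
    {c : ℝ} (hc : 0 < c) : ∀ᶠ y in 𝓝 x, ∀ t ∈ K, entrySum (T y t - T x t) ≤ c := by
  refine hK.eventually_forall_of_forall_eventually fun t _ => ?_
  have hcont : Continuous fun p : ℝ × ℝ => entrySum (T p.1 p.2 - T x p.2) :=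
    continuous_entrySum.comp (hT.sub (hT.comp (continuous_const.prodMk continuous_snd)))
  refine (hcont.tendsto (x, t)).eventually_le_const ?_
  simp only [sub_self]
  simpa [entrySum] using hc

/-- Let `X`, `T` satisfy the zero curvature equation. If a family of solutions of the equation in
`t` solves the equation in `x` at the time `t₀`, then it solves the equation in `x` at all nearby
times. -/
lemma hasDerivAt_of_zeroCurvature {X T Xt Tx : ℝ → ℝ → Mat3} {F : ℝ → ℝ → C3} {t₀ δ M : ℝ}
    (hδ : 0 < δ) (hM : 0 ≤ M) (hMδ : M * δ ≤ 1 / 2)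
    (hTM : ∀ x, ∀ t ∈ Set.Icc (t₀ - δ) (t₀ + δ), entrySum (T x t) ≤ M)
    (hXt : ∀ x t, HasMatDerivAt (fun t => X x t) (Xt x t) t)
    (hTx : ∀ x t, HasMatDerivAt (fun x => T x t) (Tx x t) x)
    (hTc : Continuous fun p : ℝ × ℝ => T p.1 p.2)
    (hTxc : Continuous fun p : ℝ × ℝ => Tx p.1 p.2)
    (hzc : ∀ x t, Xt x t + X x t * T x t = Tx x t + T x t * X x t)
    (hFt : ∀ x, ∀ t ∈ Set.Icc (t₀ - δ) (t₀ + δ), HasDerivAt (F x) (T x t *ᵥ F x t) t)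
    (hF0 : ∀ x, HasDerivAt (fun x => F x t₀) (X x t₀ *ᵥ F x t₀) x)
    {t : ℝ} (ht : t ∈ Set.Icc (t₀ - δ) (t₀ + δ)) (x : ℝ) :
    HasDerivAt (fun x => F x t) (X x t *ᵥ F x t) x := by
  set K := Set.Icc (t₀ - δ) (t₀ + δ)
  have hK : IsCompact K := isCompact_Icc
  have hFc : ContinuousOn (F x) K := fun t ht => (hFt x t ht).continuousAt.continuousWithinAt
  have hXFc : ContinuousOn (fun t => X x t *ᵥ F x t) K := fun t ht =>
    ((hXt x t).mulVec (hFt x t ht)).continuousAt.continuousWithinAt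
  obtain ⟨B₁, hB₁⟩ := hK.exists_bound_of_continuousOn hFc
  obtain ⟨B₂, hB₂⟩ := hK.exists_bound_of_continuousOn hXFc
  have hB₁0 : 0 ≤ B₁ := (norm_nonneg _).trans (hB₁ t ht)
  have hB₂0 : 0 ≤ B₂ := (norm_nonneg _).trans (hB₂ t ht)
  rw [hasDerivAt_iff_isLittleO, Asymptotics.isLittleO_iff]
  intro c hc
  set η := c / (2 * (1 + δ * (B₁ + B₂))) with hη
  have hη0 : 0 < η := by positivity
  have hinit := Asymptotics.isLittleO_iff.1 (hasDerivAt_iff_isLittleO.1 (hF0 x)) hη0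
  filter_upwards [eventually_entrySum_sub_le hTx hTxc hK x hη0,
    eventually_entrySum_sub_le_const hTc hK x hη0, hinit] with y h1 h2 h3
  -- the remainder solves the equation in `t` at `y` up to a term of order `o(y - x)`
  set R : ℝ → C3 := fun t => F y t - F x t - ((y - x : ℝ) : ℂ) • (X x t *ᵥ F x t) with hR
  set E : ℝ → C3 := fun t => (T y t - T x t - ((y - x : ℝ) : ℂ) • Tx x t) *ᵥ F x t +
    ((y - x : ℝ) : ℂ) • ((T y t - T x t) *ᵥ (X x t *ᵥ F x t)) with hE
  have hRd : ∀ t ∈ K, HasDerivAt R (T y t *ᵥ R t + E t) t := fun t ht => by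
    refine (((hFt y t ht).sub (hFt x t ht)).sub
      (((hXt x t).mulVec (hFt x t ht)).const_smul ((y - x : ℝ) : ℂ))).congr_deriv ?_
    rw [Matrix.mulVec_mulVec, ← Matrix.add_mulVec, hzc]
    simp only [hR, hE, Matrix.mulVec_sub, Matrix.mulVec_smul, Matrix.sub_mulVec, Matrix.add_mulVec,
      Matrix.smul_mulVec, ← Matrix.mulVec_mulVec, smul_add, smul_sub]
    abel
  have hEb : ∀ t ∈ K, ‖E t‖ ≤ η * (B₁ + B₂) * |y - x| := fun t ht => by
    have e1 : ‖(T y t - T x t - ((y - x : ℝ) : ℂ) • Tx x t) *ᵥ F x t‖ ≤ η * |y - x| * B₁ :=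
      (norm_mulVec_le _ _).trans (mul_le_mul (h1 t ht) (hB₁ t ht) (norm_nonneg _) (by positivity))
    have e2 : ‖((y - x : ℝ) : ℂ) • ((T y t - T x t) *ᵥ (X x t *ᵥ F x t))‖ ≤
        |y - x| * (η * B₂) := by
      rw [norm_smul, Complex.norm_real, Real.norm_eq_abs]
      exact mul_le_mul_of_nonneg_left ((norm_mulVec_le _ _).trans
        (mul_le_mul (h2 t ht) (hB₂ t ht) (norm_nonneg _) hη0.le)) (abs_nonneg _)
    refine (norm_add_le _ _).trans ?_
    linarith
  have hRb := norm_le_of_norm_deriv_le hδ.le hM hMδ hRd (ε := η * (B₁ + B₂) * |y - x|)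
    (fun t ht => (norm_add_le _ _).trans (add_le_add ((norm_mulVec_le _ _).trans
      (mul_le_mul_of_nonneg_right (hTM y t ht) (norm_nonneg _))) (hEb t ht))) t ht
  have hR0 : ‖R t₀‖ ≤ η * |y - x| := by
    simpa only [hR, Complex.coe_smul, Real.norm_eq_abs] using h3
  have hfin : ‖R t‖ ≤ c * |y - x| := by
    have : 2 * (η * |y - x| + δ * (η * (B₁ + B₂) * |y - x|)) = c * |y - x| := by
      rw [hη]
      field_simp
    linarith
  simpa only [hR, Complex.coe_smul, Real.norm_eq_abs] using hfin

/-- The modified eigenfunction, defined at each time by the Volterra equation, evolves by the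
second equation of the Lax pair. -/
theorem hasDerivAt_leftJost_time {G : Mat3} {θ : Fin 3 → ℂ} {l : Fin 3}
    {Q T Xt Tx : ℝ → ℝ → Mat3}
    (adm : ∀ t, LeftAdmissible G θ (fun x => Q x t) l 0)
    (hQt : ∀ x t, HasMatDerivAt (fun t => Q x t) (Xt x t) t)
    (hTx : ∀ x t, HasMatDerivAt (fun x => T x t) (Tx x t) x)
    (hTc : Continuous fun p : ℝ × ℝ => T p.1 p.2)
    (hTxc : Continuous fun p : ℝ × ℝ => Tx p.1 p.2)
    (hzc : ∀ x t, Xt x t + (jostGen G θ l + Q x t) * T x t =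
      Tx x t + T x t * (jostGen G θ l + Q x t))
    (hTb : ∀ t₀, ∃ M, ∀ x, ∀ t ∈ Set.Icc (t₀ - 1) (t₀ + 1), entrySum (T x t) ≤ M)
    (hlim : ∀ t₀, ∀ ε > 0, ∀ᶠ x in atBot, ∀ t ∈ Set.Icc (t₀ - 1) (t₀ + 1),
      ‖T x t *ᵥ Gᵀ l‖ ≤ ε) (x t₀ : ℝ) :
    HasDerivAt (fun t => leftJost G θ (fun x => Q x t) l x)
      (T x t₀ *ᵥ leftJost G θ (fun x => Q x t₀) l x) t₀ := by
  obtain ⟨M, hM⟩ := hTb t₀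
  have hM0 : 0 ≤ M := (entrySum_nonneg _).trans (hM 0 t₀ ⟨by linarith, by linarith⟩)
  -- a time step on which the Gronwall estimate applies
  set δ := 1 / (4 * (M + 1)) with hδdef
  have hδ : 0 < δ := by positivity
  have hMδ : M * δ ≤ 1 / 4 := by
    rw [hδdef, mul_one_div, div_le_div_iff₀ (by positivity) (by norm_num)]
    linarith
  have hδ1 : δ ≤ 1 / 4 := by
    rw [hδdef]
    exact one_div_le_one_div_of_le (by norm_num) (by linarith)
  have hTt : ∀ x, Continuous (T x) := fun x =>
    hTc.comp (continuous_const.prodMk continuous_id)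
  choose F hF0 hFt using fun x => exists_solution_linear hδ hM0 hMδ (hTt x) (t₀ := t₀)
    (fun t ht => hM x t ⟨by linarith [ht.1], by linarith [ht.2]⟩)
    (leftJost G θ (fun x => Q x t₀) l x)
  have hsub : ∀ t ∈ Set.Icc (t₀ - δ) (t₀ + δ), t ∈ Set.Icc (t₀ - 1) (t₀ + 1) := fun t ht =>
    ⟨by linarith [ht.1], by linarith [ht.2]⟩
  have ht₀ : t₀ ∈ Set.Icc (t₀ - δ) (t₀ + δ) := ⟨by linarith, by linarith⟩
  -- `F` evolves the eigenfunction at the time `t₀` by the equation in `t`; it solves the equation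
  -- in `x` at nearby times and keeps its normalization, hence it is the eigenfunction there
  have hFx : ∀ t ∈ Set.Icc (t₀ - δ) (t₀ + δ), ∀ x,
      HasDerivAt (fun x => F x t) ((jostGen G θ l + Q x t) *ᵥ F x t) x := fun t ht x =>
    hasDerivAt_of_zeroCurvature (X := fun x t => jostGen G θ l + Q x t) (Xt := Xt) hδ hM0
      (by linarith) (fun x t ht => hM x t (hsub t ht))
      (fun x t i j => by simpa using (hQt x t i j).const_add (jostGen G θ l i j))
      hTx hTc hTxc hzc hFt (fun x => by simpa [hF0] using (adm t₀).hasDerivAt x) ht x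
  have hFlim : ∀ t ∈ Set.Icc (t₀ - δ) (t₀ + δ), Tendsto (fun x => ‖F x t - Gᵀ l‖) atBot (𝓝 0) := by
    intro t ht
    rw [Metric.tendsto_nhds]
    intro ε hε
    have hnorm := tendsto_iff_norm_sub_tendsto_zero.1 (adm t₀).tendsto_normalization
    filter_upwards [hlim t₀ ε hε, hnorm.eventually_lt_const (show 0 < ε / 4 by positivity)]
      with x h1 h2
    have hd : ∀ t ∈ Set.Icc (t₀ - δ) (t₀ + δ), HasDerivAt (fun t => F x t - Gᵀ l)
        (T x t *ᵥ (F x t - Gᵀ l) + T x t *ᵥ Gᵀ l) t := fun t ht => by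
      rw [← Matrix.mulVec_add, sub_add_cancel]
      exact (hFt x t ht).sub_const _
    have := norm_le_of_norm_deriv_le hδ.le hM0 (by linarith) hd (ε := ε) (fun t ht =>
      (norm_add_le _ _).trans (add_le_add ((norm_mulVec_le _ _).trans
      (mul_le_mul_of_nonneg_right (hM x t (hsub t ht)) (norm_nonneg _))) (h1 t (hsub t ht)))) t ht
    rw [hF0] at this
    rw [dist_zero_right, norm_norm]
    nlinarith
  have hFeq : ∀ t ∈ Set.Icc (t₀ - δ) (t₀ + δ), (fun x => F x t) = leftJost G θ (fun x => Q x t) l :=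
    fun t ht => (adm t).eq_of_hasDerivAt (hFx t ht) (by simpa using hFlim t ht)
  have hmem : Set.Icc (t₀ - δ) (t₀ + δ) ∈ 𝓝 t₀ := Icc_mem_nhds (by linarith) (by linarith)
  have hres := hFt x t₀ ht₀
  rw [hF0] at hres
  refine hres.congr_of_eventuallyEq ?_
  filter_upwards [hmem] with t ht
  exact (congrFun (hFeq t ht) x).symm

/-- The same for the normalization at `+∞`. -/
theorem hasDerivAt_rightJost_time {G : Mat3} {θ : Fin 3 → ℂ} {l : Fin 3}
    {Q T Xt Tx : ℝ → ℝ → Mat3}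
    (adm : ∀ t, RightAdmissible G θ (fun x => Q x t) l 0)
    (hQt : ∀ x t, HasMatDerivAt (fun t => Q x t) (Xt x t) t)
    (hTx : ∀ x t, HasMatDerivAt (fun x => T x t) (Tx x t) x)
    (hTc : Continuous fun p : ℝ × ℝ => T p.1 p.2)
    (hTxc : Continuous fun p : ℝ × ℝ => Tx p.1 p.2)
    (hzc : ∀ x t, Xt x t + (jostGen G θ l + Q x t) * T x t =
      Tx x t + T x t * (jostGen G θ l + Q x t))
    (hTb : ∀ t₀, ∃ M, ∀ x, ∀ t ∈ Set.Icc (t₀ - 1) (t₀ + 1), entrySum (T x t) ≤ M)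
    (hlim : ∀ t₀, ∀ ε > 0, ∀ᶠ x in atTop, ∀ t ∈ Set.Icc (t₀ - 1) (t₀ + 1),
      ‖T x t *ᵥ Gᵀ l‖ ≤ ε) (x t₀ : ℝ) :
    HasDerivAt (fun t => rightJost G θ (fun x => Q x t) l x)
      (T x t₀ *ᵥ rightJost G θ (fun x => Q x t₀) l x) t₀ := by
  simp only [fun t => RightAdmissible.rightJost_eq (adm t)]
  refine hasDerivAt_leftJost_time (Q := fun x t => -Q (-x) t) (T := fun x t => T (-x) t)
    (Xt := fun x t => -Xt (-x) t) (Tx := fun x t => -Tx (-x) t) adm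
    (fun x t i j => (hQt (-x) t i j).neg) (fun x t i j => ?_)
    (hTc.comp (by fun_prop : Continuous fun p : ℝ × ℝ => (-p.1, p.2)))
    (hTxc.comp (by fun_prop : Continuous fun p : ℝ × ℝ => (-p.1, p.2))).neg (fun x t => ?_)
    (fun t₀ => ?_) (fun t₀ ε hε => ?_) (-x) t₀ |>.congr_deriv ?_
  · refine (HasDerivAt.scomp (h := fun y : ℝ => -y) x (hTx (-x) t i j)
      (hasDerivAt_id x).neg).congr_deriv ?_
    simp
  · rw [jostGen_neg, ← neg_add, Matrix.neg_mul, Matrix.mul_neg, ← neg_add, hzc, neg_add]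
  · obtain ⟨M, hM⟩ := hTb t₀
    exact ⟨M, fun x => hM (-x)⟩
  · exact tendsto_neg_atBot_atTop.eventually (hlim t₀ ε hε)
  · simp

/-! ### The Lax pair -/

/-- The matrix `σ = diag(1, -1, -1)`. -/
def sigmaMat : Mat3 := !![1, 0, 0; 0, -1, 0; 0, 0, -1]

/-- The matrix `X = -ikσ + U` of the `x`-equation of the Lax pair. -/
def laxX (k : ℂ) (q : C2) : Mat3 := (-(I * k)) • sigmaMat + potMatrix q

/-- The matrix `T` of the `t`-equation of the Lax pair, in terms of the values `q`, `p`, `r` of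
`u`, `u_x`, `u_xx`. -/
def laxT (α₁ α₂ n k : ℂ) (q p r : C2) : Mat3 :=
  α₁ • ((-2 * k) • laxX k q + I • (sigmaMat * (potMatrix q * potMatrix q - potMatrix p))
      + (I * n ^ 2) • sigmaMat)
    + α₂ • ((4 * k ^ 2) • laxX k q
      - (2 * I * k) • (sigmaMat * (potMatrix q * potMatrix q - potMatrix p))
      + (2 : ℂ) • (potMatrix q * potMatrix q * potMatrix q) - potMatrix r
      - (potMatrix q * potMatrix p - potMatrix p * potMatrix q))

/-- The derivative of `laxT` along `x`, where `s` is the value of `u_xxx`. -/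
def laxTx (α₁ α₂ k : ℂ) (q p r s : C2) : Mat3 :=
  α₁ • ((-2 * k) • potMatrix p + I • (sigmaMat *
      (potMatrix p * potMatrix q + potMatrix q * potMatrix p - potMatrix r)))
    + α₂ • ((4 * k ^ 2) • potMatrix p
      - (2 * I * k) • (sigmaMat *
        (potMatrix p * potMatrix q + potMatrix q * potMatrix p - potMatrix r))
      + (2 : ℂ) • ((potMatrix p * potMatrix q + potMatrix q * potMatrix p) * potMatrix q
        + potMatrix q * potMatrix q * potMatrix p) - potMatrix s
      - (potMatrix q * potMatrix r - potMatrix r * potMatrix q))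

set_option maxHeartbeats 2000000 in
/-- The zero curvature equation, with the time derivative `w` of the potential expressed by the
Hirota equation. -/
lemma zeroCurvature_of_hirota (α₁ α₂ n : ℝ) (k : ℂ) (q p r s w : C2)
    (hw : ∀ i, w i = I * α₁ * (r i + 2 * (q 0 * conj (q 0) + q 1 * conj (q 1) - n ^ 2) * q i)
      - α₂ * (s i + 3 * (q 0 * conj (q 0) + q 1 * conj (q 1)) * p i
        + 3 * (conj (q 0) * p 0 + conj (q 1) * p 1) * q i)) :
    potMatrix w + laxX k q * laxT α₁ α₂ n k q p r =
      laxTx α₁ α₂ k q p r s + laxT α₁ α₂ n k q p r * laxX k q := by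
  have h0 := hw 0
  have h1 := hw 1
  ext i j
  fin_cases i <;> fin_cases j <;>
    simp [laxX, laxT, laxTx, potMatrix, sigmaMat, h0, h1, map_ofNat] <;>
    ring_nf <;> simp only [I_sq] <;> ring

/-- The symmetry of the Lax pair under conjugation: the conjugates of solutions at `z^*` solve the
adjoint system at `z`. -/
lemma laxX_conj_transpose (k : ℂ) (q : C2) :
    (laxX (conj k) q).map conj = -(laxX k q)ᵀ := by
  ext i j
  fin_cases i <;> fin_cases j <;> simp [laxX, potMatrix, sigmaMat]

set_option maxHeartbeats 1000000 in
lemma laxT_conj_transpose (α₁ α₂ n : ℝ) (k : ℂ) (q p r : C2) :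
    (laxT α₁ α₂ n (conj k) q p r).map conj = -(laxT α₁ α₂ n k q p r)ᵀ := by
  ext i j
  fin_cases i <;> fin_cases j <;>
    simp [laxX, laxT, potMatrix, sigmaMat, map_ofNat] <;> ring

lemma HasDerivAt.potMatrix {v : ℝ → C2} {v' : C2} {x : ℝ} (h : HasDerivAt v v' x) :
    HasMatDerivAt (fun y => potMatrix (v y)) (potMatrix v') x := by
  have h' : ∀ i, HasDerivAt (fun y => v y i) (v' i) x := fun i =>
    ((EuclideanSpace.proj (𝕜 := ℂ) i : C2 →L[ℂ] ℂ).restrictScalars ℝ).hasFDerivAt.comp_hasDerivAt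
      x h
  have hc : ∀ i, HasDerivAt (fun y => conj (v y i)) (conj (v' i)) x := fun i =>
    Complex.conjCLE.hasFDerivAt.comp_hasDerivAt x (h' i)
  intro i j
  fin_cases i <;> fin_cases j <;> simp [_root_.potMatrix] <;>
    first
    | exact hasDerivAt_const _ _
    | exact h' _
    | exact (hc _).neg

lemma continuous_potMatrix : Continuous potMatrix := by
  refine continuous_mat3_iff.2 fun i j => ?_
  fin_cases i <;> fin_cases j <;> simp [potMatrix] <;> fun_prop

lemma continuous_laxT (α₁ α₂ n k : ℂ) :
    Continuous fun v : C2 × C2 × C2 => laxT α₁ α₂ n k v.1 v.2.1 v.2.2 := by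
  have h1 := continuous_potMatrix.comp (continuous_fst : Continuous fun v : C2 × C2 × C2 => v.1)
  have h2 := continuous_potMatrix.comp
    (continuous_fst.comp continuous_snd : Continuous fun v : C2 × C2 × C2 => v.2.1)
  have h3 := continuous_potMatrix.comp
    (continuous_snd.comp continuous_snd : Continuous fun v : C2 × C2 × C2 => v.2.2)
  simp only [Function.comp_def] at h1 h2 h3
  unfold laxT laxX
  fun_prop

/-! ### The eigenvector matrix -/

lemma normSq_C2 (v : C2) : (‖v‖ : ℂ) ^ 2 = v 0 * conj (v 0) + v 1 * conj (v 1) := by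
  rw [← Complex.ofReal_pow, EuclideanSpace.norm_sq_eq]
  simp [Fin.sum_univ_two, Complex.mul_conj, Complex.normSq_eq_norm_sq]

/-- The product of the transposed adjoint eigenvector matrix and the eigenvector matrix is
diagonal. -/
lemma adj_transpose_mul_eigMatrix {v : C2} (hv : v ≠ 0) {z : ℂ} (hz : z ≠ 0) :
    ((eigMatrix v (conj z)).map conj)ᵀ * eigMatrix v z =
      Matrix.diagonal ![1 + (‖v‖ : ℂ) ^ 2 / z ^ 2, 1, 1 + (‖v‖ : ℂ) ^ 2 / z ^ 2] := by
  have hn : (‖v‖ : ℂ) ≠ 0 := by simpa using hv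
  have h := normSq_C2 v
  ext i j
  fin_cases i <;> fin_cases j <;>
    simp [eigMatrix, Matrix.mul_apply, Fin.sum_univ_three] <;> field_simp <;>
    ring_nf <;> simp only [I_sq, h] <;> ring

lemma det_eigMatrix {v : C2} (hv : v ≠ 0) {z : ℂ} (hz : z ≠ 0) :
    (eigMatrix v z).det = 1 + (‖v‖ : ℂ) ^ 2 / z ^ 2 := by
  have hn : (‖v‖ : ℂ) ≠ 0 := by simpa using hv
  have h := normSq_C2 v
  rw [Matrix.det_fin_three]
  simp [eigMatrix]
  field_simp
  ring_nf
  simp only [I_sq]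
  have h4 : (‖v‖ : ℂ) ^ 4 = (‖v‖ : ℂ) ^ 2 * (‖v‖ : ℂ) ^ 2 := by ring
  simp only [h4, h]
  ring

/-! ### Regularity and limits of the potential -/

/-- Partial differentiation along the first variable lowers the order of smoothness by one. -/
lemma contDiff_deriv_fst {g : ℝ → ℝ → C2} {m : ℕ}
    (hg : ContDiff ℝ (m + 1 : ℕ) fun p : ℝ × ℝ => g p.1 p.2) :
    (∀ x t, HasDerivAt (fun y => g y t) (deriv (fun y => g y t) x) x) ∧
      ContDiff ℝ m fun p : ℝ × ℝ => deriv (fun y => g y p.2) p.1 := by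
  set f : ℝ × ℝ → C2 := fun p => g p.1 p.2
  have hd : ∀ x t, HasDerivAt (fun y => g y t) (fderiv ℝ f (x, t) (1, 0)) x := fun x t => by
    have h1 : HasFDerivAt f (fderiv ℝ f (x, t)) (x, t) :=
      (hg.differentiable (by simp) (x, t)).hasFDerivAt
    have h2 : HasDerivAt (fun y : ℝ => (y, t)) ((1 : ℝ), (0 : ℝ)) x :=
      (hasDerivAt_id x).prodMk (hasDerivAt_const x t)
    exact h1.comp_hasDerivAt x h2
  refine ⟨fun x t => by rw [(hd x t).deriv]; exact hd x t, ?_⟩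
  have : (fun p : ℝ × ℝ => deriv (fun y => g y p.2) p.1) = fun p => fderiv ℝ f p (1, 0) := by
    ext1 p
    exact (hd p.1 p.2).deriv
  rw [this]
  exact (hg.fderiv_right (by norm_cast)).clm_apply contDiff_const

namespace HirotaData

variable {D : HirotaData}

lemma contDiff_ux (hu : D.IsSolution) (n m : ℕ) (h : n + m = 3) :
    ContDiff ℝ m fun p : ℝ × ℝ => D.ux n p.1 p.2 := by
  induction n generalizing m with
  | zero =>
    obtain rfl : m = 3 := by omega
    simpa [ux, iteratedDeriv_zero] using hu.smooth
  | succ n ih =>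
    have := (contDiff_deriv_fst (g := D.ux n) (ih (m + 1) (by omega))).2
    simpa only [ux, iteratedDeriv_succ] using this

lemma hasDerivAt_ux (hu : D.IsSolution) {n : ℕ} (hn : n < 3) (x t : ℝ) :
    HasDerivAt (fun y => D.ux n y t) (D.ux (n + 1) x t) x := by
  have := (contDiff_deriv_fst (g := D.ux n) (m := 2 - n)
    (contDiff_ux hu n (2 - n + 1) (by omega))).1 x t
  simpa only [ux, iteratedDeriv_succ] using this

lemma continuous_ux (hu : D.IsSolution) {n : ℕ} (hn : n ≤ 3) :
    Continuous fun p : ℝ × ℝ => D.ux n p.1 p.2 :=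
  (contDiff_ux hu n (3 - n) (by omega)).continuous

lemma ux_zero (x t : ℝ) : D.ux 0 x t = D.u x t := by simp [ux, iteratedDeriv_zero]

lemma continuous_u (hu : D.IsSolution) : Continuous fun p : ℝ × ℝ => D.u p.1 p.2 :=
  hu.smooth.continuous

lemma continuous_u_fst (hu : D.IsSolution) (t : ℝ) : Continuous fun x => D.u x t :=
  (continuous_u hu).comp (continuous_id.prodMk continuous_const)

lemma hasDerivAt_ut (hu : D.IsSolution) (x t : ℝ) :
    HasDerivAt (fun s => D.u x s) (deriv (fun s => D.u x s) t) t := by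
  refine DifferentiableAt.hasDerivAt ?_
  have h1 := hu.smooth.differentiable (by simp) (x, t)
  exact DifferentiableAt.comp t (f := fun s : ℝ => (x, s)) h1
    ((differentiableAt_const x).prodMk differentiableAt_id)

/-- The Hirota equation, solved for the time derivative. -/
lemma ut_apply (hu : D.IsSolution) (x t : ℝ) (i : Fin 2) :
    deriv (fun s => D.u x s) t i =
      I * D.α₁ * (D.ux 2 x t i + 2 * (D.u x t 0 * conj (D.u x t 0) + D.u x t 1 * conj (D.u x t 1)
        - (D.u0 : ℂ) ^ 2) * D.u x t i)
      - D.α₂ * (D.ux 3 x t i + 3 * (D.u x t 0 * conj (D.u x t 0)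
          + D.u x t 1 * conj (D.u x t 1)) * D.ux 1 x t i
        + 3 * (conj (D.u x t 0) * D.ux 1 x t 0 + conj (D.u x t 1) * D.ux 1 x t 1)
          * D.u x t i) := by
  have h := congrArg (fun v : C2 => v i) (hu.equation x t)
  simp only [normSq_C2, PiLp.inner_apply, RCLike.inner_apply, Fin.sum_univ_two, PiLp.add_apply,
    PiLp.smul_apply, smul_eq_mul, PiLp.zero_apply] at h
  linear_combination (-I) * h + (deriv (fun s => D.u x s) t i + D.α₂ * (D.ux 3 x t i
    + 3 * (D.u x t 0 * conj (D.u x t 0) + D.u x t 1 * conj (D.u x t 1)) * D.ux 1 x t i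
    + 3 * (conj (D.u x t 0) * D.ux 1 x t 0 + conj (D.u x t 1) * D.ux 1 x t 1)
          * D.u x t i)) * I_sq

/-- A continuous function of `u`, `u_x`, `u_xx` is, far out, close to its value at the limit. -/
lemma eventually_le_of_limit {F : Filter ℝ} {v : C2}
    (h0 : TendstoLocallyUniformly D.u (fun _ => v) F)
    (h1 : TendstoLocallyUniformly (D.ux 1) (fun _ => 0) F)
    (h2 : TendstoLocallyUniformly (D.ux 2) (fun _ => 0) F)
    {Φ : C2 × C2 × C2 → ℝ} (hΦ : Continuous Φ) {c : ℝ} (hc : Φ (v, 0, 0) < c) (a b : ℝ) :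
    ∀ᶠ x in F, ∀ t ∈ Set.Icc a b, Φ (D.u x t, D.ux 1 x t, D.ux 2 x t) ≤ c := by
  obtain ⟨δ, hδ, hball⟩ := Metric.eventually_nhds_iff_ball.1
    ((hΦ.tendsto (v, 0, 0)).eventually_le_const hc)
  have hunif : ∀ {f : ℝ → ℝ → C2} {w : C2}, TendstoLocallyUniformly f (fun _ => w) F →
      ∀ᶠ x in F, ∀ t ∈ Set.Icc a b, dist w (f x t) < δ := fun h =>
    Metric.tendstoUniformlyOn_iff.1 ((tendstoLocallyUniformlyOn_iff_tendstoUniformlyOn_of_compact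
      isCompact_Icc).1 h.tendstoLocallyUniformlyOn) δ hδ
  filter_upwards [hunif h0, hunif h1, hunif h2] with x e0 e1 e2 t ht
  refine hball _ ?_
  rw [Metric.mem_ball, dist_comm, Prod.dist_eq, Prod.dist_eq]
  exact max_lt (e0 t ht) (max_lt (e1 t ht) (e2 t ht))

lemma exists_bound_of_limit (hu : D.IsSolution) {Φ : C2 × C2 × C2 → ℝ} (hΦ : Continuous Φ)
    (a b : ℝ) : ∃ M, ∀ x, ∀ t ∈ Set.Icc a b, Φ (D.u x t, D.ux 1 x t, D.ux 2 x t) ≤ M := by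
  obtain ⟨x₁, h₁⟩ := eventually_atBot.1 (eventually_le_of_limit hu.limit_left hu.limit_ux_left
    hu.limit_uxx_left hΦ (lt_add_one _) a b)
  obtain ⟨x₂, h₂⟩ := eventually_atTop.1 (eventually_le_of_limit hu.limit_right hu.limit_ux_right
    hu.limit_uxx_right hΦ (lt_add_one _) a b)
  have hc : Continuous fun p : ℝ × ℝ => Φ (D.u p.1 p.2, D.ux 1 p.1 p.2, D.ux 2 p.1 p.2) :=
    hΦ.comp ((continuous_u hu).prodMk ((continuous_ux hu (by norm_num)).prodMk
      (continuous_ux hu (by norm_num))))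
  obtain ⟨C, hC⟩ := ((isCompact_Icc (a := x₁) (b := x₂)).prod
    (isCompact_Icc (a := a) (b := b))).exists_bound_of_continuousOn hc.continuousOn
  refine ⟨max C (max (Φ (D.um, 0, 0) + 1) (Φ (D.up, 0, 0) + 1)), fun x t ht => ?_⟩
  rcases le_total x x₁ with hx | hx
  · exact (h₁ x hx t ht).trans ((le_max_left _ _).trans (le_max_right _ _))
  rcases le_total x₂ x with hx' | hx'
  · exact (h₂ x hx' t ht).trans ((le_max_right _ _).trans (le_max_right _ _))
  · exact ((le_abs_self _).trans (hC (x, t) ⟨⟨hx, hx'⟩, ht⟩)).trans (le_max_left _ _)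

/-! ### The Lax pair along the solution -/

/-- The frequencies of the background eigenfunctions in `t`. -/
def omega (D : HirotaData) (z : ℂ) : Fin 3 → ℂ :=
  ![2 * D.lam z * (D.α₁ * D.kk z + D.α₂ * (-2 * D.kk z ^ 2 + (D.u0 : ℂ) ^ 2)),
    -(D.α₁ * (D.kk z ^ 2 + D.lam z ^ 2) - 4 * D.α₂ * D.kk z ^ 3),
    -(2 * D.lam z * (D.α₁ * D.kk z + D.α₂ * (-2 * D.kk z ^ 2 + (D.u0 : ℂ) ^ 2)))]

/-- The matrix of the `x`-equation at `(x, t)`. -/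
def Xmat (D : HirotaData) (z : ℂ) (x t : ℝ) : Mat3 := laxX (D.kk z) (D.u x t)

/-- The matrix of the `t`-equation at `(x, t)`. -/
def Tmat (D : HirotaData) (z : ℂ) (x t : ℝ) : Mat3 :=
  laxT D.α₁ D.α₂ D.u0 (D.kk z) (D.u x t) (D.ux 1 x t) (D.ux 2 x t)

lemma hh_apply (z : ℂ) (x t : ℝ) (l : Fin 3) :
    D.hh z x t l = D.theta z l * x + D.omega z l * t := by
  fin_cases l <;> simp [hh, theta, omega, h1, h2] <;> ring

lemma hasMatDerivAt_Tmat (hu : D.IsSolution) (z : ℂ) (x t : ℝ) :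
    HasMatDerivAt (fun x => D.Tmat z x t) (laxTx D.α₁ D.α₂ (D.kk z) (D.u x t) (D.ux 1 x t)
      (D.ux 2 x t) (D.ux 3 x t)) x := by
  have h0 : HasMatDerivAt (fun x => potMatrix (D.u x t)) (potMatrix (D.ux 1 x t)) x := by
    simpa only [ux_zero] using (hasDerivAt_ux hu (n := 0) (by norm_num) x t).potMatrix
  have h1 : HasMatDerivAt (fun x => potMatrix (D.ux 1 x t)) (potMatrix (D.ux 2 x t)) x :=
    (hasDerivAt_ux hu (n := 1) (by norm_num) x t).potMatrix
  have h2 : HasMatDerivAt (fun x => potMatrix (D.ux 2 x t)) (potMatrix (D.ux 3 x t)) x :=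
    (hasDerivAt_ux hu (n := 2) (by norm_num) x t).potMatrix
  have hX := (hasMatDerivAt_const ((-(I * D.kk z)) • sigmaMat) x).add h0
  have hA := (hasMatDerivAt_const sigmaMat x).mul ((h0.mul h0).sub h1)
  have h := ((((hX.smul (-2 * D.kk z)).add (hA.smul I)).add
    (hasMatDerivAt_const ((I * (D.u0 : ℂ) ^ 2) • sigmaMat) x)).smul (D.α₁ : ℂ)).add
    ((((((hX.smul (4 * D.kk z ^ 2)).sub (hA.smul (2 * I * D.kk z))).add
    (((h0.mul h0).mul h0).smul (2 : ℂ))).sub h2).sub ((h0.mul h1).sub (h1.mul h0))).smul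
      (D.α₂ : ℂ))
  unfold Tmat laxT laxTx laxX
  convert h using 1
  simp only [Matrix.zero_mul, zero_add, add_zero]
  congr 3
  abel

lemma continuous_Tmat (hu : D.IsSolution) (z : ℂ) :
    Continuous fun p : ℝ × ℝ => D.Tmat z p.1 p.2 :=
  Continuous.comp (f := fun p : ℝ × ℝ => (D.u p.1 p.2, D.ux 1 p.1 p.2, D.ux 2 p.1 p.2))
    (continuous_laxT D.α₁ D.α₂ D.u0 (D.kk z)) ((continuous_u hu).prodMk
    ((continuous_ux hu (n := 1) (by norm_num)).prodMk (continuous_ux hu (n := 2) (by norm_num))))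

lemma continuous_Tmat_deriv (hu : D.IsSolution) (z : ℂ) :
    Continuous fun p : ℝ × ℝ => laxTx D.α₁ D.α₂ (D.kk z) (D.u p.1 p.2) (D.ux 1 p.1 p.2)
      (D.ux 2 p.1 p.2) (D.ux 3 p.1 p.2) := by
  have key : ∀ q p r s : ℝ × ℝ → Mat3, Continuous q → Continuous p → Continuous r →
      Continuous s → Continuous fun v => (D.α₁ : ℂ) • ((-2 * D.kk z) • p v + I • (sigmaMat *
          (p v * q v + q v * p v - r v)))
        + (D.α₂ : ℂ) • ((4 * D.kk z ^ 2) • p v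
          - (2 * I * D.kk z) • (sigmaMat * (p v * q v + q v * p v - r v))
          + (2 : ℂ) • ((p v * q v + q v * p v) * q v + q v * q v * p v) - s v
          - (q v * r v - r v * q v)) := by
    intro q p r s hq hp hr hs
    have hA : Continuous fun v => p v * q v + q v * p v :=
      (hp.matrix_mul hq).add (hq.matrix_mul hp)
    have hB : Continuous fun v => sigmaMat * (p v * q v + q v * p v - r v) :=
      continuous_const.matrix_mul (hA.sub hr)
    have hC : Continuous fun v => (p v * q v + q v * p v) * q v + q v * q v * p v :=
      (hA.matrix_mul hq).add ((hq.matrix_mul hq).matrix_mul hp)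
    have hE : Continuous fun v => q v * r v - r v * q v :=
      (hq.matrix_mul hr).sub (hr.matrix_mul hq)
    exact (((hp.const_smul (_ : ℂ)).add (hB.const_smul (_ : ℂ))).const_smul (_ : ℂ)).add
      ((((((hp.const_smul (_ : ℂ)).sub (hB.const_smul (_ : ℂ))).add
        (hC.const_smul (_ : ℂ))).sub hs).sub hE).const_smul (_ : ℂ))
  exact key _ _ _ _ (continuous_potMatrix.comp (continuous_u hu))
    (continuous_potMatrix.comp (continuous_ux hu (n := 1) (by norm_num)))
    (continuous_potMatrix.comp (continuous_ux hu (n := 2) (by norm_num)))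
    (continuous_potMatrix.comp (continuous_ux hu (n := 3) (by norm_num)))

lemma zeroCurvature (hu : D.IsSolution) (z : ℂ) (x t : ℝ) :
    potMatrix (deriv (fun s => D.u x s) t) + D.Xmat z x t * D.Tmat z x t =
      laxTx D.α₁ D.α₂ (D.kk z) (D.u x t) (D.ux 1 x t) (D.ux 2 x t) (D.ux 3 x t)
        + D.Tmat z x t * D.Xmat z x t :=
  zeroCurvature_of_hirota _ _ _ _ _ _ _ _ _ (ut_apply hu x t)

/-! ### Background eigenvectors -/

lemma norm_um : ‖D.um‖ = D.u0 := by
  rw [um, norm_smul, mul_comm I, Complex.norm_exp_ofReal_mul_I, one_mul]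
  rfl

lemma norm_up : ‖D.up‖ = D.u0 := by
  rw [up, norm_smul, mul_comm I, Complex.norm_exp_ofReal_mul_I, one_mul]
  rfl

lemma u0_pos (hu0 : D.uo ≠ 0) : 0 < D.u0 := norm_pos_iff.2 hu0

lemma u0_ne (hu0 : D.uo ≠ 0) : (D.u0 : ℂ) ≠ 0 := Complex.ofReal_ne_zero.2 (u0_pos hu0).ne'

/-- The columns of the eigenvector matrix are eigenvectors of the background matrices of both
Lax equations. -/
lemma laxX_mulVec_eigMatrix (hu0 : D.uo ≠ 0) {v : C2} (hv : ‖v‖ = D.u0) {z : ℂ} (hz : z ≠ 0)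
    (l : Fin 3) :
    laxX (D.kk z) v *ᵥ (eigMatrix v z)ᵀ l = (I * D.theta z l) • (eigMatrix v z)ᵀ l := by
  have hn := u0_ne hu0
  have h := normSq_C2 v
  rw [hv] at h
  ext i
  fin_cases l <;> fin_cases i <;>
    simp [laxX, eigMatrix, sigmaMat, potMatrix, theta, lam, kk, Matrix.mulVec, dotProduct,
      Fin.sum_univ_three, hv] <;> field_simp <;> ring_nf <;> simp only [I_sq, h] <;> ring

lemma laxT_mulVec_eigMatrix (hu0 : D.uo ≠ 0) {v : C2} (hv : ‖v‖ = D.u0) {z : ℂ} (hz : z ≠ 0)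
    (l : Fin 3) :
    laxT D.α₁ D.α₂ D.u0 (D.kk z) v 0 0 *ᵥ (eigMatrix v z)ᵀ l =
      (I * D.omega z l) • (eigMatrix v z)ᵀ l := by
  have hn := u0_ne hu0
  have h := normSq_C2 v
  rw [hv] at h
  have hX := laxX_mulVec_eigMatrix hu0 hv hz l
  have h0 : potMatrix 0 = 0 := by
    ext i j
    fin_cases i <;> fin_cases j <;> simp [potMatrix]
  set c := (eigMatrix v z)ᵀ l with hc
  set k := D.kk z with hk
  have hT : laxT D.α₁ D.α₂ D.u0 k v 0 0 *ᵥ c =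
      (D.α₁ : ℂ) • ((-2 * k) • (laxX k v *ᵥ c)
          + I • (sigmaMat *ᵥ (potMatrix v *ᵥ (potMatrix v *ᵥ c)))
        + (I * (D.u0 : ℂ) ^ 2) • (sigmaMat *ᵥ c))
      + (D.α₂ : ℂ) • ((4 * k ^ 2) • (laxX k v *ᵥ c)
        - (2 * I * k) • (sigmaMat *ᵥ (potMatrix v *ᵥ (potMatrix v *ᵥ c)))
        + (2 : ℂ) • (potMatrix v *ᵥ (potMatrix v *ᵥ (potMatrix v *ᵥ c)))) := by
    simp only [laxT, h0, sub_zero, Matrix.mul_zero, Matrix.zero_mul, Matrix.add_mulVec,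
      Matrix.sub_mulVec, Matrix.smul_mulVec, ← Matrix.mulVec_mulVec]
  have hU : potMatrix v *ᵥ c = laxX k v *ᵥ c + (I * k) • (sigmaMat *ᵥ c) := by
    rw [laxX, Matrix.add_mulVec, Matrix.smul_mulVec, neg_smul]
    abel
  rw [hT]
  by_cases hl : l = 1
  · have hU0 : potMatrix v *ᵥ c = 0 := by
      subst hl
      ext i
      fin_cases i <;>
        simp [hc, potMatrix, eigMatrix, Matrix.mulVec, dotProduct, Fin.sum_univ_three, hv]
      ring
    have hs : sigmaMat *ᵥ c = -c := by
      subst hl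
      ext i
      fin_cases i <;>
        simp [hc, sigmaMat, eigMatrix, Matrix.mulVec, dotProduct, Fin.sum_univ_three]
    rw [hU0, Matrix.mulVec_zero, Matrix.mulVec_zero, Matrix.mulVec_zero, hX, hs]
    subst hl
    have hlam : D.lam z ^ 2 = k ^ 2 + (D.u0 : ℂ) ^ 2 := by
      simp only [hk, lam, kk]
      field_simp
      ring
    simp only [omega, theta, Matrix.cons_val_one, Matrix.cons_val_zero, smul_zero, add_zero,
      sub_zero,
      smul_neg, ← hk, hlam]
    ext i
    simp only [Pi.add_apply, Pi.smul_apply, Pi.neg_apply, smul_eq_mul]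
    ring
  · have hU2 : potMatrix v *ᵥ (potMatrix v *ᵥ c) = (-(D.u0 : ℂ) ^ 2) • c := by
      ext i
      fin_cases l <;> first | exact absurd rfl hl | skip
      all_goals
        fin_cases i <;>
          simp [hc, potMatrix, eigMatrix, Matrix.mulVec, dotProduct, Fin.sum_univ_three, hv] <;>
          field_simp <;> ring_nf <;> simp only [h] <;> ring
    have hω : D.omega z l = -2 * k * D.α₁ * D.theta z l
        + D.α₂ * (4 * k ^ 2 - 2 * (D.u0 : ℂ) ^ 2) * D.theta z l := by
      fin_cases l <;> first | exact absurd rfl hl | skip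
      all_goals simp [omega, theta, ← hk]; ring
    rw [hU2, Matrix.mulVec_smul, Matrix.mulVec_smul, hU, hX, hω]
    ext i
    simp only [Pi.add_apply, Pi.sub_apply, Pi.smul_apply, smul_eq_mul]
    ring

end HirotaData

/-! ### Complex conjugation of the Volterra problem -/

lemma map_conj_inv (G : Mat3) : (G.map conj)⁻¹ = G⁻¹.map conj := by
  have h : ∀ A : Mat3, A.map conj = Aᴴᵀ := fun A => by
    ext i j
    simp [Matrix.conjTranspose_apply]
  rw [h, h, Matrix.conjTranspose_nonsing_inv, Matrix.transpose_nonsing_inv]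

lemma map_conj_mulVec_star (A : Mat3) (v : C3) : A.map conj *ᵥ star v = star (A *ᵥ v) := by
  ext i
  simp [Matrix.mulVec, dotProduct]

lemma norm_star_C3 (v : C3) : ‖star v‖ = ‖v‖ := by
  simp [Pi.norm_def]

section

variable {G : Mat3} {θ : Fin 3 → ℂ} {Q : ℝ → Mat3} {l : Fin 3} {κ : ℝ}

lemma jostGen_conj :
    jostGen (G.map conj) (fun j => -conj (θ j)) l = (jostGen G θ l).map conj := by
  simp only [jostGen, map_conj_inv, Matrix.map_mul]
  congr 3
  rw [Matrix.diagonal_map (map_zero _)]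
  congr 1
  ext j
  simp only [map_mul, map_sub, conj_I]
  ring

lemma LeftAdmissible.conj (h : LeftAdmissible G θ Q l κ) :
    LeftAdmissible (G.map conj) (fun j => -conj (θ j)) (fun y => (Q y).map conj) l κ where
  det := by
    have := h.det.map (starRingEnd ℂ)
    rwa [RingHom.map_det] at this
  rate_nonneg := h.rate_nonneg
  rate j := by simpa [add_comm] using h.rate j
  cont := continuous_mat3_iff.2 fun i j =>
    Complex.continuous_conj.comp (continuous_mat3_iff.1 h.cont i j)
  integ a := by
    have : ∀ y, entrySum ((Q y).map conj) = entrySum (Q y) := fun y => by simp [entrySum]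
    simpa only [this] using h.integ a

lemma LeftAdmissible.leftJost_conj (h : LeftAdmissible G θ Q l κ) :
    leftJost (G.map conj) (fun j => -conj (θ j)) (fun y => (Q y).map conj) l =
      fun x => star (leftJost G θ Q l x) := by
  refine (h.conj.eq_of_hasDerivAt (fun x => ?_) ?_).symm
  · refine (h.hasDerivAt x).star.congr_deriv ?_
    rw [jostGen_conj, ← map_conj_mulVec_star, Matrix.map_add _ (map_add _)]
  · have : ∀ x, ‖star (leftJost G θ Q l x) - (G.map conj)ᵀ l‖ = ‖leftJost G θ Q l x - Gᵀ l‖ :=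
      fun x => by
        rw [← norm_star_C3 (leftJost G θ Q l x - Gᵀ l), star_sub]
        rfl
    simpa only [this] using h.tendsto

end

namespace HirotaData

variable {D : HirotaData}

/-! ### Symmetries of the uniformization -/

lemma theta_conj (z : ℂ) (j : Fin 3) : D.theta (conj z) j = conj (D.theta z j) := by
  fin_cases j <;> simp [theta, lam, kk, map_ofNat]

lemma mu_conj (z : ℂ) : D.mu (conj z) = conj (D.mu z) := by simp [mu]

lemma kk_conj (z : ℂ) : D.kk (conj z) = conj (D.kk z) := by simp [kk, map_ofNat]

lemma dd_conj (z : ℂ) (j : Fin 3) : D.dd (conj z) j = conj (D.dd z j) := by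
  fin_cases j <;> simp [dd, mu_conj]

lemma omega_conj (z : ℂ) (j : Fin 3) : D.omega (conj z) j = conj (D.omega z j) := by
  fin_cases j <;> simp [omega, lam, kk, map_ofNat]

lemma hh_conj (z : ℂ) (x t : ℝ) (j : Fin 3) : D.hh (conj z) x t j = conj (D.hh z x t j) := by
  simp [hh_apply, theta_conj, omega_conj]

lemma hh_sum (z : ℂ) (x t : ℝ) :
    D.hh z x t 0 + D.hh z x t 1 + D.hh z x t 2 = D.h2 z x t := by
  simp [hh]

/-- The involution `ẑ = -u_o²/z`. -/
def zhat (D : HirotaData) (z : ℂ) : ℂ := -(D.u0 : ℂ) ^ 2 / z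

/-- The exchange of the first and the third index, which `ẑ` induces. -/
def swapIdx : Fin 3 → Fin 3 := ![2, 1, 0]

/-- The factors relating the columns at `ẑ` to those at `z`. -/
def hatFactor (D : HirotaData) (z : ℂ) : Fin 3 → ℂ := ![z / (I * D.u0), 1, z / (I * D.u0)]

lemma zhat_ne_zero (hu0 : D.uo ≠ 0) {z : ℂ} (hz : z ≠ 0) : D.zhat z ≠ 0 := by
  have := u0_ne hu0
  simp [zhat, hz, this]

lemma zhat_conj (z : ℂ) : D.zhat (conj z) = conj (D.zhat z) := by simp [zhat]

lemma kk_zhat (hu0 : D.uo ≠ 0) {z : ℂ} (hz : z ≠ 0) : D.kk (D.zhat z) = D.kk z := by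
  have := u0_ne hu0
  simp only [kk, zhat]
  field_simp
  ring

lemma theta_zhat (hu0 : D.uo ≠ 0) {z : ℂ} (hz : z ≠ 0) (l : Fin 3) :
    D.theta (D.zhat z) l = D.theta z (swapIdx l) := by
  have := u0_ne hu0
  have hl : D.lam (D.zhat z) = -D.lam z := by
    simp only [lam, zhat]
    field_simp
    ring
  fin_cases l <;> simp [theta, swapIdx, hl, kk_zhat hu0 hz]

lemma mu_zhat (hu0 : D.uo ≠ 0) {z : ℂ} (hz : z ≠ 0) :
    D.mu (D.zhat z) = D.mu z * (z ^ 2 / (D.u0 : ℂ) ^ 2) := by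
  have := u0_ne hu0
  simp only [mu, zhat]
  field_simp
  ring

lemma mu_zhat_ne_zero (hu0 : D.uo ≠ 0) {z : ℂ} (hz : z ≠ 0) (hmu : D.mu z ≠ 0) :
    D.mu (D.zhat z) ≠ 0 := by
  have := u0_ne hu0
  rw [mu_zhat hu0 hz]
  exact mul_ne_zero hmu (by positivity)

lemma mu_conj_ne_zero {z : ℂ} (hmu : D.mu z ≠ 0) : D.mu (conj z) ≠ 0 := by
  rw [mu_conj]
  simpa using hmu

lemma dd_ne_zero {z : ℂ} (hmu : D.mu z ≠ 0) (j : Fin 3) : D.dd z j ≠ 0 := by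
  fin_cases j <;> simp [dd, hmu]

lemma hatFactor_ne_zero (hu0 : D.uo ≠ 0) {z : ℂ} (hz : z ≠ 0) (l : Fin 3) :
    D.hatFactor z l ≠ 0 := by
  have := u0_ne hu0
  fin_cases l <;> simp [hatFactor, hz, this]

lemma ne_zero_of_norm (hu0 : D.uo ≠ 0) {v : C2} (hv : ‖v‖ = D.u0) : v ≠ 0 := by
  rw [← norm_pos_iff, hv]
  exact u0_pos hu0

lemma det_eigMatrix_eq (hu0 : D.uo ≠ 0) {v : C2} (hv : ‖v‖ = D.u0) {z : ℂ} (hz : z ≠ 0) :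
    (eigMatrix v z).det = D.mu z := by
  rw [det_eigMatrix (ne_zero_of_norm hu0 hv) hz, hv, mu]

lemma adj_dotProduct_eigMatrix (hu0 : D.uo ≠ 0) {v : C2} (hv : ‖v‖ = D.u0) {z : ℂ} (hz : z ≠ 0)
    (j l : Fin 3) :
    star ((eigMatrix v (conj z))ᵀ j) ⬝ᵥ (eigMatrix v z)ᵀ l = if j = l then D.dd z j else 0 := by
  have h := congrFun (congrFun (adj_transpose_mul_eigMatrix (ne_zero_of_norm hu0 hv) hz) j) l
  have h' : star ((eigMatrix v (conj z))ᵀ j) ⬝ᵥ (eigMatrix v z)ᵀ l =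
      (((eigMatrix v (conj z)).map conj)ᵀ * eigMatrix v z) j l := rfl
  rw [h', h, hv, Matrix.diagonal_apply]
  rfl

lemma eigMatrix_zhat (hu0 : D.uo ≠ 0) {v : C2} (hv : ‖v‖ = D.u0) {z : ℂ} (hz : z ≠ 0)
    (l : Fin 3) :
    (eigMatrix v (D.zhat z))ᵀ l = D.hatFactor z l • (eigMatrix v z)ᵀ (swapIdx l) := by
  have := u0_ne hu0
  ext i
  fin_cases l <;> fin_cases i <;> simp [eigMatrix, zhat, hatFactor, swapIdx, hv] <;> field_simp <;>
    simp

/-- The factors relating the vector products of adjoint eigenfunctions to the eigenfunctions. -/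
def crossFactor (D : HirotaData) (z : ℂ) : Fin 3 → ℂ := ![1, D.mu z, 1]

lemma crossFactor_ne_zero {z : ℂ} (hmu : D.mu z ≠ 0) (j : Fin 3) : D.crossFactor z j ≠ 0 := by
  fin_cases j <;> simp [crossFactor, hmu]

lemma crossProduct_eigMatrix (hu0 : D.uo ≠ 0) {v : C2} (hv : ‖v‖ = D.u0) {z : ℂ} (hz : z ≠ 0)
    (c : Fin 3) :
    crossProduct (star ((eigMatrix v (conj z))ᵀ (c + 1))) (star ((eigMatrix v (conj z))ᵀ (c + 2)))
      = D.crossFactor z c • (eigMatrix v z)ᵀ c := by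
  have hn := u0_ne hu0
  have h := normSq_C2 v
  rw [hv] at h
  ext i
  fin_cases c <;> fin_cases i <;>
    simp [eigMatrix, crossFactor, hv, cross_apply, mu] <;> field_simp <;> ring_nf <;>
    simp only [I_sq, h] <;> ring

lemma jostGen_eigMatrix (hu0 : D.uo ≠ 0) {v : C2} (hv : ‖v‖ = D.u0) {z : ℂ} (hz : z ≠ 0)
    (hmu : D.mu z ≠ 0) (l : Fin 3) :
    jostGen (eigMatrix v z) (D.theta z) l = laxX (D.kk z) v - (I * D.theta z l) • (1 : Mat3) := by
  have hdet : IsUnit (eigMatrix v z).det := by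
    rw [det_eigMatrix_eq hu0 hv hz]
    exact hmu.isUnit
  have h : eigMatrix v z * Matrix.diagonal (fun j => I * (D.theta z j - D.theta z l)) =
      (laxX (D.kk z) v - (I * D.theta z l) • (1 : Mat3)) * eigMatrix v z := by
    ext i j
    have hj := congrFun (laxX_mulVec_eigMatrix hu0 hv hz j) i
    have hj' : (laxX (D.kk z) v * eigMatrix v z) i j =
        I * D.theta z j * eigMatrix v z i j := hj
    rw [Matrix.mul_diagonal, Matrix.sub_mul, Matrix.sub_apply, hj', Matrix.smul_mul,
      Matrix.one_mul, Matrix.smul_apply, smul_eq_mul]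
    ring
  rw [jostGen, h, Matrix.mul_assoc, Matrix.mul_nonsing_inv _ hdet, Matrix.mul_one]

/-! ### Eigenfunctions characterized by the differential equation -/

/-- `f` solves the modified `x`-equation for the `l`-th column at time `t`, and approaches the
`l`-th background eigenvector along `F` faster than `e^{-κ|x|}`. -/
structure JostAt (D : HirotaData) (v : C2) (F : Filter ℝ) (κ t : ℝ) (z : ℂ) (l : Fin 3)
    (f : ℝ → C3) : Prop where
  deriv : ∀ x, HasDerivAt f ((D.Xmat z x t - (I * D.theta z l) • (1 : Mat3)) *ᵥ f x) x
  lim : Tendsto (fun x => Real.exp (κ * |x|) * ‖f x - (eigMatrix v z)ᵀ l‖) F (𝓝 0)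

lemma Xmat_conj (z : ℂ) (x t : ℝ) : (D.Xmat (conj z) x t).map conj = -(D.Xmat z x t)ᵀ := by
  rw [Xmat, kk_conj, laxX_conj_transpose]
  rfl

lemma Tmat_conj (z : ℂ) (x t : ℝ) : (D.Tmat (conj z) x t).map conj = -(D.Tmat z x t)ᵀ := by
  rw [Tmat, kk_conj, laxT_conj_transpose]
  rfl

variable {v : C2} {F : Filter ℝ} {κ t : ℝ} {z : ℂ}

lemma JostAt.tendsto {l : Fin 3} {f : ℝ → C3} (hκ : 0 ≤ κ) (h : D.JostAt v F κ t z l f) :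
    Tendsto f F (𝓝 ((eigMatrix v z)ᵀ l)) := by
  refine tendsto_iff_norm_sub_tendsto_zero.2 ?_
  refine squeeze_zero (fun _ => norm_nonneg _) (fun x => ?_) h.lim
  have : 1 ≤ Real.exp (κ * |x|) := Real.one_le_exp (mul_nonneg hκ (abs_nonneg x))
  nlinarith [norm_nonneg (f x - (eigMatrix v z)ᵀ l)]

/-- The derivative of the conjugate of an eigenfunction at `z^*`. -/
lemma JostAt.deriv_star {l : Fin 3} {f : ℝ → C3} (h : D.JostAt v F κ t (conj z) l f) (x : ℝ) :
    HasDerivAt (fun x => star (f x))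
      ((-(D.Xmat z x t)ᵀ + (I * D.theta z l) • (1 : Mat3)) *ᵥ star (f x)) x := by
  refine (h.deriv x).star.congr_deriv ?_
  rw [← map_conj_mulVec_star]
  congr 1
  rw [Matrix.map_sub _ (map_sub _), Xmat_conj, sub_eq_add_neg]
  congr 1
  ext i j
  simp [theta_conj, Matrix.one_apply]
  split_ifs <;> simp

lemma JostAt.lim_star {l : Fin 3} {f : ℝ → C3} (h : D.JostAt v F κ t z l f) :
    Tendsto (fun x => Real.exp (κ * |x|) * ‖star (f x) - star ((eigMatrix v z)ᵀ l)‖) F (𝓝 0) := by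
  simpa only [← star_sub, norm_star_C3] using h.lim

/-- The symmetry `z ↦ ẑ` of the eigenfunctions. -/
lemma JostAt.hat (hu0 : D.uo ≠ 0) (hv : ‖v‖ = D.u0) (hz : z ≠ 0) {l : Fin 3} {f : ℝ → C3}
    (h : D.JostAt v F κ t z (swapIdx l) f) :
    D.JostAt v F κ t (D.zhat z) l fun x => D.hatFactor z l • f x where
  deriv x := by
    refine ((h.deriv x).const_smul (D.hatFactor z l)).congr_deriv ?_
    rw [theta_zhat hu0 hz, Matrix.mulVec_smul, Xmat, Xmat, kk_zhat hu0 hz]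
  lim := by
    have := h.lim.const_mul ‖D.hatFactor z l‖
    rw [mul_zero] at this
    refine this.congr fun x => ?_
    rw [eigMatrix_zhat hu0 hv hz, ← smul_sub, norm_smul]
    ring

end HirotaData

/-! ### Pairings and vector products of eigenfunctions -/

lemma norm_dotProduct_le (a b : C3) : ‖a ⬝ᵥ b‖ ≤ 3 * (‖a‖ * ‖b‖) := by
  calc ‖a ⬝ᵥ b‖ ≤ ∑ i, ‖a i * b i‖ := norm_sum_le _ _
    _ ≤ ∑ _i : Fin 3, ‖a‖ * ‖b‖ := by
        refine Finset.sum_le_sum fun i _ => ?_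
        rw [norm_mul]
        exact mul_le_mul (norm_le_pi_norm a i) (norm_le_pi_norm b i) (norm_nonneg _)
          (norm_nonneg _)
    _ = 3 * (‖a‖ * ‖b‖) := by simp

lemma norm_crossProduct_le (a b : C3) : ‖crossProduct a b‖ ≤ 2 * (‖a‖ * ‖b‖) := by
  refine (pi_norm_le_iff_of_nonneg (by positivity)).2 fun i => ?_
  have h : ∀ p q r s : Fin 3, ‖a p * b q - a r * b s‖ ≤ 2 * (‖a‖ * ‖b‖) := fun p q r s => by
    refine (norm_sub_le _ _).trans ?_
    rw [norm_mul, norm_mul, two_mul]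
    exact add_le_add
      (mul_le_mul (norm_le_pi_norm a p) (norm_le_pi_norm b q) (norm_nonneg _) (norm_nonneg _))
      (mul_le_mul (norm_le_pi_norm a r) (norm_le_pi_norm b s) (norm_nonneg _) (norm_nonneg _))
  rw [cross_apply]
  fin_cases i <;> exact h _ _ _ _

lemma HasDerivAt.dotProduct {a b : ℝ → C3} {a' b' : C3} {x : ℝ} (ha : HasDerivAt a a' x)
    (hb : HasDerivAt b b' x) :
    HasDerivAt (fun x => a x ⬝ᵥ b x) (a' ⬝ᵥ b x + a x ⬝ᵥ b') x := by
  rw [hasDerivAt_pi] at ha hb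
  simp only [_root_.dotProduct, ← Finset.sum_add_distrib]
  exact HasDerivAt.fun_sum fun i _ => (ha i).mul (hb i)

lemma HasDerivAt.crossProduct {a b : ℝ → C3} {a' b' : C3} {x : ℝ} (ha : HasDerivAt a a' x)
    (hb : HasDerivAt b b' x) :
    HasDerivAt (fun x => crossProduct (a x) (b x))
      (crossProduct a' (b x) + crossProduct (a x) b') x := by
  rw [hasDerivAt_pi] at ha hb ⊢
  intro i
  have h : ∀ p q r s : Fin 3, HasDerivAt (fun x => a x p * b x q - a x r * b x s)
      (a' p * b x q - a' r * b x s + (a x p * b' q - a x r * b' s)) x := fun p q r s =>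
    (((ha p).mul (hb q)).sub ((ha r).mul (hb s))).congr_deriv (by ring)
  simp only [cross_apply]
  fin_cases i <;> exact h _ _ _ _

/-- Solutions of a linear system and of its adjoint system have constant pairing. -/
lemma hasDerivAt_pairing_zero {a b : ℝ → C3} {A : Mat3} {x : ℝ}
    (ha : HasDerivAt a (-Aᵀ *ᵥ a x) x) (hb : HasDerivAt b (A *ᵥ b x) x) :
    HasDerivAt (fun x => a x ⬝ᵥ b x) 0 x := by
  refine (ha.dotProduct hb).congr_deriv ?_
  rw [Matrix.neg_mulVec, neg_dotProduct, Matrix.mulVec_transpose, Matrix.dotProduct_mulVec]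
  ring

/-- The vector product of two solutions of the adjoint system. -/
lemma crossProduct_adjoint (A : Mat3) (a b : C3) :
    crossProduct (Aᵀ *ᵥ a) b + crossProduct a (Aᵀ *ᵥ b) =
      A.trace • crossProduct a b - A *ᵥ crossProduct a b := by
  ext i
  fin_cases i <;>
    simp [cross_apply, Matrix.mulVec, dotProduct, Fin.sum_univ_three, Matrix.trace] <;> ring

namespace HirotaData

variable {D : HirotaData} {v : C2} {F : Filter ℝ} {κ t : ℝ} {z : ℂ}

lemma theta_sum (z : ℂ) (c : Fin 3) :
    D.theta z (c + 1) + D.theta z (c + 2) = D.kk z - D.theta z c := by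
  fin_cases c <;> simp [theta]
  ring

lemma trace_Xmat (z : ℂ) (x t : ℝ) : (D.Xmat z x t).trace = I * D.kk z := by
  simp [Xmat, laxX, sigmaMat, potMatrix, Matrix.trace, Fin.sum_univ_three]

/-- The vector product of two adjoint eigenfunctions is a multiple of the third
eigenfunction. -/
lemma JostAt.cross (hu0 : D.uo ≠ 0) (hv : ‖v‖ = D.u0) (hz : z ≠ 0) (hmu : D.mu z ≠ 0)
    (hκ : 0 ≤ κ) {c : Fin 3} {f g : ℝ → C3} (hf : D.JostAt v F κ t (conj z) (c + 1) f)
    (hg : D.JostAt v F κ t (conj z) (c + 2) g) :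
    D.JostAt v F κ t z c
      fun x => (D.crossFactor z c)⁻¹ • crossProduct (star (f x)) (star (g x)) where
  deriv x := by
    refine (((hf.deriv_star x).crossProduct (hg.deriv_star x)).const_smul
      (D.crossFactor z c)⁻¹).congr_deriv ?_
    rw [Matrix.mulVec_smul]
    congr 1
    -- the trace of `X` is absorbed by the sum of the three frequencies
    have h := crossProduct_adjoint (D.Xmat z x t) (star (f x)) (star (g x))
    simp only [Matrix.add_mulVec, Matrix.sub_mulVec, Matrix.neg_mulVec, Matrix.smul_mulVec,
      Matrix.one_mulVec, map_add, map_neg, map_smul, LinearMap.add_apply, LinearMap.neg_apply,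
      LinearMap.smul_apply]
    have h3 := theta_sum (D := D) z c
    rw [trace_Xmat] at h
    have h4 : (I * D.kk z) • crossProduct (star (f x)) (star (g x)) =
        (I * D.theta z (c + 1)) • crossProduct (star (f x)) (star (g x))
        + (I * D.theta z (c + 2)) • crossProduct (star (f x)) (star (g x))
        + (I * D.theta z c) • crossProduct (star (f x)) (star (g x)) := by
      rw [← add_smul, ← add_smul, ← mul_add, ← mul_add, h3, sub_add_cancel]
    rw [h4] at h
    rw [← sub_eq_zero] at h ⊢
    rw [← neg_eq_zero, ← h]
    abel
  lim := by
    set a := star ((eigMatrix v (conj z))ᵀ (c + 1))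
    set b := star ((eigMatrix v (conj z))ᵀ (c + 2))
    have hG : (eigMatrix v z)ᵀ c = (D.crossFactor z c)⁻¹ • crossProduct a b := by
      rw [crossProduct_eigMatrix hu0 hv hz, smul_smul,
        inv_mul_cancel₀ (crossFactor_ne_zero hmu c), one_smul]
    have hg' : Tendsto (fun x => ‖star (g x)‖) F (𝓝 ‖b‖) := by
      simpa only [b, norm_star_C3] using (hg.tendsto hκ).norm
    have hlim : Tendsto (fun x => ‖(D.crossFactor z c)⁻¹‖ *
        (2 * ((Real.exp (κ * |x|) * ‖star (f x) - a‖) * ‖star (g x)‖)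
          + 2 * (‖a‖ * (Real.exp (κ * |x|) * ‖star (g x) - b‖)))) F (𝓝 0) := by
      have h := ((((hf.lim_star).mul hg').const_mul 2).add
        (((hg.lim_star).const_mul ‖a‖).const_mul 2)).const_mul ‖(D.crossFactor z c)⁻¹‖
      simpa using h
    refine squeeze_zero (fun x => by positivity) (fun x => ?_) hlim
    have hsplit : crossProduct (star (f x)) (star (g x)) - crossProduct a b =
        crossProduct (star (f x) - a) (star (g x)) + crossProduct a (star (g x) - b) := by
      simp only [map_sub, LinearMap.sub_apply]
      abel
    rw [hG, ← smul_sub, norm_smul, hsplit]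
    have h1 := norm_crossProduct_le (star (f x) - a) (star (g x))
    have h2 := norm_crossProduct_le a (star (g x) - b)
    calc Real.exp (κ * |x|) * (‖(D.crossFactor z c)⁻¹‖ * ‖crossProduct (star (f x) - a) (star (g x))
          + crossProduct a (star (g x) - b)‖)
        ≤ Real.exp (κ * |x|) * (‖(D.crossFactor z c)⁻¹‖ * (2 * (‖star (f x) - a‖ * ‖star (g x)‖)
          + 2 * (‖a‖ * ‖star (g x) - b‖))) := by
          gcongr
          exact (norm_add_le _ _).trans (add_le_add h1 h2)
      _ = _ := by ring

/-- The pairing of adjoint eigenfunctions and eigenfunctions with the same normalization is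
diagonal. Off the diagonal, the decay of the remainders outweighs the exponential factor. -/
lemma JostAt.pairing (hu0 : D.uo ≠ 0) (hv : ‖v‖ = D.u0) (hz : z ≠ 0) (hκ : 0 ≤ κ) [F.NeBot]
    {j l : Fin 3} {f g : ℝ → C3} (hf : D.JostAt v F κ t (conj z) j f)
    (hg : D.JostAt v F κ t z l g)
    (hF : ∀ᶠ x in F, -(x * (D.theta z l - D.theta z j).im) ≤ κ * |x|) (x : ℝ) :
    exp (I * (D.hh z x t l - D.hh z x t j)) * (star (f x) ⬝ᵥ g x) =
      if j = l then D.dd z j else 0 := by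
  set a := star ((eigMatrix v (conj z))ᵀ j) with ha
  set b := (eigMatrix v z)ᵀ l with hb
  set e : ℝ → ℂ := fun x => exp (I * (D.hh z x t l - D.hh z x t j)) with he
  have hed : ∀ x, HasDerivAt e (I * (D.theta z l - D.theta z j) * e x) x := fun x => by
    have h1 : HasDerivAt (fun x : ℝ => I * (D.hh z x t l - D.hh z x t j))
        (I * (D.theta z l - D.theta z j)) x := by
      simp only [hh_apply]
      refine (((((Complex.ofRealCLM.hasDerivAt (x := x)).const_mul (D.theta z l)).add_const
        (D.omega z l * t)).sub (((Complex.ofRealCLM.hasDerivAt (x := x)).const_mul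
        (D.theta z j)).add_const (D.omega z j * t))).const_mul I).congr_deriv ?_
      simp
    refine h1.cexp.congr_deriv ?_
    ring
  have hd : ∀ x, HasDerivAt (fun x => e x * (star (f x) ⬝ᵥ g x)) 0 x := fun x => by
    refine ((hed x).mul ((hf.deriv_star x).dotProduct (hg.deriv x))).congr_deriv ?_
    rw [Matrix.add_mulVec, Matrix.sub_mulVec, Matrix.smul_mulVec, Matrix.smul_mulVec,
      Matrix.one_mulVec, Matrix.one_mulVec, add_dotProduct, dotProduct_sub, Matrix.neg_mulVec,
      neg_dotProduct, Matrix.mulVec_transpose, Matrix.dotProduct_mulVec, smul_dotProduct,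
      dotProduct_smul, smul_eq_mul, smul_eq_mul]
    ring
  have hconst : ∀ y, e y * (star (f y) ⬝ᵥ g y) = e x * (star (f x) ⬝ᵥ g x) := fun y =>
    is_const_of_deriv_eq_zero (fun x => (hd x).differentiableAt) (fun x => (hd x).deriv) y x
  have hab : ∀ y, e y * (a ⬝ᵥ b) = if j = l then D.dd z j else 0 := fun y => by
    rw [ha, hb, adj_dotProduct_eigMatrix hu0 hv hz]
    split_ifs with h
    · simp [he, h]
    · rw [mul_zero]
  have hg' : Tendsto (fun x => ‖g x‖) F (𝓝 ‖b‖) := (hg.tendsto hκ).norm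
  set C : ℝ := ‖exp (I * (D.omega z l - D.omega z j) * t)‖ with hC
  -- the exponential grows at most at the rate `κ`, at which both remainders decay
  have henorm : ∀ᶠ y in F, ‖e y‖ ≤ C * Real.exp (κ * |y|) := by
    filter_upwards [hF] with y hy
    have : e y = exp (I * (D.omega z l - D.omega z j) * t) *
        exp (I * y * (D.theta z l - D.theta z j)) := by
      rw [he, ← Complex.exp_add]
      simp only [hh_apply]
      congr 1
      ring
    rw [this, norm_mul, norm_exp_I_mul]
    gcongr
  have hlim : Tendsto (fun y => C * (3 * ((Real.exp (κ * |y|) * ‖star (f y) - a‖) * ‖g y‖)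
      + 3 * (‖a‖ * (Real.exp (κ * |y|) * ‖g y - b‖)))) F (𝓝 0) := by
    have h := ((((hf.lim_star).mul hg').const_mul 3).add
      (((hg.lim).const_mul ‖a‖).const_mul 3)).const_mul C
    simpa using h
  have hzero : Tendsto (fun _ : ℝ => ‖e x * (star (f x) ⬝ᵥ g x) -
      if j = l then D.dd z j else 0‖) F (𝓝 0) := by
    refine squeeze_zero' (Eventually.of_forall fun _ => norm_nonneg _) ?_ hlim
    filter_upwards [henorm] with y hy
    have hsplit : star (f y) ⬝ᵥ g y - a ⬝ᵥ b = (star (f y) - a) ⬝ᵥ g y + a ⬝ᵥ (g y - b) := by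
      rw [sub_dotProduct, dotProduct_sub]
      ring
    rw [← hconst y, ← hab y, ← mul_sub, norm_mul, hsplit]
    have h1 := norm_dotProduct_le (star (f y) - a) (g y)
    have h2 := norm_dotProduct_le a (g y - b)
    calc ‖e y‖ * ‖(star (f y) - a) ⬝ᵥ g y + a ⬝ᵥ (g y - b)‖
        ≤ (C * Real.exp (κ * |y|)) * (3 * (‖star (f y) - a‖ * ‖g y‖) + 3 * (‖a‖ * ‖g y - b‖)) := by
          gcongr
          exact (norm_add_le _ _).trans (add_le_add h1 h2)
      _ = _ := by ring
  have := tendsto_nhds_unique hzero tendsto_const_nhds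
  exact sub_eq_zero.1 (norm_eq_zero.1 this.symm)

end HirotaData

/-! ### The Jost eigenfunctions of the Hirota equation -/

lemma entrySum_potMatrix_sub_le (a b : C2) :
    entrySum (potMatrix a - potMatrix b) ≤ 4 * ‖a - b‖ := by
  have h0 : ‖a 0 - b 0‖ ≤ ‖a - b‖ := PiLp.norm_apply_le (a - b) 0
  have h1 : ‖a 1 - b 1‖ ≤ ‖a - b‖ := PiLp.norm_apply_le (a - b) 1
  have h0' : ‖-conj (a 0) + conj (b 0)‖ ≤ ‖a - b‖ := by
    rw [← norm_neg, ← Complex.norm_conj]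
    simpa [sub_eq_add_neg, add_comm] using h0
  have h1' : ‖-conj (a 1) + conj (b 1)‖ ≤ ‖a - b‖ := by
    rw [← norm_neg, ← Complex.norm_conj]
    simpa [sub_eq_add_neg, add_comm] using h1
  simp only [entrySum, Fin.sum_univ_three, Matrix.sub_apply]
  simp [potMatrix]
  linarith

lemma integrableOn_entrySum_potMatrix {w : ℝ → C2} (hw : Continuous w) {v : C2} {κ : ℝ}
    {s : Set ℝ} (h : IntegrableOn (fun x => Real.exp (κ * |x|) • (w x - v)) s) :
    IntegrableOn (fun x => Real.exp (κ * |x|) * entrySum (potMatrix (w x) - potMatrix v)) s := by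
  have hc : Continuous fun x => Real.exp (κ * |x|) * entrySum (potMatrix (w x) - potMatrix v) :=
    (by fun_prop : Continuous fun x : ℝ => Real.exp (κ * |x|)).mul (continuous_entrySum.comp
      ((continuous_potMatrix.comp hw).sub continuous_const))
  refine (h.norm.const_mul 4).mono' hc.aestronglyMeasurable (Eventually.of_forall fun x => ?_)
  rw [norm_mul, norm_smul, Real.norm_of_nonneg (Real.exp_pos _).le,
    Real.norm_of_nonneg (entrySum_nonneg _)]
  nlinarith [entrySum_potMatrix_sub_le (w x) v, Real.exp_pos (κ * |x|)]

namespace HirotaData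

variable {D : HirotaData}

/-- The conditions under which the `l`-th Jost eigenfunction normalized at `-∞` exists at `z` and
at time `t`, where `κ` is the rate of decay of the potential. -/
structure AdmM (D : HirotaData) (κ t : ℝ) (z : ℂ) (l : Fin 3) : Prop where
  ne_zero : z ≠ 0
  mu_ne_zero : D.mu z ≠ 0
  adm : LeftAdmissible (eigMatrix D.um z) (D.theta z)
    (fun y => potMatrix (D.u y t) - potMatrix D.um) l κ

/-- The same for the normalization at `+∞`. -/
structure AdmP (D : HirotaData) (κ t : ℝ) (z : ℂ) (l : Fin 3) : Prop where
  ne_zero : z ≠ 0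
  mu_ne_zero : D.mu z ≠ 0
  adm : RightAdmissible (eigMatrix D.up z) (D.theta z)
    (fun y => potMatrix (D.u y t) - potMatrix D.up) l κ

lemma admM_of_rate (hu0 : D.uo ≠ 0) (hu : D.IsSolution) {κ t : ℝ} (hκ : 0 ≤ κ)
    (hint : ∀ a, IntegrableOn (fun x => Real.exp (κ * |x|) • (D.u x t - D.um)) (Set.Iic a))
    {z : ℂ} (hz : z ≠ 0) (hmu : D.mu z ≠ 0) {l : Fin 3}
    (hr : ∀ j, -κ ≤ (D.theta z j - D.theta z l).im) : D.AdmM κ t z l where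
  ne_zero := hz
  mu_ne_zero := hmu
  adm :=
    { det := by
        rw [det_eigMatrix_eq hu0 norm_um hz]
        exact hmu.isUnit
      rate_nonneg := hκ
      rate := hr
      cont := (continuous_potMatrix.comp (continuous_u_fst hu t)).sub continuous_const
      integ := fun a => integrableOn_entrySum_potMatrix (continuous_u_fst hu t) (hint a) }

lemma admP_of_rate (hu0 : D.uo ≠ 0) (hu : D.IsSolution) {κ t : ℝ} (hκ : 0 ≤ κ)
    (hint : ∀ a, IntegrableOn (fun x => Real.exp (κ * |x|) • (D.u x t - D.up)) (Set.Ici a))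
    {z : ℂ} (hz : z ≠ 0) (hmu : D.mu z ≠ 0) {l : Fin 3}
    (hr : ∀ j, -κ ≤ (D.theta z l - D.theta z j).im) : D.AdmP κ t z l where
  ne_zero := hz
  mu_ne_zero := hmu
  adm :=
    { det := by
        rw [det_eigMatrix_eq hu0 norm_up hz]
        exact hmu.isUnit
      rate_nonneg := hκ
      rate := fun j => by
        have := hr j
        simp only [Pi.neg_apply, Complex.sub_im, Complex.neg_im] at this ⊢
        linarith
      cont := (((continuous_potMatrix.comp (continuous_u_fst hu t)).sub
        continuous_const).comp continuous_neg).neg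
      integ := fun a => by
        have h := integrableOn_entrySum_potMatrix (continuous_u_fst hu t) (hint (-a))
        have h2 := ((Measure.measurePreserving_neg (volume : Measure ℝ)).integrableOn_comp_preimage
          (Homeomorph.neg ℝ).measurableEmbedding).2 h
        simpa [Function.comp_def, entrySum_neg, -neg_sub] using h2 }

lemma jostGen_add_eq_Xmat (hu0 : D.uo ≠ 0) {v : C2} (hv : ‖v‖ = D.u0) {z : ℂ} (hz : z ≠ 0)
    (hmu : D.mu z ≠ 0) (l : Fin 3) (x t : ℝ) :
    jostGen (eigMatrix v z) (D.theta z) l + (potMatrix (D.u x t) - potMatrix v) =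
      D.Xmat z x t - (I * D.theta z l) • (1 : Mat3) := by
  rw [jostGen_eigMatrix hu0 hv hz hmu, Xmat, laxX, laxX]
  abel

variable {κ t : ℝ} {z : ℂ} {l : Fin 3}

lemma AdmM.jostAt (hu0 : D.uo ≠ 0) (h : D.AdmM κ t z l) :
    D.JostAt D.um atBot κ t z l fun x => D.phiM z x t l where
  deriv x := by
    rw [← jostGen_add_eq_Xmat hu0 norm_um h.ne_zero h.mu_ne_zero]
    exact h.adm.hasDerivAt x
  lim := h.adm.tendsto

lemma AdmP.jostAt (hu0 : D.uo ≠ 0) (h : D.AdmP κ t z l) :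
    D.JostAt D.up atTop κ t z l fun x => D.phiP z x t l where
  deriv x := by
    rw [← jostGen_add_eq_Xmat hu0 norm_up h.ne_zero h.mu_ne_zero]
    exact RightAdmissible.hasDerivAt h.adm x
  lim := RightAdmissible.tendsto h.adm

lemma AdmM.eq_phiM (hu0 : D.uo ≠ 0) (h : D.AdmM κ t z l) {f : ℝ → C3}
    (hf : D.JostAt D.um atBot κ t z l f) : f = fun x => D.phiM z x t l := by
  refine h.adm.eq_of_hasDerivAt (fun x => ?_) hf.lim
  rw [jostGen_add_eq_Xmat hu0 norm_um h.ne_zero h.mu_ne_zero]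
  exact hf.deriv x

lemma AdmP.eq_phiP (hu0 : D.uo ≠ 0) (h : D.AdmP κ t z l) {f : ℝ → C3}
    (hf : D.JostAt D.up atTop κ t z l f) : f = fun x => D.phiP z x t l := by
  refine RightAdmissible.eq_of_hasDerivAt h.adm (fun x => ?_) hf.lim
  rw [jostGen_add_eq_Xmat hu0 norm_up h.ne_zero h.mu_ne_zero]
  exact hf.deriv x

lemma neg_theta_eq (z : ℂ) : -D.theta z = fun j => -conj (D.theta (conj z) j) := by
  ext j
  simp [theta_conj]

lemma AdmM.adjM_eq (h : D.AdmM κ t (conj z) l) (x : ℝ) :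
    D.adjM z x t l = star (D.phiM (conj z) x t l) := by
  rw [adjM, neg_theta_eq, h.adm.leftJost_conj]
  rfl

lemma AdmP.adjP_eq (h : D.AdmP κ t (conj z) l) (x : ℝ) :
    D.adjP z x t l = star (D.phiP (conj z) x t l) := by
  have hn : (fun y => -(potMatrix (D.u (-y) t) - potMatrix D.up).map conj) =
      fun y => (-(potMatrix (D.u (-y) t) - potMatrix D.up)).map conj := by
    ext y i j
    simp
  have hθ : - -D.theta z = fun j => -conj ((-D.theta (conj z)) j) := by
    ext j
    simp [theta_conj]
  have h1 := LeftAdmissible.leftJost_conj h.adm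
  have h2 := LeftAdmissible.conj h.adm
  rw [← hn, ← hθ] at h1 h2
  have h3 : RightAdmissible ((eigMatrix D.up (conj z)).map conj) (-D.theta z)
    (fun y => (potMatrix (D.u y t) - potMatrix D.up).map conj) l κ := h2
  rw [adjP, h3.rightJost_eq, h1, phiP, RightAdmissible.rightJost_eq h.adm]

lemma star_exp_hh (z : ℂ) (x t : ℝ) (l : Fin 3) :
    star (exp (I * D.hh (conj z) x t l)) = exp (-I * D.hh z x t l) := by
  rw [hh_conj, Complex.star_def, ← Complex.exp_conj]
  simp

lemma AdmM.adjJostM_eq (h : D.AdmM κ t (conj z) l) (x : ℝ) :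
    D.adjJostM z x t l = star (D.jostM (conj z) x t l) := by
  rw [adjJostM, h.adjM_eq, jostM, star_smul, star_exp_hh]

lemma AdmP.adjJostP_eq (h : D.AdmP κ t (conj z) l) (x : ℝ) :
    D.adjJostP z x t l = star (D.jostP (conj z) x t l) := by
  rw [adjJostP, h.adjP_eq, jostP, star_smul, star_exp_hh]

/-! ### The differential equations in `x` -/

lemma hasDerivAt_exp_hh (z : ℂ) (x t : ℝ) (l : Fin 3) :
    HasDerivAt (fun x => exp (I * D.hh z x t l))
      (I * D.theta z l * exp (I * D.hh z x t l)) x := by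
  have h1 : HasDerivAt (fun x : ℝ => I * D.hh z x t l) (I * D.theta z l) x := by
    simp only [hh_apply]
    refine ((((Complex.ofRealCLM.hasDerivAt (x := x)).const_mul (D.theta z l)).add_const
      (D.omega z l * t)).const_mul I).congr_deriv ?_
    simp
  refine h1.cexp.congr_deriv ?_
  ring

lemma JostAt.hasDerivAt_smul_exp {v : C2} {F : Filter ℝ} {f : ℝ → C3}
    (h : D.JostAt v F κ t z l f) (x : ℝ) :
    HasDerivAt (fun x => exp (I * D.hh z x t l) • f x)
      (D.Xmat z x t *ᵥ (exp (I * D.hh z x t l) • f x)) x := by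
  refine ((hasDerivAt_exp_hh z x t l).smul (h.deriv x)).congr_deriv ?_
  rw [Matrix.mulVec_smul, Matrix.sub_mulVec, Matrix.smul_mulVec, Matrix.one_mulVec, smul_sub,
    smul_smul, mul_comm (exp _)]
  abel

lemma AdmM.hasDerivAt_jostM (hu0 : D.uo ≠ 0) (h : D.AdmM κ t z l) (x : ℝ) :
    HasDerivAt (fun x => D.jostM z x t l) (D.Xmat z x t *ᵥ D.jostM z x t l) x :=
  (h.jostAt hu0).hasDerivAt_smul_exp x

lemma AdmP.hasDerivAt_jostP (hu0 : D.uo ≠ 0) (h : D.AdmP κ t z l) (x : ℝ) :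
    HasDerivAt (fun x => D.jostP z x t l) (D.Xmat z x t *ᵥ D.jostP z x t l) x :=
  (h.jostAt hu0).hasDerivAt_smul_exp x

lemma AdmM.hasDerivAt_adjJostM (hu0 : D.uo ≠ 0) (h : D.AdmM κ t (conj z) l) (x : ℝ) :
    HasDerivAt (fun x => D.adjJostM z x t l) (-(D.Xmat z x t)ᵀ *ᵥ D.adjJostM z x t l) x := by
  simp only [h.adjJostM_eq]
  refine (h.hasDerivAt_jostM hu0 x).star.congr_deriv ?_
  rw [← map_conj_mulVec_star, Xmat_conj]

lemma AdmP.hasDerivAt_adjJostP (hu0 : D.uo ≠ 0) (h : D.AdmP κ t (conj z) l) (x : ℝ) :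
    HasDerivAt (fun x => D.adjJostP z x t l) (-(D.Xmat z x t)ᵀ *ᵥ D.adjJostP z x t l) x := by
  simp only [h.adjJostP_eq]
  refine (h.hasDerivAt_jostP hu0 x).star.congr_deriv ?_
  rw [← map_conj_mulVec_star, Xmat_conj]

/-! ### The differential equations in `t` -/

lemma hasDerivAt_exp_hh_time (z : ℂ) (x t : ℝ) (l : Fin 3) :
    HasDerivAt (fun t => exp (I * D.hh z x t l))
      (I * D.omega z l * exp (I * D.hh z x t l)) t := by
  have h1 : HasDerivAt (fun t : ℝ => I * D.hh z x t l) (I * D.omega z l) t := by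
    simp only [hh_apply]
    refine ((((Complex.ofRealCLM.hasDerivAt (x := t)).const_mul (D.omega z l)).const_add
      (D.theta z l * x)).const_mul I).congr_deriv ?_
    simp
  refine h1.cexp.congr_deriv ?_
  ring

/-- The zero curvature equation for the modified eigenfunctions, whose Lax matrices differ from `X`
and `T` by multiples of the identity. -/
lemma zeroCurvature_shift (hu : D.IsSolution) (z : ℂ) (x t : ℝ) (a b : ℂ) :
    potMatrix (deriv (fun s => D.u x s) t)
        + (D.Xmat z x t - a • (1 : Mat3)) * (D.Tmat z x t - b • (1 : Mat3)) =
      laxTx D.α₁ D.α₂ (D.kk z) (D.u x t) (D.ux 1 x t) (D.ux 2 x t) (D.ux 3 x t)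
        + (D.Tmat z x t - b • (1 : Mat3)) * (D.Xmat z x t - a • (1 : Mat3)) := by
  have h := zeroCurvature hu z x t
  simp only [Matrix.sub_mul, Matrix.mul_sub, Matrix.smul_mul, Matrix.mul_smul, Matrix.one_mul,
    Matrix.mul_one, smul_sub]
  rw [smul_comm b a]
  rw [← sub_eq_zero] at h ⊢
  rw [← h]
  abel

lemma continuous_shiftedT (D : HirotaData) (k c : ℂ) :
    Continuous fun q : C2 × C2 × C2 =>
      laxT D.α₁ D.α₂ D.u0 k q.1 q.2.1 q.2.2 - c • (1 : Mat3) :=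
  (continuous_laxT D.α₁ D.α₂ D.u0 k).sub continuous_const

/-- The background eigenvectors are stationary under the modified `t`-equation in the limit, which
keeps the normalization of the modified eigenfunctions independent of time. -/
lemma eventually_norm_shiftedT_le (hu0 : D.uo ≠ 0) {F : Filter ℝ} {v : C2} (hv : ‖v‖ = D.u0)
    (h0 : TendstoLocallyUniformly D.u (fun _ => v) F)
    (h1 : TendstoLocallyUniformly (D.ux 1) (fun _ => 0) F)
    (h2 : TendstoLocallyUniformly (D.ux 2) (fun _ => 0) F) (hz : z ≠ 0) (l : Fin 3) (t₀ : ℝ)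
    {ε : ℝ} (hε : 0 < ε) :
    ∀ᶠ x in F, ∀ t ∈ Set.Icc (t₀ - 1) (t₀ + 1),
      ‖(D.Tmat z x t - (I * D.omega z l) • (1 : Mat3)) *ᵥ (eigMatrix v z)ᵀ l‖ ≤ ε := by
  refine eventually_le_of_limit (Φ := fun q => ‖(laxT D.α₁ D.α₂ D.u0 (D.kk z) q.1 q.2.1 q.2.2
    - (I * D.omega z l) • (1 : Mat3)) *ᵥ (eigMatrix v z)ᵀ l‖) h0 h1 h2
    ((continuous_shiftedT D _ _).matrix_mulVec continuous_const).norm ?_ _ _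
  simp only [Matrix.sub_mulVec, laxT_mulVec_eigMatrix hu0 hv hz, Matrix.smul_mulVec,
    Matrix.one_mulVec, sub_self, norm_zero]
  exact hε

lemma hasDerivAt_phiM_time (hu0 : D.uo ≠ 0) (hu : D.IsSolution) (h : ∀ t, D.AdmM 0 t z l)
    (x t : ℝ) :
    HasDerivAt (fun t => D.phiM z x t l)
      ((D.Tmat z x t - (I * D.omega z l) • (1 : Mat3)) *ᵥ D.phiM z x t l) t := by
  refine hasDerivAt_leftJost_time (Q := fun x t => potMatrix (D.u x t) - potMatrix D.um)
    (T := fun x t => D.Tmat z x t - (I * D.omega z l) • (1 : Mat3))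
    (Xt := fun x t => potMatrix (deriv (fun s => D.u x s) t))
    (Tx := fun x t => laxTx D.α₁ D.α₂ (D.kk z) (D.u x t) (D.ux 1 x t) (D.ux 2 x t) (D.ux 3 x t))
    (fun t => (h t).adm) (fun x t => ?_) (fun x t => ?_)
    ((continuous_Tmat hu z).sub continuous_const) (continuous_Tmat_deriv hu z) (fun x t => ?_)
    (fun t₀ => ?_) (fun t₀ ε hε => ?_) x t
  · simpa using (hasDerivAt_ut hu x t).potMatrix.sub (hasMatDerivAt_const _ t)
  · simpa using (hasMatDerivAt_Tmat hu z x t).sub (hasMatDerivAt_const _ x)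
  · simp only [jostGen_add_eq_Xmat hu0 norm_um (h t).ne_zero (h t).mu_ne_zero]
    exact zeroCurvature_shift hu z x t _ _
  · exact exists_bound_of_limit hu
      (continuous_entrySum.comp (continuous_shiftedT D (D.kk z) (I * D.omega z l))) _ _
  · exact eventually_norm_shiftedT_le hu0 norm_um hu.limit_left hu.limit_ux_left
      hu.limit_uxx_left (h 0).ne_zero l t₀ hε

lemma hasDerivAt_phiP_time (hu0 : D.uo ≠ 0) (hu : D.IsSolution) (h : ∀ t, D.AdmP 0 t z l)
    (x t : ℝ) :
    HasDerivAt (fun t => D.phiP z x t l)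
      ((D.Tmat z x t - (I * D.omega z l) • (1 : Mat3)) *ᵥ D.phiP z x t l) t := by
  refine hasDerivAt_rightJost_time (Q := fun x t => potMatrix (D.u x t) - potMatrix D.up)
    (T := fun x t => D.Tmat z x t - (I * D.omega z l) • (1 : Mat3))
    (Xt := fun x t => potMatrix (deriv (fun s => D.u x s) t))
    (Tx := fun x t => laxTx D.α₁ D.α₂ (D.kk z) (D.u x t) (D.ux 1 x t) (D.ux 2 x t) (D.ux 3 x t))
    (fun t => (h t).adm) (fun x t => ?_) (fun x t => ?_)
    ((continuous_Tmat hu z).sub continuous_const) (continuous_Tmat_deriv hu z) (fun x t => ?_)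
    (fun t₀ => ?_) (fun t₀ ε hε => ?_) x t
  · simpa using (hasDerivAt_ut hu x t).potMatrix.sub (hasMatDerivAt_const _ t)
  · simpa using (hasMatDerivAt_Tmat hu z x t).sub (hasMatDerivAt_const _ x)
  · simp only [jostGen_add_eq_Xmat hu0 norm_up (h t).ne_zero (h t).mu_ne_zero]
    exact zeroCurvature_shift hu z x t _ _
  · exact exists_bound_of_limit hu
      (continuous_entrySum.comp (continuous_shiftedT D (D.kk z) (I * D.omega z l))) _ _
  · exact eventually_norm_shiftedT_le hu0 norm_up hu.limit_right hu.limit_ux_right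
      hu.limit_uxx_right (h 0).ne_zero l t₀ hε

lemma hasDerivAt_smul_exp_time {f : ℝ → C3} {x : ℝ}
    (h : HasDerivAt f ((D.Tmat z x t - (I * D.omega z l) • (1 : Mat3)) *ᵥ f t) t) :
    HasDerivAt (fun t => exp (I * D.hh z x t l) • f t)
      (D.Tmat z x t *ᵥ (exp (I * D.hh z x t l) • f t)) t := by
  refine ((hasDerivAt_exp_hh_time z x t l).smul h).congr_deriv ?_
  rw [Matrix.mulVec_smul, Matrix.sub_mulVec, Matrix.smul_mulVec, Matrix.one_mulVec, smul_sub,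
    smul_smul, mul_comm (exp _)]
  abel

lemma hasDerivAt_jostM_time (hu0 : D.uo ≠ 0) (hu : D.IsSolution) (h : ∀ t, D.AdmM 0 t z l)
    (x t : ℝ) : HasDerivAt (fun t => D.jostM z x t l) (D.Tmat z x t *ᵥ D.jostM z x t l) t :=
  hasDerivAt_smul_exp_time (hasDerivAt_phiM_time hu0 hu h x t)

lemma hasDerivAt_jostP_time (hu0 : D.uo ≠ 0) (hu : D.IsSolution) (h : ∀ t, D.AdmP 0 t z l)
    (x t : ℝ) : HasDerivAt (fun t => D.jostP z x t l) (D.Tmat z x t *ᵥ D.jostP z x t l) t :=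
  hasDerivAt_smul_exp_time (hasDerivAt_phiP_time hu0 hu h x t)

lemma hasDerivAt_adjJostM_time (hu0 : D.uo ≠ 0) (hu : D.IsSolution)
    (h : ∀ t, D.AdmM 0 t (conj z) l) (x t : ℝ) :
    HasDerivAt (fun t => D.adjJostM z x t l) (-(D.Tmat z x t)ᵀ *ᵥ D.adjJostM z x t l) t := by
  simp only [fun t => (h t).adjJostM_eq]
  refine (hasDerivAt_jostM_time hu0 hu h x t).star.congr_deriv ?_
  rw [← map_conj_mulVec_star, Tmat_conj]

lemma hasDerivAt_adjJostP_time (hu0 : D.uo ≠ 0) (hu : D.IsSolution)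
    (h : ∀ t, D.AdmP 0 t (conj z) l) (x t : ℝ) :
    HasDerivAt (fun t => D.adjJostP z x t l) (-(D.Tmat z x t)ᵀ *ᵥ D.adjJostP z x t l) t := by
  simp only [fun t => (h t).adjJostP_eq]
  refine (hasDerivAt_jostP_time hu0 hu h x t).star.congr_deriv ?_
  rw [← map_conj_mulVec_star, Tmat_conj]

/-! ### Constancy of the pairings -/

lemma eq_of_hasDerivAt_zero {f : ℝ → ℂ} (h : ∀ x, HasDerivAt f 0 x) (x y : ℝ) : f x = f y :=
  is_const_of_deriv_eq_zero (fun x => (h x).differentiableAt) (fun x => (h x).deriv) x y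

variable {κ' : ℝ} {j : Fin 3}

lemma pairing_PM_const_space (hu0 : D.uo ≠ 0) (hj : D.AdmP κ t (conj z) j)
    (hl : D.AdmM κ' t z l) (x y : ℝ) :
    D.adjJostP z x t j ⬝ᵥ D.jostM z x t l = D.adjJostP z y t j ⬝ᵥ D.jostM z y t l :=
  eq_of_hasDerivAt_zero (f := fun x => D.adjJostP z x t j ⬝ᵥ D.jostM z x t l) (fun x =>
    hasDerivAt_pairing_zero (hj.hasDerivAt_adjJostP hu0 x) (hl.hasDerivAt_jostM hu0 x)) x y

lemma pairing_MP_const_space (hu0 : D.uo ≠ 0) (hj : D.AdmM κ t (conj z) j)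
    (hl : D.AdmP κ' t z l) (x y : ℝ) :
    D.adjJostM z x t j ⬝ᵥ D.jostP z x t l = D.adjJostM z y t j ⬝ᵥ D.jostP z y t l :=
  eq_of_hasDerivAt_zero (f := fun x => D.adjJostM z x t j ⬝ᵥ D.jostP z x t l) (fun x =>
    hasDerivAt_pairing_zero (hj.hasDerivAt_adjJostM hu0 x) (hl.hasDerivAt_jostP hu0 x)) x y

/-- At time `0`, the scattering coefficients are the constant pairings. -/
lemma pairing_PM_zero (hu0 : D.uo ≠ 0) (hj : D.AdmP κ 0 (conj z) j)
    (hl : D.AdmM κ' 0 z l) (x : ℝ) :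
    D.adjJostP z x 0 j ⬝ᵥ D.jostM z x 0 l = D.dd z j * D.s j l z := by
  rw [pairing_PM_const_space hu0 hj hl x 0, s,
    mul_div_cancel₀ _ (dd_ne_zero hl.mu_ne_zero j)]

lemma pairing_MP_zero (hu0 : D.uo ≠ 0) (hj : D.AdmM κ 0 (conj z) j)
    (hl : D.AdmP κ' 0 z l) (x : ℝ) :
    D.adjJostM z x 0 j ⬝ᵥ D.jostP z x 0 l = D.dd z j * D.b j l z := by
  rw [pairing_MP_const_space hu0 hj hl x 0, b,
    mul_div_cancel₀ _ (dd_ne_zero hl.mu_ne_zero j)]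

/-- The scattering coefficients do not depend on time. -/
lemma pairing_PM (hu0 : D.uo ≠ 0) (hu : D.IsSolution) (hj : ∀ t, D.AdmP 0 t (conj z) j)
    (hl : ∀ t, D.AdmM 0 t z l) (x t : ℝ) :
    D.adjJostP z x t j ⬝ᵥ D.jostM z x t l = D.dd z j * D.s j l z := by
  rw [← pairing_PM_zero hu0 (hj 0) (hl 0) x]
  exact eq_of_hasDerivAt_zero (f := fun t => D.adjJostP z x t j ⬝ᵥ D.jostM z x t l) (fun t =>
    hasDerivAt_pairing_zero (hasDerivAt_adjJostP_time hu0 hu hj x t)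
      (hasDerivAt_jostM_time hu0 hu hl x t)) t 0

lemma pairing_MP (hu0 : D.uo ≠ 0) (hu : D.IsSolution) (hj : ∀ t, D.AdmM 0 t (conj z) j)
    (hl : ∀ t, D.AdmP 0 t z l) (x t : ℝ) :
    D.adjJostM z x t j ⬝ᵥ D.jostP z x t l = D.dd z j * D.b j l z := by
  rw [← pairing_MP_zero hu0 (hj 0) (hl 0) x]
  exact eq_of_hasDerivAt_zero (f := fun t => D.adjJostM z x t j ⬝ᵥ D.jostP z x t l) (fun t =>
    hasDerivAt_pairing_zero (hasDerivAt_adjJostM_time hu0 hu hj x t)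
      (hasDerivAt_jostP_time hu0 hu hl x t)) t 0

/-- The pairing of adjoint eigenfunctions and eigenfunctions normalized at `-∞`. -/
lemma pairing_MM (hu0 : D.uo ≠ 0) (hj : D.AdmM κ t (conj z) j) (hl : D.AdmM κ t z l) (x : ℝ) :
    D.adjJostM z x t j ⬝ᵥ D.jostM z x t l = if j = l then D.dd z j else 0 := by
  rw [← (hj.jostAt hu0).pairing hu0 norm_um hl.ne_zero hl.adm.rate_nonneg (hl.jostAt hu0) ?_ x,
    adjJostM, jostM, hj.adjM_eq, smul_dotProduct, dotProduct_smul, smul_eq_mul, smul_eq_mul,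
    ← mul_assoc, ← Complex.exp_add]
  · ring_nf
  · filter_upwards [eventually_le_atBot 0] with x hx
    have h1 := hj.adm.rate l
    rw [theta_conj, theta_conj, ← map_sub, Complex.conj_im] at h1
    rw [abs_of_nonpos hx]
    nlinarith

/-- The pairing of adjoint eigenfunctions and eigenfunctions normalized at `+∞`. -/
lemma pairing_PP (hu0 : D.uo ≠ 0) (hj : D.AdmP κ t (conj z) j) (hl : D.AdmP κ t z l) (x : ℝ) :
    D.adjJostP z x t j ⬝ᵥ D.jostP z x t l = if j = l then D.dd z j else 0 := by
  rw [← (hj.jostAt hu0).pairing hu0 norm_up hl.ne_zero hl.adm.rate_nonneg (hl.jostAt hu0) ?_ x,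
    adjJostP, jostP, hj.adjP_eq, smul_dotProduct, dotProduct_smul, smul_eq_mul, smul_eq_mul,
    ← mul_assoc, ← Complex.exp_add]
  · ring_nf
  · filter_upwards [eventually_ge_atTop 0] with x hx
    have h1 := hj.adm.rate l
    simp only [Pi.neg_apply, theta_conj, Complex.sub_im, Complex.neg_im, Complex.conj_im] at h1
    rw [abs_of_nonneg hx, Complex.sub_im]
    nlinarith

end HirotaData

namespace HirotaData

variable {D : HirotaData} {κ κ' t : ℝ} {z : ℂ} {j l : Fin 3}

/-! ### Symmetries of the eigenfunctions and of the scattering coefficients -/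

lemma AdmM.zhat (hu0 : D.uo ≠ 0) (h : D.AdmM κ t z (swapIdx l)) : D.AdmM κ t (D.zhat z) l where
  ne_zero := zhat_ne_zero hu0 h.ne_zero
  mu_ne_zero := mu_zhat_ne_zero hu0 h.ne_zero h.mu_ne_zero
  adm :=
    { det := by
        rw [det_eigMatrix_eq hu0 norm_um (zhat_ne_zero hu0 h.ne_zero)]
        exact (mu_zhat_ne_zero hu0 h.ne_zero h.mu_ne_zero).isUnit
      rate_nonneg := h.adm.rate_nonneg
      rate := fun j => by
        rw [theta_zhat hu0 h.ne_zero, theta_zhat hu0 h.ne_zero]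
        exact h.adm.rate _
      cont := h.adm.cont
      integ := h.adm.integ }

lemma AdmP.zhat (hu0 : D.uo ≠ 0) (h : D.AdmP κ t z (swapIdx l)) : D.AdmP κ t (D.zhat z) l where
  ne_zero := zhat_ne_zero hu0 h.ne_zero
  mu_ne_zero := mu_zhat_ne_zero hu0 h.ne_zero h.mu_ne_zero
  adm :=
    { det := by
        rw [det_eigMatrix_eq hu0 norm_up (zhat_ne_zero hu0 h.ne_zero)]
        exact (mu_zhat_ne_zero hu0 h.ne_zero h.mu_ne_zero).isUnit
      rate_nonneg := h.adm.rate_nonneg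
      rate := fun j => by
        rw [Pi.neg_apply, Pi.neg_apply, theta_zhat hu0 h.ne_zero, theta_zhat hu0 h.ne_zero]
        exact h.adm.rate _
      cont := h.adm.cont
      integ := h.adm.integ }

lemma AdmM.phiM_zhat (hu0 : D.uo ≠ 0) (h : D.AdmM κ t z (swapIdx l)) (x : ℝ) :
    D.phiM (D.zhat z) x t l = D.hatFactor z l • D.phiM z x t (swapIdx l) :=
  (congrFun ((h.zhat hu0).eq_phiM hu0 ((h.jostAt hu0).hat hu0 norm_um h.ne_zero)) x).symm

lemma AdmP.phiP_zhat (hu0 : D.uo ≠ 0) (h : D.AdmP κ t z (swapIdx l)) (x : ℝ) :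
    D.phiP (D.zhat z) x t l = D.hatFactor z l • D.phiP z x t (swapIdx l) :=
  (congrFun ((h.zhat hu0).eq_phiP hu0 ((h.jostAt hu0).hat hu0 norm_up h.ne_zero)) x).symm

lemma hh_zero (z : ℂ) (l : Fin 3) : D.hh z 0 0 l = 0 := by simp [hh_apply]

lemma dd_zhat (hu0 : D.uo ≠ 0) (hz : z ≠ 0) (j : Fin 3) :
    conj (D.hatFactor (conj z) j) * D.dd z (swapIdx j) * D.hatFactor z j = D.dd (D.zhat z) j := by
  have hn := u0_ne hu0
  fin_cases j
  all_goals
    simp [hatFactor, dd, swapIdx, mu_zhat hu0 hz]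
  all_goals
    field_simp
    simp

/-- The symmetry `z ↦ ẑ` of the scattering coefficients. -/
lemma s_zhat (hu0 : D.uo ≠ 0) (hj : D.AdmP κ 0 (conj z) (swapIdx j))
    (hl : D.AdmM κ' 0 z (swapIdx l)) :
    D.s j l (D.zhat z) =
      D.hatFactor z l / D.hatFactor z j * D.s (swapIdx j) (swapIdx l) z := by
  have hj' : D.AdmP κ 0 (conj (D.zhat z)) j := by
    rw [← zhat_conj]
    exact hj.zhat hu0
  have h1 : D.adjJostP (D.zhat z) 0 0 j =
      conj (D.hatFactor (conj z) j) • D.adjJostP z 0 0 (swapIdx j) := by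
    rw [adjJostP, adjJostP, hj'.adjP_eq, hj.adjP_eq, ← zhat_conj, hj.phiP_zhat hu0, star_smul,
      hh_zero, hh_zero]
    simp
  have h2 : D.jostM (D.zhat z) 0 0 l = D.hatFactor z l • D.jostM z 0 0 (swapIdx l) := by
    rw [jostM, jostM, hl.phiM_zhat hu0, hh_zero, hh_zero]
    simp
  have h3 := dd_zhat hu0 hl.ne_zero j
  have h4 := dd_ne_zero hl.mu_ne_zero (swapIdx j)
  have h5 := hatFactor_ne_zero hu0 hl.ne_zero j
  have h6 := dd_ne_zero (mu_zhat_ne_zero hu0 hl.ne_zero hl.mu_ne_zero) j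
  rw [s, s, h1, h2, smul_dotProduct, dotProduct_smul, smul_eq_mul, smul_eq_mul]
  rw [← h3] at h6 ⊢
  have h7 : conj (D.hatFactor (conj z) j) ≠ 0 := left_ne_zero_of_mul (left_ne_zero_of_mul h6)
  field_simp

/-- The symmetry `z ↦ z^*` of the scattering coefficients. -/
lemma conj_s_conj (hj : D.AdmP κ 0 z j) (hl : D.AdmM κ' 0 (conj z) l) :
    conj (D.s j l (conj z)) = D.b l j z * D.dd z l / D.dd z j := by
  have hj' : D.AdmP κ 0 (conj (conj z)) j := by rwa [Complex.conj_conj]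
  have h := dd_ne_zero hj.mu_ne_zero l
  rw [s, b, hl.adjJostM_eq, hj'.adjJostP_eq, Complex.conj_conj, dd_conj, map_div₀,
    Complex.conj_conj, div_mul_cancel₀ _ h, ← Complex.star_def, ← Matrix.star_dotProduct_star,
    star_star]

lemma hat_apply (f : ℂ → ℂ) (z : ℂ) : D.hat f z = f (D.zhat z) := rfl

lemma smile_apply (f : ℂ → ℂ) (z : ℂ) : D.smile f z = conj (D.hat f (conj z)) := rfl

lemma hat_beta1 (hu0 : D.uo ≠ 0) (h1 : D.AdmP κ 0 (conj z) 1) (h2 : D.AdmP κ 0 (conj z) 2)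
    (hm : D.AdmM κ 0 z 2) :
    D.hat D.beta1 z = z / (I * D.u0) * (D.s 1 2 z / D.s 2 2 z) := by
  have h := hatFactor_ne_zero hu0 hm.ne_zero 0
  rw [hat_apply, beta1, s_zhat (j := 1) (l := 0) hu0 h1 hm, s_zhat (j := 0) (l := 0) hu0 h2 hm,
    div_self h]
  simp [hatFactor, swapIdx]
  ring

lemma hat_beta2 (hu0 : D.uo ≠ 0) (h0 : D.AdmP κ 0 (conj z) 0) (h2 : D.AdmP κ 0 (conj z) 2)
    (hm : D.AdmM κ 0 z 2) :
    D.hat D.beta2 z = D.s 0 2 z / D.s 2 2 z := by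
  have h := hatFactor_ne_zero hu0 hm.ne_zero 0
  rw [hat_apply, beta2, s_zhat (j := 2) (l := 0) hu0 h0 hm, s_zhat (j := 0) (l := 0) hu0 h2 hm,
    div_self h, show D.hatFactor z 2 = D.hatFactor z 0 from rfl, div_self h]
  simp [swapIdx]

lemma hat_beta3 (hu0 : D.uo ≠ 0) (h0 : D.AdmP κ 0 (conj z) 0) (h1 : D.AdmP κ 0 (conj z) 1)
    (hm : D.AdmM κ 0 z 1) :
    D.hat D.beta3 z = I * D.u0 / z * (D.s 0 1 z / D.s 1 1 z) := by
  rw [hat_apply, beta3, s_zhat (j := 2) (l := 1) hu0 h0 hm, s_zhat (j := 1) (l := 1) hu0 h1 hm]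
  simp [hatFactor, swapIdx]
  ring

lemma frown_beta2 (h0 : D.AdmP κ 0 z 0) (h2 : D.AdmP κ 0 z 2) (hm : D.AdmM κ 0 (conj z) 0) :
    frown D.beta2 z = D.b 0 2 z / D.b 0 0 z := by
  have h := h0.mu_ne_zero
  rw [frown, beta2, map_div₀, conj_s_conj h2 hm, conj_s_conj h0 hm]
  simp [dd, h]

lemma frown_beta3 (h1 : D.AdmP κ 0 z 1) (h2 : D.AdmP κ 0 z 2) (hm : D.AdmM κ 0 (conj z) 1) :
    frown D.beta3 z = D.b 1 2 z / (D.mu z * D.b 1 1 z) := by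
  have h := h1.mu_ne_zero
  rw [frown, beta3, map_div₀, conj_s_conj h2 hm, conj_s_conj h1 hm]
  simp [dd]
  field_simp

lemma smile_beta2 (hu0 : D.uo ≠ 0) (h0 : D.AdmP κ 0 z 0) (h2 : D.AdmP κ 0 z 2)
    (hm : D.AdmM κ 0 (conj z) 2) :
    D.smile D.beta2 z = D.b 2 0 z / D.b 2 2 z := by
  have h := h0.mu_ne_zero
  rw [smile_apply, hat_beta2 hu0 (by rwa [Complex.conj_conj]) (by rwa [Complex.conj_conj]) hm,
    map_div₀, conj_s_conj h2 hm, conj_s_conj h0 hm]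
  simp [dd, h]

lemma smile_beta3 (hu0 : D.uo ≠ 0) (h0 : D.AdmP κ 0 z 0) (h1 : D.AdmP κ 0 z 1)
    (hm : D.AdmM κ 0 (conj z) 1) :
    D.smile D.beta3 z = -(I * D.u0 / (z * D.mu z)) * (D.b 1 0 z / D.b 1 1 z) := by
  have h := h0.mu_ne_zero
  rw [smile_apply, hat_beta3 hu0 (by rwa [Complex.conj_conj]) (by rwa [Complex.conj_conj]) hm,
    map_mul, map_div₀ _ (D.s 0 1 _), conj_s_conj h0 hm, conj_s_conj h1 hm]
  simp [dd]
  field_simp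

/-! ### Vector products of adjoint eigenfunctions -/

/-- The exponents `h₁`, `h₂`, `-h₁` sum to `h₂`, so that the factor `e^{ih₂}` turns the exponentials
of two adjoint eigenfunctions into that of the third eigenfunction. -/
lemma exp_hh_cyclic (z : ℂ) (x t : ℝ) (c : Fin 3) :
    exp (I * D.h2 z x t) * (exp (-I * D.hh z x t (c + 1)) * exp (-I * D.hh z x t (c + 2))) =
      exp (I * D.hh z x t c) := by
  have h : D.hh z x t c + D.hh z x t (c + 1) + D.hh z x t (c + 2) = D.h2 z x t := by
    rw [← hh_sum]
    fin_cases c <;> simp <;> ring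
  rw [← Complex.exp_add, ← Complex.exp_add, ← h]
  ring_nf

lemma cross_adjJostM (hu0 : D.uo ≠ 0) {c : Fin 3} (h1 : D.AdmM κ t (conj z) (c + 1))
    (h2 : D.AdmM κ t (conj z) (c + 2)) (hc : D.AdmM κ t z c) (x : ℝ) :
    exp (I * D.h2 z x t) • crossProduct (D.adjJostM z x t (c + 1)) (D.adjJostM z x t (c + 2)) =
      D.crossFactor z c • D.jostM z x t c := by
  have h := congrFun (hc.eq_phiM hu0 (JostAt.cross hu0 norm_um hc.ne_zero hc.mu_ne_zero
    hc.adm.rate_nonneg (h1.jostAt hu0) (h2.jostAt hu0))) x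
  rw [adjJostM, adjJostM, h1.adjM_eq, h2.adjM_eq, jostM, ← h, map_smul, map_smul,
    LinearMap.smul_apply, smul_smul, smul_smul, smul_smul, smul_smul, ← exp_hh_cyclic, mul_assoc,
    mul_comm (exp (-I * D.hh z x t (c + 2))), mul_comm (D.crossFactor z c),
    mul_inv_cancel_right₀ (crossFactor_ne_zero hc.mu_ne_zero c)]

lemma cross_adjJostP (hu0 : D.uo ≠ 0) {c : Fin 3} (h1 : D.AdmP κ t (conj z) (c + 1))
    (h2 : D.AdmP κ t (conj z) (c + 2)) (hc : D.AdmP κ t z c) (x : ℝ) :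
    exp (I * D.h2 z x t) • crossProduct (D.adjJostP z x t (c + 1)) (D.adjJostP z x t (c + 2)) =
      D.crossFactor z c • D.jostP z x t c := by
  have h := congrFun (hc.eq_phiP hu0 (JostAt.cross hu0 norm_up hc.ne_zero hc.mu_ne_zero
    hc.adm.rate_nonneg (h1.jostAt hu0) (h2.jostAt hu0))) x
  rw [adjJostP, adjJostP, h1.adjP_eq, h2.adjP_eq, jostP, ← h, map_smul, map_smul,
    LinearMap.smul_apply, smul_smul, smul_smul, smul_smul, smul_smul, ← exp_hh_cyclic, mul_assoc,
    mul_comm (exp (-I * D.hh z x t (c + 2))), mul_comm (D.crossFactor z c),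
    mul_inv_cancel_right₀ (crossFactor_ne_zero hc.mu_ne_zero c)]

/-! ### Domains of existence -/

/-- The points at which the `l`-th Jost eigenfunction normalized at `-∞` exists. -/
def domM (D : HirotaData) (l : Fin 3) : Set ℂ :=
  {z | z ≠ 0 ∧ D.mu z ≠ 0 ∧ ∀ j, 0 ≤ (D.theta z j - D.theta z l).im}

/-- The points at which the `l`-th Jost eigenfunction normalized at `+∞` exists. -/
def domP (D : HirotaData) (l : Fin 3) : Set ℂ :=
  {z | z ≠ 0 ∧ D.mu z ≠ 0 ∧ ∀ j, 0 ≤ (D.theta z l - D.theta z j).im}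

lemma admM_of_mem (hu0 : D.uo ≠ 0) (hu : D.IsSolution) (h : z ∈ D.domM l) (t : ℝ) :
    D.AdmM 0 t z l :=
  admM_of_rate hu0 hu le_rfl (fun a => by simpa using hu.integrable_left t a) h.1 h.2.1
    (by simpa using h.2.2)

lemma admP_of_mem (hu0 : D.uo ≠ 0) (hu : D.IsSolution) (h : z ∈ D.domP l) (t : ℝ) :
    D.AdmP 0 t z l :=
  admP_of_rate hu0 hu le_rfl (fun a => by simpa using hu.integrable_right t a) h.1 h.2.1
    (by simpa using h.2.2)

lemma conj_mem_domM : conj z ∈ D.domM l ↔ z ∈ D.domP l := by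
  simp [domM, domP, theta_conj, mu_conj]

lemma conj_mem_domP : conj z ∈ D.domP l ↔ z ∈ D.domM l := by
  simp [domM, domP, theta_conj, mu_conj]

lemma lam_im (z : ℂ) : (D.lam z).im = z.im * (1 - D.u0 ^ 2 / ‖z‖ ^ 2) / 2 := by
  rw [lam, ← Complex.normSq_eq_norm_sq]
  simp [Complex.div_im, Complex.add_im, sq]
  ring

lemma kk_im (z : ℂ) : (D.kk z).im = z.im * (1 + D.u0 ^ 2 / ‖z‖ ^ 2) / 2 := by
  rw [kk, ← Complex.normSq_eq_norm_sq]
  simp [Complex.div_im, Complex.sub_im, sq]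
  ring

/-- The signs of the differences of the exponents are decided by those of `Im z`, `Im λ`. -/
lemma theta_im (z : ℂ) : ∃ c : ℝ, 0 ≤ c ∧ (∀ j, (D.theta z j).im =
    ![-(D.lam z).im, (D.lam z).im + c * z.im, (D.lam z).im] j) ∧
    (D.lam z).im + (D.lam z).im + c * z.im = z.im := by
  refine ⟨D.u0 ^ 2 / ‖z‖ ^ 2, by positivity, fun j => ?_, ?_⟩
  · fin_cases j <;> simp [theta]
    rw [lam_im, kk_im]
    ring
  · rw [lam_im]
    ring

lemma mem_domM_zero (hz : z ≠ 0) (hmu : D.mu z ≠ 0) (h : 0 ≤ z.im) (h' : 0 ≤ (D.lam z).im) :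
    z ∈ D.domM 0 := by
  obtain ⟨c, hc, hθ, hs⟩ := D.theta_im z
  have := mul_nonneg hc h
  refine ⟨hz, hmu, fun j => ?_⟩
  rw [Complex.sub_im, hθ j, hθ 0]
  fin_cases j <;> simp <;> linarith

lemma mem_domM_one (hz : z ≠ 0) (hmu : D.mu z ≠ 0) (h : z.im ≤ 0) : z ∈ D.domM 1 := by
  obtain ⟨c, hc, hθ, hs⟩ := D.theta_im z
  have := mul_nonneg hc (neg_nonneg.2 h)
  have h2 := hs
  refine ⟨hz, hmu, fun j => ?_⟩
  rw [Complex.sub_im, hθ j, hθ 1]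
  fin_cases j <;> simp <;> linarith

lemma mem_domM_two (hz : z ≠ 0) (hmu : D.mu z ≠ 0) (h : 0 ≤ z.im) (h' : (D.lam z).im ≤ 0) :
    z ∈ D.domM 2 := by
  obtain ⟨c, hc, hθ, hs⟩ := D.theta_im z
  have := mul_nonneg hc h
  refine ⟨hz, hmu, fun j => ?_⟩
  rw [Complex.sub_im, hθ j, hθ 2]
  fin_cases j <;> simp <;> linarith

lemma lam_conj (z : ℂ) : D.lam (conj z) = conj (D.lam z) := by simp [lam, map_ofNat]

lemma mem_domP_zero (hz : z ≠ 0) (hmu : D.mu z ≠ 0) (h : z.im ≤ 0) (h' : (D.lam z).im ≤ 0) :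
    z ∈ D.domP 0 :=
  conj_mem_domM.1 (mem_domM_zero (by simpa using hz) (mu_conj_ne_zero hmu) (by simpa using h)
    (by simpa [lam_conj] using h'))

lemma mem_domP_one (hz : z ≠ 0) (hmu : D.mu z ≠ 0) (h : 0 ≤ z.im) : z ∈ D.domP 1 :=
  conj_mem_domM.1 (mem_domM_one (by simpa using hz) (mu_conj_ne_zero hmu) (by simpa using h))

lemma mem_domP_two (hz : z ≠ 0) (hmu : D.mu z ≠ 0) (h : z.im ≤ 0) (h' : 0 ≤ (D.lam z).im) :
    z ∈ D.domP 2 :=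
  conj_mem_domM.1 (mem_domM_two (by simpa using hz) (mu_conj_ne_zero hmu) (by simpa using h)
    (by simpa [lam_conj] using h'))

lemma lam_im_of_norm_eq (hu0 : D.uo ≠ 0) (h : ‖z‖ = D.u0) : (D.lam z).im = 0 := by
  have := u0_pos hu0
  rw [lam_im, h, div_self (by positivity), sub_self, mul_zero, zero_div]

lemma norm_pos_of_norm_eq (hu0 : D.uo ≠ 0) (h : ‖z‖ = D.u0) : z ≠ 0 := by
  rw [← norm_pos_iff, h]
  exact u0_pos hu0

lemma theta_im_of_norm_eq (hu0 : D.uo ≠ 0) (h : ‖z‖ = D.u0) (i j : Fin 3) :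
    -D.u0 ≤ (D.theta z i - D.theta z j).im := by
  obtain ⟨c, hc, hθ, hs⟩ := D.theta_im z
  have h0 := lam_im_of_norm_eq hu0 h
  have h1 := hs
  rw [h0, zero_add, zero_add] at h1
  have h2 := abs_le.1 (Complex.abs_im_le_norm z)
  rw [h] at h2
  have := u0_pos hu0
  rw [Complex.sub_im, hθ i, hθ j, h0, h1]
  fin_cases i <;> fin_cases j <;> simp <;> linarith

/-- Under exponential decay, all eigenfunctions exist on the circle. -/
lemma ExpDecay.admM (he : D.ExpDecay) (hu0 : D.uo ≠ 0) (hu : D.IsSolution) (h : ‖z‖ = D.u0)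
    (hmu : D.mu z ≠ 0) (l : Fin 3) : D.AdmM D.u0 0 z l :=
  admM_of_rate hu0 hu (u0_pos hu0).le he.left (norm_pos_of_norm_eq hu0 h) hmu
    fun j => theta_im_of_norm_eq hu0 h j l

lemma ExpDecay.admP (he : D.ExpDecay) (hu0 : D.uo ≠ 0) (hu : D.IsSolution) (h : ‖z‖ = D.u0)
    (hmu : D.mu z ≠ 0) (l : Fin 3) : D.AdmP D.u0 0 z l :=
  admP_of_rate hu0 hu (u0_pos hu0).le he.right (norm_pos_of_norm_eq hu0 h) hmu
    fun j => theta_im_of_norm_eq hu0 h l j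

lemma mem_domM_of_im_eq_zero (hz : z ≠ 0) (hmu : D.mu z ≠ 0) (h : z.im = 0) (l : Fin 3) :
    z ∈ D.domM l := by
  have hl : (D.lam z).im = 0 := by rw [lam_im, h, zero_mul, zero_div]
  fin_cases l
  · exact mem_domM_zero hz hmu h.ge hl.ge
  · exact mem_domM_one hz hmu h.le
  · exact mem_domM_two hz hmu h.ge hl.le

lemma mem_domP_of_im_eq_zero (hz : z ≠ 0) (hmu : D.mu z ≠ 0) (h : z.im = 0) (l : Fin 3) :
    z ∈ D.domP l :=
  conj_mem_domM.1 (mem_domM_of_im_eq_zero (by simpa using hz) (mu_conj_ne_zero hmu)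
    (by simpa using h) l)

lemma mu_ne_zero_of_im_eq_zero (hz : z ≠ 0) (h : z.im = 0) : D.mu z ≠ 0 := by
  obtain ⟨x, rfl⟩ : ∃ x : ℝ, z = x := ⟨z.re, by apply Complex.ext <;> simp [h]⟩
  have hx : x ≠ 0 := by simpa using hz
  have h1 : D.mu x = ((1 + D.u0 ^ 2 / x ^ 2 : ℝ) : ℂ) := by
    rw [mu]
    push_cast
    ring
  rw [h1, Complex.ofReal_ne_zero]
  positivity

end HirotaData

/-! ### Dual bases and vector products in `ℂ³` -/

/-- The expansion of a vector in a basis with respect to which a dual system is known. -/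
lemma eq_sum_of_dual {p q : Fin 3 → C3} {d : Fin 3 → ℂ} (hd : ∀ j, d j ≠ 0)
    (h : ∀ j l, q j ⬝ᵥ p l = if j = l then d j else 0) (v : C3) :
    v = ∑ j, (q j ⬝ᵥ v / d j) • p j := by
  set A : Mat3 := Matrix.of fun j => (d j)⁻¹ • q j with hA
  set C : Mat3 := (Matrix.of p)ᵀ with hC
  have h1 : A * C = 1 := by
    ext j l
    have : (A * C) j l = ((d j)⁻¹ • q j) ⬝ᵥ p l := rfl
    rw [this, smul_dotProduct, h, Matrix.one_apply]
    split_ifs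
    · simp [hd]
    · simp
  have h2 : C * A = 1 := mul_eq_one_comm.1 h1
  have h3 : C *ᵥ (A *ᵥ v) = v := by rw [Matrix.mulVec_mulVec, h2, Matrix.one_mulVec]
  have h4 : ∀ j, (A *ᵥ v) j = q j ⬝ᵥ v / d j := fun j => by
    have : (A *ᵥ v) j = ((d j)⁻¹ • q j) ⬝ᵥ v := rfl
    rw [this, smul_dotProduct, smul_eq_mul, div_eq_inv_mul]
  nth_rw 1 [← h3]
  ext i
  simp only [Matrix.mulVec, dotProduct, Finset.sum_apply, Pi.smul_apply, smul_eq_mul] at h4 ⊢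
  simp only [h4]
  exact Finset.sum_congr rfl fun j _ => mul_comm _ _

/-- Expansion of a vector in the vector products of three vectors. -/
lemma triple_smul_eq (e : ℂ) (a b c v : C3) :
    (a ⬝ᵥ (e • crossProduct b c)) • v = (a ⬝ᵥ v) • (e • crossProduct b c)
      + (b ⬝ᵥ v) • (e • crossProduct c a) + (c ⬝ᵥ v) • (e • crossProduct a b) := by
  ext i
  fin_cases i <;> simp [cross_apply, dotProduct, Fin.sum_univ_three] <;> ring

lemma dotProduct_cross_rotate (a b c : C3) :
    a ⬝ᵥ crossProduct b c = b ⬝ᵥ crossProduct c a := by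
  simp [cross_apply, dotProduct, Fin.sum_univ_three]
  ring

lemma cols_mul (a b c : C3) (A : Mat3) :
    cols a b c * A = cols (A 0 0 • a + A 1 0 • b + A 2 0 • c) (A 0 1 • a + A 1 1 • b + A 2 1 • c)
      (A 0 2 • a + A 1 2 • b + A 2 2 • c) := by
  ext i j
  fin_cases j <;> simp [cols, Matrix.mul_apply, Fin.sum_univ_three, mul_comm]

namespace HirotaData

variable {D : HirotaData} {κ κ' t x : ℝ} {z : ℂ} {j l : Fin 3}

/-! ### The scattering relations -/

/-- The `l`-th eigenfunction normalized at `-∞` exists at `z` and at time `t`, and it satisfies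
the `t`-equation of the Lax pair unless `t = 0`. -/
def FlowM (D : HirotaData) (κ t : ℝ) (z : ℂ) (l : Fin 3) : Prop :=
  D.AdmM κ t z l ∧ (t = 0 ∨ ∀ t, D.AdmM 0 t z l)

/-- The same for the normalization at `+∞`. -/
def FlowP (D : HirotaData) (κ t : ℝ) (z : ℂ) (l : Fin 3) : Prop :=
  D.AdmP κ t z l ∧ (t = 0 ∨ ∀ t, D.AdmP 0 t z l)

lemma flowM_of_mem (hu0 : D.uo ≠ 0) (hu : D.IsSolution) (h : z ∈ D.domM l) (t : ℝ) :
    D.FlowM 0 t z l :=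
  ⟨admM_of_mem hu0 hu h t, Or.inr (admM_of_mem hu0 hu h)⟩

lemma flowP_of_mem (hu0 : D.uo ≠ 0) (hu : D.IsSolution) (h : z ∈ D.domP l) (t : ℝ) :
    D.FlowP 0 t z l :=
  ⟨admP_of_mem hu0 hu h t, Or.inr (admP_of_mem hu0 hu h)⟩

lemma FlowP.pairing (hu0 : D.uo ≠ 0) (hu : D.IsSolution) (hj : D.FlowP κ t (conj z) j)
    (hl : D.FlowM κ' t z l) (x : ℝ) :
    D.adjJostP z x t j ⬝ᵥ D.jostM z x t l = D.dd z j * D.s j l z := by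
  rcases hj.2 with rfl | hj'
  · exact pairing_PM_zero hu0 hj.1 hl.1 x
  rcases hl.2 with rfl | hl'
  · exact pairing_PM_zero hu0 hj.1 hl.1 x
  · exact pairing_PM hu0 hu hj' hl' x t

lemma FlowM.pairing (hu0 : D.uo ≠ 0) (hu : D.IsSolution) (hj : D.FlowM κ t (conj z) j)
    (hl : D.FlowP κ' t z l) (x : ℝ) :
    D.adjJostM z x t j ⬝ᵥ D.jostP z x t l = D.dd z j * D.b j l z := by
  rcases hj.2 with rfl | hj'
  · exact pairing_MP_zero hu0 hj.1 hl.1 x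
  rcases hl.2 with rfl | hl'
  · exact pairing_MP_zero hu0 hj.1 hl.1 x
  · exact pairing_MP hu0 hu hj' hl' x t

/-- All eigenfunctions and all adjoint eigenfunctions exist at `z` and at time `t`. -/
structure Full (D : HirotaData) (κ t : ℝ) (z : ℂ) : Prop where
  m : ∀ l, D.FlowM κ t z l
  p : ∀ l, D.FlowP κ t z l
  cm : ∀ l, D.FlowM κ t (conj z) l
  cp : ∀ l, D.FlowP κ t (conj z) l

lemma full_of_im_eq_zero (hu0 : D.uo ≠ 0) (hu : D.IsSolution) (hz : z ≠ 0) (h : z.im = 0)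
    (t : ℝ) : D.Full 0 t z := by
  have hmu := mu_ne_zero_of_im_eq_zero (D := D) hz h
  have hm := mem_domM_of_im_eq_zero hz hmu h
  have hp := mem_domP_of_im_eq_zero hz hmu h
  exact ⟨fun l => flowM_of_mem hu0 hu (hm l) t, fun l => flowP_of_mem hu0 hu (hp l) t,
    fun l => flowM_of_mem hu0 hu (conj_mem_domM.2 (hp l)) t,
    fun l => flowP_of_mem hu0 hu (conj_mem_domP.2 (hm l)) t⟩

lemma ExpDecay.full (he : D.ExpDecay) (hu0 : D.uo ≠ 0) (hu : D.IsSolution) (h : ‖z‖ = D.u0)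
    (hmu : D.mu z ≠ 0) : D.Full D.u0 0 z := by
  have h' : ‖conj z‖ = D.u0 := by rwa [Complex.norm_conj]
  have hmu' := mu_conj_ne_zero hmu
  exact ⟨fun l => ⟨he.admM hu0 hu h hmu l, Or.inl rfl⟩,
    fun l => ⟨he.admP hu0 hu h hmu l, Or.inl rfl⟩,
    fun l => ⟨he.admM hu0 hu h' hmu' l, Or.inl rfl⟩,
    fun l => ⟨he.admP hu0 hu h' hmu' l, Or.inl rfl⟩⟩

lemma Full.mu_ne_zero (h : D.Full κ t z) : D.mu z ≠ 0 := (h.m 0).1.mu_ne_zero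

lemma Full.eq_sum_jostP (h : D.Full κ t z) (hu0 : D.uo ≠ 0) (x : ℝ) (v : C3) :
    v = ∑ j, (D.adjJostP z x t j ⬝ᵥ v / D.dd z j) • D.jostP z x t j :=
  eq_sum_of_dual (dd_ne_zero h.mu_ne_zero) (fun j l => pairing_PP hu0 (h.cp j).1 (h.p l).1 x) v

lemma Full.eq_sum_jostM (h : D.Full κ t z) (hu0 : D.uo ≠ 0) (x : ℝ) (v : C3) :
    v = ∑ j, (D.adjJostM z x t j ⬝ᵥ v / D.dd z j) • D.jostM z x t j :=
  eq_sum_of_dual (dd_ne_zero h.mu_ne_zero) (fun j l => pairing_MM hu0 (h.cm j).1 (h.m l).1 x) v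

lemma Full.jostM_eq (h : D.Full κ t z) (hu0 : D.uo ≠ 0) (hu : D.IsSolution) (x : ℝ)
    (l : Fin 3) :
    D.jostM z x t l = D.s 0 l z • D.jostP z x t 0 + D.s 1 l z • D.jostP z x t 1
      + D.s 2 l z • D.jostP z x t 2 := by
  have hd := dd_ne_zero (D := D) h.mu_ne_zero
  conv_lhs => rw [h.eq_sum_jostP hu0 x (D.jostM z x t l)]
  simp only [(h.cp _).pairing hu0 hu (h.m l), mul_div_cancel_left₀ _ (hd _), Fin.sum_univ_three]

lemma Full.jostP_eq (h : D.Full κ t z) (hu0 : D.uo ≠ 0) (hu : D.IsSolution) (x : ℝ)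
    (l : Fin 3) :
    D.jostP z x t l = D.b 0 l z • D.jostM z x t 0 + D.b 1 l z • D.jostM z x t 1
      + D.b 2 l z • D.jostM z x t 2 := by
  have hd := dd_ne_zero (D := D) h.mu_ne_zero
  conv_lhs => rw [h.eq_sum_jostM hu0 x (D.jostP z x t l)]
  simp only [(h.cm _).pairing hu0 hu (h.p l), mul_div_cancel_left₀ _ (hd _), Fin.sum_univ_three]

/-- The columns of `S` and `B` are coordinates in a basis of eigenfunctions, read off by pairing
with the dual basis of adjoint eigenfunctions. -/
theorem Full.scattering (h : D.Full κ t z) (hu0 : D.uo ≠ 0) (hu : D.IsSolution) (x : ℝ) :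
    D.JostM z x t = D.JostP z x t * D.S z ∧ D.JostP z x t = D.JostM z x t * D.B z := by
  constructor
  · rw [JostP, cols_mul, JostM, h.jostM_eq hu0 hu x 0, h.jostM_eq hu0 hu x 1,
      h.jostM_eq hu0 hu x 2]
    rfl
  · rw [JostM, cols_mul, JostP, h.jostP_eq hu0 hu x 0, h.jostP_eq hu0 hu x 1,
      h.jostP_eq hu0 hu x 2]
    rfl

/-! ### The auxiliary eigenfunctions -/

/-- Coordinates, in the basis of eigenfunctions normalized at `+∞`, of a vector product which has
an adjoint eigenfunction of that kind as its first factor. -/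
lemma Full.smul_cross_eq (h : D.Full κ t z) (hu0 : D.uo ≠ 0) (hu : D.IsSolution) (x : ℝ)
    (c l : Fin 3) :
    exp (I * D.h2 z x t) • crossProduct (D.adjJostP z x t c) (D.adjJostM z x t l) =
      (D.dd z l * D.b l (c + 1) z * D.crossFactor z (c + 1) / D.dd z (c + 2))
        • D.jostP z x t (c + 2)
      - (D.dd z l * D.b l (c + 2) z * D.crossFactor z (c + 2) / D.dd z (c + 1))
        • D.jostP z x t (c + 1) := by
  have hX : ∀ a, exp (I * D.h2 z x t) • crossProduct (D.adjJostP z x t (a + 1))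
      (D.adjJostP z x t (a + 2)) = D.crossFactor z a • D.jostP z x t a := fun a =>
    cross_adjJostP hu0 (h.cp _).1 (h.cp _).1 (h.p a).1 x
  have hb : ∀ a, D.adjJostM z x t l ⬝ᵥ D.jostP z x t a = D.dd z l * D.b l a z := fun a =>
    (h.cm l).pairing hu0 hu (h.p a) x
  have key : ∀ a, D.adjJostP z x t a ⬝ᵥ (exp (I * D.h2 z x t) •
      crossProduct (D.adjJostP z x t c) (D.adjJostM z x t l)) =
      D.adjJostM z x t l ⬝ᵥ (exp (I * D.h2 z x t) •
        crossProduct (D.adjJostP z x t a) (D.adjJostP z x t c)) := fun a => by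
    rw [dotProduct_smul, dotProduct_smul, ← dotProduct_cross_rotate]
  have h0 : D.adjJostP z x t c ⬝ᵥ (exp (I * D.h2 z x t) •
      crossProduct (D.adjJostP z x t c) (D.adjJostM z x t l)) = 0 := by
    rw [key, cross_self, smul_zero, dotProduct_zero]
  have h1 : D.adjJostP z x t (c + 1) ⬝ᵥ (exp (I * D.h2 z x t) •
      crossProduct (D.adjJostP z x t c) (D.adjJostM z x t l)) =
      -(D.dd z l * D.b l (c + 2) z * D.crossFactor z (c + 2)) := by
    have := hX (c + 2)
    rw [show c + 2 + 1 = c by fin_cases c <;> rfl, show c + 2 + 2 = c + 1 by fin_cases c <;> rfl]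
      at this
    rw [key, ← cross_anticomm, smul_neg, dotProduct_neg, this, dotProduct_smul, hb, smul_eq_mul]
    ring
  have h2 : D.adjJostP z x t (c + 2) ⬝ᵥ (exp (I * D.h2 z x t) •
      crossProduct (D.adjJostP z x t c) (D.adjJostM z x t l)) =
      D.dd z l * D.b l (c + 1) z * D.crossFactor z (c + 1) := by
    have := hX (c + 1)
    rw [show c + 1 + 2 = c by fin_cases c <;> rfl, show c + 1 + 1 = c + 2 by fin_cases c <;> rfl]
      at this
    rw [key, this, dotProduct_smul, hb, smul_eq_mul]
    ring
  have hs : ∀ f : Fin 3 → C3, ∑ a, f a = f c + f (c + 1) + f (c + 2) := fun f => by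
    rw [Fin.sum_univ_three]
    fin_cases c <;> simp <;> abel
  rw [h.eq_sum_jostP hu0 x (exp (I * D.h2 z x t) •
    crossProduct (D.adjJostP z x t c) (D.adjJostM z x t l)), hs, h0, h1, h2, zero_div, zero_smul,
    neg_div, neg_smul]
  abel

/-- The auxiliary eigenfunctions in the basis of eigenfunctions normalized at `+∞`. -/
lemma Full.rho_eq (h : D.Full κ t z) (hu0 : D.uo ≠ 0) (hu : D.IsSolution) (x : ℝ) :
    D.rho z x t 0 = (-D.b 1 2 z) • D.jostP z x t 1 + D.b 1 1 z • D.jostP z x t 2 ∧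
    D.rho z x t 1 = (-D.b 0 2 z) • D.jostP z x t 0 + D.b 0 0 z • D.jostP z x t 2 ∧
    D.rho z x t 2 = D.b 2 2 z • D.jostP z x t 0 + (-D.b 2 0 z) • D.jostP z x t 2 ∧
    D.rho z x t 3 = D.b 1 1 z • D.jostP z x t 0 + (-D.b 1 0 z) • D.jostP z x t 1 := by
  have hmu := h.mu_ne_zero
  have e0 := h.smul_cross_eq hu0 hu x 0 1
  have e1 := h.smul_cross_eq hu0 hu x 1 0
  have e2 := h.smul_cross_eq hu0 hu x 1 2
  have e3 := h.smul_cross_eq hu0 hu x 2 1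
  simp [dd, crossFactor, hmu] at e0 e1 e2 e3
  refine ⟨?_, ?_, ?_, ?_⟩
  · simp only [rho, Matrix.cons_val_zero]
    rw [e0, neg_smul]
    abel
  · simp only [rho, Matrix.cons_val_one, Matrix.cons_val_zero]
    rw [← cross_anticomm, smul_neg, e1, neg_smul]
    abel
  · simp only [rho, Matrix.cons_val]
    rw [e2, neg_smul]
    abel
  · simp only [rho, Matrix.cons_val]
    rw [← cross_anticomm, smul_neg, e3, neg_smul]
    abel

end HirotaData

namespace HirotaData

variable {D : HirotaData} {κ t x : ℝ} {z : ℂ} {j l : Fin 3}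

/-! ### Relations on the circle -/

/-- On the upper semicircle, where only some of the eigenfunctions exist, the two eigenfunctions
normalized at `-∞` are combinations of two auxiliary eigenfunctions. -/
lemma jostM_eq_rho (hu0 : D.uo ≠ 0) (hu : D.IsSolution) (hl : l ≠ 1) (hm : D.FlowM κ t z l)
    (hp : D.FlowP κ t z 1) (hp0 : D.FlowP κ t (conj z) 0)
    (hp2 : D.FlowP κ t (conj z) 2) (hcm : D.FlowM κ t (conj z) 1) (x : ℝ) :
    D.b 1 1 z • D.jostM z x t l = D.s 2 l z • D.rho z x t 0 + D.s 0 l z • D.rho z x t 3 := by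
  have hmu := hm.1.mu_ne_zero
  have h := triple_smul_eq (exp (I * D.h2 z x t)) (D.adjJostM z x t 1)
    (D.adjJostP z x t 2) (D.adjJostP z x t 0) (D.jostM z x t l)
  have hX : exp (I * D.h2 z x t) • crossProduct (D.adjJostP z x t 2) (D.adjJostP z x t 0) =
    D.mu z • D.jostP z x t 1 := cross_adjJostP hu0 (c := 1) hp2.1 hp0.1 hp.1 x
  have h1 := pairing_MM hu0 hcm.1 hm.1 x
  rw [if_neg hl.symm] at h1
  rw [hX, h1, zero_smul, zero_add, dotProduct_smul, hcm.pairing hu0 hu hp, hp2.pairing hu0 hu hm,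
    hp0.pairing hu0 hu hm] at h
  have h' : D.mu z • (D.b 1 1 z • D.jostM z x t l) =
      D.mu z • (D.s 2 l z • D.rho z x t 0 + D.s 0 l z • D.rho z x t 3) := by
    rw [smul_add, smul_smul, smul_smul, smul_smul]
    simpa [dd, rho] using h
  exact smul_right_injective _ hmu h'

/-- The corresponding relation on the lower semicircle. -/
lemma jostP_eq_rho (hu0 : D.uo ≠ 0) (hu : D.IsSolution) (hl : l ≠ 1) (hp : D.FlowP κ t z l)
    (hm : D.FlowM κ t z 1) (hm0 : D.FlowM κ t (conj z) 0)
    (hm2 : D.FlowM κ t (conj z) 2) (hcp : D.FlowP κ t (conj z) 1) (x : ℝ) :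
    D.s 1 1 z • D.jostP z x t l = D.b 2 l z • D.rho z x t 1 + D.b 0 l z • D.rho z x t 2 := by
  have hmu := hm.1.mu_ne_zero
  have h := triple_smul_eq (exp (I * D.h2 z x t)) (D.adjJostP z x t 1)
    (D.adjJostM z x t 2) (D.adjJostM z x t 0) (D.jostP z x t l)
  have hX : exp (I * D.h2 z x t) • crossProduct (D.adjJostM z x t 2) (D.adjJostM z x t 0) =
    D.mu z • D.jostM z x t 1 := cross_adjJostM hu0 (c := 1) hm2.1 hm0.1 hm.1 x
  have h1 := pairing_PP hu0 hcp.1 hp.1 x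
  rw [if_neg hl.symm] at h1
  rw [hX, h1, zero_smul, zero_add, dotProduct_smul, hcp.pairing hu0 hu hm, hm2.pairing hu0 hu hp,
    hm0.pairing hu0 hu hp] at h
  have h' : D.mu z • (D.s 1 1 z • D.jostP z x t l) =
      D.mu z • (D.b 2 l z • D.rho z x t 1 + D.b 0 l z • D.rho z x t 2) := by
    rw [smul_add, smul_smul, smul_smul, smul_smul]
    simpa [dd, rho] using h
  exact smul_right_injective _ hmu h'

/-- On the lower semicircle, `s₂₂` is a minor of the scattering matrix `B`. -/
lemma s_one_one_eq (hu0 : D.uo ≠ 0) (hu : D.IsSolution) (hp0 : D.FlowP κ t z 0)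
    (hp2 : D.FlowP κ t z 2) (hm : D.FlowM κ t z 1) (hm0 : D.FlowM κ t (conj z) 0)
    (hm2 : D.FlowM κ t (conj z) 2) (hcp : D.FlowP κ t (conj z) 1) :
    D.s 1 1 z = D.b 0 0 z * D.b 2 2 z - D.b 0 2 z * D.b 2 0 z := by
  have hmu := hm.1.mu_ne_zero
  have hmu' := mu_conj_ne_zero hmu
  have hX : exp (I * D.h2 z 0 t) • crossProduct (D.adjJostM z 0 t 2) (D.adjJostM z 0 t 0) =
    D.mu z • D.jostM z 0 t 1 := cross_adjJostM hu0 (c := 1) hm2.1 hm0.1 hm.1 0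
  have hp0' : D.AdmP κ t (conj (conj z)) 0 := by simpa using hp0.1
  have hp2' : D.AdmP κ t (conj (conj z)) 2 := by simpa using hp2.1
  have hY : exp (I * D.h2 (conj z) 0 t) • crossProduct (D.adjJostP (conj z) 0 t 2)
      (D.adjJostP (conj z) 0 t 0) = D.mu (conj z) • D.jostP (conj z) 0 t 1 :=
    cross_adjJostP hu0 (c := 1) hp2' hp0' hcp.1 0
  have hY' : exp (-I * D.h2 z 0 t) • crossProduct (D.jostP z 0 t 2) (D.jostP z 0 t 0) =
      D.mu z • D.adjJostP z 0 t 1 := by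
    have := congrArg star hY
    rw [hp0'.adjJostP_eq, hp2'.adjJostP_eq, Complex.conj_conj, star_smul, star_smul,
      ← hcp.1.adjJostP_eq, mu_conj] at this
    have h2 : star (exp (I * D.h2 (conj z) 0 t)) = exp (-I * D.h2 z 0 t) :=
      star_exp_hh z 0 t 1
    have h3 : star (crossProduct (star (D.jostP z 0 t 2)) (star (D.jostP z 0 t 0))) =
        crossProduct (D.jostP z 0 t 2) (D.jostP z 0 t 0) := by
      ext i
      fin_cases i <;> simp [cross_apply]
    rw [h2, h3] at this
    simpa using this
  have h := congrArg₂ (· ⬝ᵥ ·) hX hY'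
  simp only [smul_dotProduct, dotProduct_smul, cross_dot_cross, hm2.pairing hu0 hu hp2,
    hm0.pairing hu0 hu hp0, hm2.pairing hu0 hu hp0, hm0.pairing hu0 hu hp2, smul_eq_mul] at h
  rw [dotProduct_comm (D.jostM z 0 t 1), hcp.pairing hu0 hu hm, ← mul_assoc, ← Complex.exp_add,
    neg_mul, neg_add_cancel, Complex.exp_zero] at h
  simp only [dd, Matrix.cons_val] at h
  have h' : D.mu z ^ 2 * D.s 1 1 z =
      D.mu z ^ 2 * (D.b 0 0 z * D.b 2 2 z - D.b 0 2 z * D.b 2 0 z) := by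
    linear_combination -h
  exact mul_left_cancel₀ (pow_ne_zero 2 hmu) h'

/-! ### The matrices of the Riemann-Hilbert problem -/

lemma exp_mul_exp_neg (w : ℂ) : exp (I * w) * exp (-I * w) = 1 := by
  rw [← Complex.exp_add, neg_mul, add_neg_cancel, Complex.exp_zero]

lemma phiM_eq (z : ℂ) (x t : ℝ) (l : Fin 3) :
    D.phiM z x t l = exp (-I * D.hh z x t l) • D.jostM z x t l := by
  rw [jostM, smul_smul, mul_comm, exp_mul_exp_neg, one_smul]

lemma phiP_eq (z : ℂ) (x t : ℝ) (l : Fin 3) :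
    D.phiP z x t l = exp (-I * D.hh z x t l) • D.jostP z x t l := by
  rw [jostP, smul_smul, mul_comm, exp_mul_exp_neg, one_smul]

lemma chi_eq (z : ℂ) (x t : ℝ) :
    D.chi z x t 0 = exp (-I * D.hh z x t 2) • D.rho z x t 0 ∧
    D.chi z x t 1 = exp (-I * D.hh z x t 2) • D.rho z x t 1 ∧
    D.chi z x t 2 = exp (-I * D.hh z x t 0) • D.rho z x t 2 ∧
    D.chi z x t 3 = exp (-I * D.hh z x t 0) • D.rho z x t 3 := by
  have h : -I * D.hh z x t 2 = I * D.h1 z x t := by simp [hh]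
  rw [h]
  exact ⟨rfl, rfl, rfl, rfl⟩

lemma cols_mul_diagonal (a b c : C3) (f g : Fin 3 → ℂ) :
    cols a b c * Matrix.diagonal f * Matrix.diagonal g =
      cols (g 0 • f 0 • a) (g 1 • f 1 • b) (g 2 • f 2 • c) := by
  ext i j
  rw [Matrix.mul_diagonal, Matrix.mul_diagonal]
  fin_cases j <;> simp [cols] <;> ring

lemma M_eq (j : Fin 4) (z : ℂ) (x t : ℝ) :
    D.M j z x t = D.P z x t j * D.expNegH z x t *
      Matrix.diagonal (fun l => (D.den z j l)⁻¹) := by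
  obtain ⟨h0, h1, h2, h3⟩ := D.chi_eq z x t
  have h : ∀ v : C3, (1 : ℂ)⁻¹ • v = v := fun v => by rw [inv_one, one_smul]
  have hc : ∀ {a a' b b' c c' : C3}, a = a' → b = b' → c = c' →
      cols a b c = cols a' b' c' := fun ha hb hc => by rw [ha, hb, hc]
  rw [expNegH]
  fin_cases j
  · refine Eq.trans ?_ (cols_mul_diagonal _ _ _ _ _).symm
    rw [← phiM_eq, ← phiP_eq, ← h0]
    exact hc rfl (h _).symm rfl
  · refine Eq.trans ?_ (cols_mul_diagonal _ _ _ _ _).symm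
    rw [← phiM_eq, ← phiP_eq, ← h1]
    exact hc (h _).symm rfl rfl
  · refine Eq.trans ?_ (cols_mul_diagonal _ _ _ _ _).symm
    rw [← phiM_eq, ← phiP_eq, ← h2]
    exact hc rfl rfl (h _).symm
  · refine Eq.trans ?_ (cols_mul_diagonal _ _ _ _ _).symm
    rw [← phiM_eq, ← phiP_eq, ← h3]
    exact hc rfl (h _).symm rfl

lemma Regular.diagonal_inv {j : Fin 4} (h : D.Regular j z) :
    (Matrix.diagonal (D.den z j))⁻¹ = Matrix.diagonal (fun l => (D.den z j l)⁻¹) := by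
  refine Matrix.inv_eq_right_inv ?_
  rw [Matrix.diagonal_mul_diagonal, ← Matrix.diagonal_one]
  congr 1
  ext l
  exact mul_inv_cancel₀ (h l)

/-- The jump relation follows from a relation between the coordinates of the columns with respect
to three common vectors. -/
lemma jump_of_coords {a c : Fin 4} {W A C V : Mat3} (hA : D.P z x t a = W * A)
    (hC : D.P z x t c = W * C)
    (h : A * Matrix.diagonal (fun l => (D.den z a l)⁻¹) =
      C * Matrix.diagonal (fun l => (D.den z c l)⁻¹) * (1 - V)) :
    D.M a z x t = D.M c z x t * (1 - D.expH z x t * V * D.expNegH z x t) := by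
  have hE : D.expNegH z x t * D.expH z x t = 1 := by
    rw [expNegH, expH, Matrix.diagonal_mul_diagonal, ← Matrix.diagonal_one]
    congr 1
    ext l
    rw [mul_comm, exp_mul_exp_neg]
  have hcomm : ∀ f : Fin 3 → ℂ, D.expNegH z x t * Matrix.diagonal f =
      Matrix.diagonal f * D.expNegH z x t := fun f => by
    simp only [expNegH, Matrix.diagonal_mul_diagonal, mul_comm]
  have h1 : D.expNegH z x t * (1 - D.expH z x t * V * D.expNegH z x t) =
      (1 - V) * D.expNegH z x t := by
    rw [mul_sub, mul_one, sub_mul, one_mul, ← mul_assoc, ← mul_assoc, hE, one_mul]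
  rw [M_eq, M_eq, mul_assoc, hcomm, mul_assoc (D.P z x t c), hcomm, mul_assoc (D.P z x t c),
    mul_assoc (Matrix.diagonal _), h1, hA, hC]
  calc W * A * (Matrix.diagonal (fun l => (D.den z a l)⁻¹) * D.expNegH z x t)
      = W * (A * Matrix.diagonal (fun l => (D.den z a l)⁻¹)) * D.expNegH z x t := by
        simp only [mul_assoc]
    _ = _ := by
        rw [h]
        simp only [mul_assoc]

end HirotaData

namespace HirotaData

variable {D : HirotaData} {κ t x : ℝ} {z : ℂ} {j l : Fin 3}

/-! ### The jump relations -/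

lemma den_inv (z : ℂ) :
    (fun l => (D.den z 0 l)⁻¹) = ![(D.s 0 0 z)⁻¹, 1, (D.b 1 1 z)⁻¹] ∧
    (fun l => (D.den z 1 l)⁻¹) = ![1, (D.s 1 1 z)⁻¹, (D.b 0 0 z)⁻¹] ∧
    (fun l => (D.den z 2 l)⁻¹) = ![(D.b 2 2 z)⁻¹, (D.s 1 1 z)⁻¹, 1] ∧
    (fun l => (D.den z 3 l)⁻¹) = ![(D.b 1 1 z)⁻¹, 1, (D.s 2 2 z)⁻¹] := by
  refine ⟨?_, ?_, ?_, ?_⟩ <;> ext l <;> fin_cases l <;> simp [den]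

lemma mul_diagonal_fin_three (a b c d e f g h i p q r : ℂ) :
    !![a, b, c; d, e, f; g, h, i] * Matrix.diagonal ![p, q, r] =
      !![a * p, b * q, c * r; d * p, e * q, f * r; g * p, h * q, i * r] := by
  ext i j
  rw [Matrix.mul_diagonal]
  fin_cases i <;> fin_cases j <;> simp

/-- The matrices `P_j` in the basis of eigenfunctions normalized at `+∞`. -/
lemma Full.P_eq (h : D.Full κ t z) (hu0 : D.uo ≠ 0) (hu : D.IsSolution) (x : ℝ) :
    D.P z x t 0 = D.JostP z x t *
      !![D.s 0 0 z, 0, 0; D.s 1 0 z, 1, -D.b 1 2 z; D.s 2 0 z, 0, D.b 1 1 z] ∧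
    D.P z x t 1 = D.JostP z x t *
      !![1, D.s 0 1 z, -D.b 0 2 z; 0, D.s 1 1 z, 0; 0, D.s 2 1 z, D.b 0 0 z] ∧
    D.P z x t 2 = D.JostP z x t *
      !![D.b 2 2 z, D.s 0 1 z, 0; 0, D.s 1 1 z, 0; -D.b 2 0 z, D.s 2 1 z, 1] ∧
    D.P z x t 3 = D.JostP z x t *
      !![D.b 1 1 z, 0, D.s 0 2 z; -D.b 1 0 z, 1, D.s 1 2 z; 0, 0, D.s 2 2 z] := by
  obtain ⟨h0, h1, h2, h3⟩ := h.rho_eq hu0 hu x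
  have hm := h.jostM_eq hu0 hu x
  have e0 : D.P z x t 0 = cols (D.jostM z x t 0) (D.jostP z x t 1) (D.rho z x t 0) := rfl
  have e1 : D.P z x t 1 = cols (D.jostP z x t 0) (D.jostM z x t 1) (D.rho z x t 1) := rfl
  have e2 : D.P z x t 2 = cols (D.rho z x t 2) (D.jostM z x t 1) (D.jostP z x t 2) := rfl
  have e3 : D.P z x t 3 = cols (D.rho z x t 3) (D.jostP z x t 1) (D.jostM z x t 2) := rfl
  rw [e0, e1, e2, e3, h0, h1, h2, h3, hm 0, hm 1, hm 2, JostP, cols_mul, cols_mul, cols_mul,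
    cols_mul]
  simp

/-- On the real line all eigenfunctions exist, and both sides of the jump relation are expanded in
the basis normalized at `+∞`. -/
lemma jump_real_outer (hu0 : D.uo ≠ 0) (hu : D.IsSolution) (hz : z ≠ 0) (h : z.im = 0)
    (hp : D.Regular 0 z) (hm : D.Regular 1 z) (x t : ℝ) :
    D.M 0 z x t = D.M 1 z x t * (1 - D.expH z x t * D.V 0 z * D.expNegH z x t) := by
  have hn := u0_ne hu0
  have hf := full_of_im_eq_zero hu0 hu hz h t
  have hf0 := full_of_im_eq_zero hu0 hu hz h 0
  obtain ⟨e0, e1, -, -⟩ := hf.P_eq hu0 hu x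
  obtain ⟨d0, d1, -, -⟩ := D.den_inv z
  refine jump_of_coords e0 e1 ?_
  have n1 : D.s 0 0 z ≠ 0 := hp 0
  have n2 : D.b 1 1 z ≠ 0 := hp 2
  have n3 : D.s 1 1 z ≠ 0 := hm 1
  have n4 : D.b 0 0 z ≠ 0 := hm 2
  have hmu := hf.mu_ne_zero
  have hV : D.V 0 z = D.V1 z := rfl
  rw [d0, d1, hV, V1, hat_beta3 hu0 (hf0.cp 0).1 (hf0.cp 1).1 (hf0.m 1).1,
    frown_beta2 (hf0.p 0).1 (hf0.p 2).1 (hf0.cm 0).1,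
    frown_beta3 (hf0.p 1).1 (hf0.p 2).1 (hf0.cm 1).1, beta1, beta2, beta3,
    mul_diagonal_fin_three, mul_diagonal_fin_three]
  ext i j
  fin_cases i <;> fin_cases j <;>
    simp [Matrix.mul_apply, Fin.sum_univ_three, Matrix.one_apply] <;> field_simp <;>
      first | done | ring1 | (ring_nf; simp only [I_sq]; ring1)

lemma jump_real_inner (hu0 : D.uo ≠ 0) (hu : D.IsSolution) (hz : z ≠ 0) (h : z.im = 0)
    (hp : D.Regular 2 z) (hm : D.Regular 3 z) (x t : ℝ) :
    D.M 2 z x t = D.M 3 z x t * (1 - D.expH z x t * D.V 2 z * D.expNegH z x t) := by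
  have hn := u0_ne hu0
  have hf := full_of_im_eq_zero hu0 hu hz h t
  have hf0 := full_of_im_eq_zero hu0 hu hz h 0
  obtain ⟨-, -, e2, e3⟩ := hf.P_eq hu0 hu x
  obtain ⟨-, -, d2, d3⟩ := D.den_inv z
  refine jump_of_coords e2 e3 ?_
  have n1 : D.b 2 2 z ≠ 0 := hp 0
  have n2 : D.s 1 1 z ≠ 0 := hp 1
  have n3 : D.b 1 1 z ≠ 0 := hm 0
  have n4 : D.s 2 2 z ≠ 0 := hm 2
  have hmu := hf.mu_ne_zero
  have hV : D.V 2 z = D.V3 z := rfl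
  rw [d2, d3, hV, V3, hat_beta1 hu0 (hf0.cp 1).1 (hf0.cp 2).1 (hf0.m 2).1,
    hat_beta2 hu0 (hf0.cp 0).1 (hf0.cp 2).1 (hf0.m 2).1,
    hat_beta3 hu0 (hf0.cp 0).1 (hf0.cp 1).1 (hf0.m 1).1,
    smile_beta2 hu0 (hf0.p 0).1 (hf0.p 2).1 (hf0.cm 2).1,
    smile_beta3 hu0 (hf0.p 0).1 (hf0.p 1).1 (hf0.cm 1).1, beta3,
    mul_diagonal_fin_three, mul_diagonal_fin_three]
  ext i j
  fin_cases i <;> fin_cases j <;>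
    simp [Matrix.mul_apply, Fin.sum_univ_three, Matrix.one_apply] <;> field_simp <;>
      first | done | ring1 | (ring_nf; simp only [I_sq, I_pow_four]; ring1)

/-- The eigenfunctions which exist on the upper semicircle. -/
lemma flow_upper_circle (hu0 : D.uo ≠ 0) (hu : D.IsSolution) (h : ‖z‖ = D.u0) (hmu : D.mu z ≠ 0)
    (him : 0 ≤ z.im) (t : ℝ) :
    D.FlowM 0 t z 0 ∧ D.FlowM 0 t z 2 ∧ D.FlowP 0 t z 1 ∧ D.FlowP 0 t (conj z) 0 ∧
      D.FlowP 0 t (conj z) 2 ∧ D.FlowM 0 t (conj z) 1 := by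
  have hz := norm_pos_of_norm_eq hu0 h
  have hl := lam_im_of_norm_eq hu0 h
  have m0 := mem_domM_zero hz hmu him hl.ge
  have m2 := mem_domM_two hz hmu him hl.le
  have p1 := mem_domP_one hz hmu him
  exact ⟨flowM_of_mem hu0 hu m0 t, flowM_of_mem hu0 hu m2 t, flowP_of_mem hu0 hu p1 t,
    flowP_of_mem hu0 hu (conj_mem_domP.2 m0) t, flowP_of_mem hu0 hu (conj_mem_domP.2 m2) t,
    flowM_of_mem hu0 hu (conj_mem_domM.2 p1) t⟩

/-- The eigenfunctions which exist on the lower semicircle. -/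
lemma flow_lower_circle (hu0 : D.uo ≠ 0) (hu : D.IsSolution) (h : ‖z‖ = D.u0) (hmu : D.mu z ≠ 0)
    (him : z.im ≤ 0) (t : ℝ) :
    D.FlowP 0 t z 0 ∧ D.FlowP 0 t z 2 ∧ D.FlowM 0 t z 1 ∧ D.FlowM 0 t (conj z) 0 ∧
      D.FlowM 0 t (conj z) 2 ∧ D.FlowP 0 t (conj z) 1 := by
  have hz := norm_pos_of_norm_eq hu0 h
  have hl := lam_im_of_norm_eq hu0 h
  have p0 := mem_domP_zero hz hmu him hl.le
  have p2 := mem_domP_two hz hmu him hl.ge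
  have m1 := mem_domM_one hz hmu him
  exact ⟨flowP_of_mem hu0 hu p0 t, flowP_of_mem hu0 hu p2 t, flowM_of_mem hu0 hu m1 t,
    flowM_of_mem hu0 hu (conj_mem_domM.2 p0) t, flowM_of_mem hu0 hu (conj_mem_domM.2 p2) t,
    flowP_of_mem hu0 hu (conj_mem_domP.2 m1) t⟩

/-- On the upper semicircle no complete basis of eigenfunctions need exist. The columns are
combinations of `ρ₄`, `φ_{+,2}` and `ρ₁` instead. -/
lemma jump_upper_circle (hu0 : D.uo ≠ 0) (hu : D.IsSolution) (h : ‖z‖ = D.u0)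
    (hmu : D.mu z ≠ 0) (him : 0 ≤ z.im) (hp : D.Regular 0 z) (hm : D.Regular 3 z) (x t : ℝ) :
    D.M 0 z x t = D.M 3 z x t * (1 - D.expH z x t * D.V 3 z * D.expNegH z x t) := by
  have n1 : D.s 0 0 z ≠ 0 := hp 0
  have n2 : D.b 1 1 z ≠ 0 := hp 2
  have n3 : D.s 2 2 z ≠ 0 := hm 2
  obtain ⟨m0, m2, p1, cp0, cp2, cm1⟩ := flow_upper_circle hu0 hu h hmu him t
  obtain ⟨-, k2, -, k3, k4, -⟩ := flow_upper_circle hu0 hu h hmu him 0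
  have r0 := (eq_inv_smul_iff₀ n2).2 (jostM_eq_rho hu0 hu (by decide) m0 p1 cp0 cp2 cm1 x)
  have r2 := (eq_inv_smul_iff₀ n2).2 (jostM_eq_rho hu0 hu (by decide) m2 p1 cp0 cp2 cm1 x)
  obtain ⟨d0, -, -, d3⟩ := D.den_inv z
  have e0 : D.P z x t 0 = cols (D.rho z x t 3) (D.jostP z x t 1) (D.rho z x t 0) *
      !![D.s 0 0 z / D.b 1 1 z, 0, 0; 0, 1, 0; D.s 2 0 z / D.b 1 1 z, 0, 1] := by
    have : D.P z x t 0 = cols (D.jostM z x t 0) (D.jostP z x t 1) (D.rho z x t 0) := rfl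
    rw [this, r0, cols_mul]
    simp [smul_smul, div_eq_inv_mul, add_comm]
  have e3 : D.P z x t 3 = cols (D.rho z x t 3) (D.jostP z x t 1) (D.rho z x t 0) *
      !![1, 0, D.s 0 2 z / D.b 1 1 z; 0, 1, 0; 0, 0, D.s 2 2 z / D.b 1 1 z] := by
    have : D.P z x t 3 = cols (D.rho z x t 3) (D.jostP z x t 1) (D.jostM z x t 2) := rfl
    rw [this, r2, cols_mul]
    simp [smul_smul, div_eq_inv_mul, add_comm]
  refine jump_of_coords e0 e3 ?_
  have hV : D.V 3 z = D.V4 z := rfl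
  rw [d0, d3, hV, V4, hat_beta2 hu0 k3.1 k4.1 k2.1, beta2, mul_diagonal_fin_three,
    mul_diagonal_fin_three]
  ext i j
  fin_cases i <;> fin_cases j <;>
    simp [Matrix.mul_apply, Fin.sum_univ_three, Matrix.one_apply] <;> field_simp <;>
      first | done | ring1

/-- On the lower semicircle the columns are combinations of `φ_{+,1}`, `φ_{-,2}` and `ρ₂`. -/
lemma jump_lower_circle (hu0 : D.uo ≠ 0) (hu : D.IsSolution) (h : ‖z‖ = D.u0)
    (hmu : D.mu z ≠ 0) (him : z.im ≤ 0) (hp : D.Regular 2 z) (hm : D.Regular 1 z) (x t : ℝ) :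
    D.M 2 z x t = D.M 1 z x t * (1 - D.expH z x t * D.V 1 z * D.expNegH z x t) := by
  have n1 : D.b 2 2 z ≠ 0 := hp 0
  have n2 : D.s 1 1 z ≠ 0 := hp 1
  have n3 : D.b 0 0 z ≠ 0 := hm 2
  obtain ⟨p0, p2, m1, cm0, cm2, cp1⟩ := flow_lower_circle hu0 hu h hmu him t
  obtain ⟨k1, k2, -, k4, k5, -⟩ := flow_lower_circle hu0 hu h hmu him 0
  -- both relations are solved for the columns outside the chosen basis; the second one needs the
  -- expression of `s₂₂` by `b_{jl}`
  have hs := s_one_one_eq hu0 hu p0 p2 m1 cm0 cm2 cp1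
  have r0 := jostP_eq_rho hu0 hu (by decide) p0 m1 cm0 cm2 cp1 x
  have r2 := jostP_eq_rho hu0 hu (by decide) p2 m1 cm0 cm2 cp1 x
  have hρ : D.rho z x t 2 = (D.s 1 1 z / D.b 0 0 z) • D.jostP z x t 0
      + (-D.b 2 0 z / D.b 0 0 z) • D.rho z x t 1 := by
    refine smul_right_injective _ n3 ?_
    simp only [smul_add, smul_smul, mul_div_cancel₀ _ n3, r0]
    rw [neg_smul]
    abel
  have hp2 : D.jostP z x t 2 = (D.b 0 2 z / D.b 0 0 z) • D.jostP z x t 0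
      + (D.b 0 0 z)⁻¹ • D.rho z x t 1 := by
    refine smul_right_injective _ n2 ?_
    simp only [smul_add, smul_smul, r2, hρ]
    rw [add_left_comm, ← add_smul]
    congr 2
    · ring
    · rw [hs]
      field_simp
      ring
  obtain ⟨-, d1, d2, -⟩ := D.den_inv z
  have e1 : D.P z x t 1 = cols (D.jostP z x t 0) (D.jostM z x t 1) (D.rho z x t 1) *
      !![1, 0, 0; 0, 1, 0; 0, 0, 1] := by
    have : D.P z x t 1 = cols (D.jostP z x t 0) (D.jostM z x t 1) (D.rho z x t 1) := rfl
    rw [this, cols_mul]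
    simp
  have e2 : D.P z x t 2 = cols (D.jostP z x t 0) (D.jostM z x t 1) (D.rho z x t 1) *
      !![D.s 1 1 z / D.b 0 0 z, 0, D.b 0 2 z / D.b 0 0 z; 0, 1, 0;
        -D.b 2 0 z / D.b 0 0 z, 0, (D.b 0 0 z)⁻¹] := by
    have : D.P z x t 2 = cols (D.rho z x t 2) (D.jostM z x t 1) (D.jostP z x t 2) := rfl
    rw [this, cols_mul, hρ, hp2]
    simp
  refine jump_of_coords e2 e1 ?_
  have hV : D.V 1 z = D.V2 z := rfl
  rw [d1, d2, hV, V2, frown_beta2 k1.1 k2.1 k4.1, smile_beta2 hu0 k1.1 k2.1 k5.1,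
    mul_diagonal_fin_three, mul_diagonal_fin_three]
  ext i j
  fin_cases i <;> fin_cases j <;>
    simp [Matrix.mul_apply, Fin.sum_univ_three, Matrix.one_apply] <;> field_simp <;>
      first | done | ring1 | rw [hs]; ring1

/-! ### The vanishing combinations on the upper semicircle -/

/-- Where all eigenfunctions exist on the circle, the relations between eigenfunctions and auxiliary
eigenfunctions have a component along the second eigenfunction normalized at `+∞`; its two instances
are the vanishing of `Λ₈` and `Λ₉`. -/
lemma lambda_eq_zero (he : D.ExpDecay) (hu0 : D.uo ≠ 0) (hu : D.IsSolution) (h : ‖z‖ = D.u0)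
    (hmu : D.mu z ≠ 0) (hp : D.Regular 0 z) (hm : D.Regular 3 z) :
    D.Lambda8 z = 0 ∧ D.Lambda9 z = 0 := by
  have hn := u0_ne hu0
  have hz := norm_pos_of_norm_eq hu0 h
  have n1 : D.s 0 0 z ≠ 0 := hp 0
  have n2 : D.b 1 1 z ≠ 0 := hp 2
  have n3 : D.s 2 2 z ≠ 0 := hm 2
  have hf := he.full hu0 hu h hmu
  obtain ⟨q0, -, -, q3⟩ := hf.rho_eq hu0 hu 0
  -- the second coordinates, in the basis of eigenfunctions normalized at `+∞`, of the relations
  -- between the eigenfunctions and the auxiliary eigenfunctions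
  have key : ∀ l, l ≠ 1 →
      D.b 1 1 z * D.s 1 l z = -(D.s 2 l z * D.b 1 2 z) - D.s 0 l z * D.b 1 0 z := fun l hl => by
    have r := jostM_eq_rho hu0 hu hl (hf.m l) (hf.p 1) (hf.cp 0) (hf.cp 2) (hf.cm 1) 0
    rw [q0, q3] at r
    have r' := congrArg (D.adjJostP z 0 0 1 ⬝ᵥ ·) r
    simp only [dotProduct_smul, dotProduct_add, (hf.cp 1).pairing hu0 hu (hf.m l),
      pairing_PP hu0 (hf.cp 1).1 (hf.p _).1, smul_eq_mul] at r'
    simp [dd] at r'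
    linear_combination r'
  have k0 := key 0 (by decide)
  have k2 := key 2 (by decide)
  have e1 : D.s 1 0 z = (-(D.s 2 0 z * D.b 1 2 z) - D.s 0 0 z * D.b 1 0 z) / D.b 1 1 z := by
    rw [eq_div_iff n2, mul_comm, k0]
  have e2 : D.s 1 2 z = (-(D.s 2 2 z * D.b 1 2 z) - D.s 0 2 z * D.b 1 0 z) / D.b 1 1 z := by
    rw [eq_div_iff n2, mul_comm, k2]
  rw [Lambda8, Lambda9, hat_beta1 hu0 (hf.cp 1).1 (hf.cp 2).1 (hf.m 2).1,
    hat_beta2 hu0 (hf.cp 0).1 (hf.cp 2).1 (hf.m 2).1,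
    smile_beta3 hu0 (hf.p 0).1 (hf.p 1).1 (hf.cm 1).1,
    frown_beta3 (hf.p 1).1 (hf.p 2).1 (hf.cm 1).1, beta1, beta2, e1, e2]
  constructor
  · field_simp
    ring
  · field_simp
    ring_nf
    simp only [I_sq]
    ring

end HirotaData

/-! ### Functions continuous on a set and holomorphic in its interior -/

/-- `f` is continuous on `E` and holomorphic in the interior of `E`. -/
structure HolOn (f : ℂ → ℂ) (E : Set ℂ) : Prop where
  cont : ContinuousOn f E
  diff : DifferentiableOn ℂ f (interior E)

namespace HolOn

variable {f g : ℂ → ℂ} {E E' : Set ℂ}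

lemma of_differentiableOn (h : DifferentiableOn ℂ f E) : HolOn f E :=
  ⟨h.continuousOn, h.mono interior_subset⟩

lemma mono (h : HolOn f E) (hE : E' ⊆ E) : HolOn f E' :=
  ⟨h.cont.mono hE, h.diff.mono (interior_mono hE)⟩

lemma congr (h : HolOn f E) (hfg : ∀ z ∈ E, g z = f z) : HolOn g E :=
  ⟨h.cont.congr hfg, h.diff.congr fun z hz => hfg z (interior_subset hz)⟩

lemma add (hf : HolOn f E) (hg : HolOn g E) : HolOn (fun z => f z + g z) E :=
  ⟨hf.cont.add hg.cont, hf.diff.add hg.diff⟩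

lemma sub (hf : HolOn f E) (hg : HolOn g E) : HolOn (fun z => f z - g z) E :=
  ⟨hf.cont.sub hg.cont, hf.diff.sub hg.diff⟩

lemma mul (hf : HolOn f E) (hg : HolOn g E) : HolOn (fun z => f z * g z) E :=
  ⟨hf.cont.mul hg.cont, hf.diff.mul hg.diff⟩

lemma conj_conj (hf : HolOn f E) :
    HolOn (fun z => conj (f (conj z))) {z | conj z ∈ E} := by
  refine ⟨?_, fun z hz => ?_⟩
  · exact Complex.continuous_conj.comp_continuousOn
      (hf.cont.comp Complex.continuous_conj.continuousOn fun z hz => hz)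
  · have h1 : conj z ∈ interior E := by
      have h2 : interior {z | conj z ∈ E} = conj ⁻¹' interior E :=
        (Complex.conjCLE.toHomeomorph.preimage_interior E).symm
      rw [h2] at hz
      exact hz
    have h3 := hf.diff.differentiableAt (isOpen_interior.mem_nhds h1)
    have h4 : DifferentiableAt ℂ (conj ∘ f ∘ conj) z := by
      have := h3.conj_conj
      rwa [Complex.conj_conj] at this
    exact h4.differentiableWithinAt

lemma analyticAt (hf : HolOn f E) {A : Set ℂ} (hA : IsOpen A) (hAE : A ⊆ E) {z : ℂ}
    (hz : z ∈ A) : AnalyticAt ℂ f z :=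
  (hf.diff.mono (interior_maximal hAE hA)).analyticAt (hA.mem_nhds hz)

end HolOn

namespace HirotaData

variable {D : HirotaData} {κ t x : ℝ} {z : ℂ} {j l : Fin 3}

/-! ### Dependence of the eigenfunctions on the spectral parameter -/

lemma differentiableOn_lam : DifferentiableOn ℂ D.lam {z | z ≠ 0} := by
  unfold lam
  exact (differentiableOn_id.add ((differentiableOn_const _).div differentiableOn_id
    fun z hz => hz)).div_const 2

lemma differentiableOn_kk : DifferentiableOn ℂ D.kk {z | z ≠ 0} := by
  unfold kk
  exact (differentiableOn_id.sub ((differentiableOn_const _).div differentiableOn_id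
    fun z hz => hz)).div_const 2

lemma differentiableOn_mu : DifferentiableOn ℂ D.mu {z | z ≠ 0} := by
  unfold mu
  exact (differentiableOn_const _).add ((differentiableOn_const _).div (differentiableOn_id.pow 2)
    fun z hz => pow_ne_zero 2 hz)

lemma differentiableOn_dd (j : Fin 3) : DifferentiableOn ℂ (fun z => D.dd z j) {z | z ≠ 0} := by
  fin_cases j
  exacts [differentiableOn_mu, differentiableOn_const _, differentiableOn_mu]

lemma differentiableOn_theta (j : Fin 3) :
    DifferentiableOn ℂ (fun z => D.theta z j) {z | z ≠ 0} := by
  fin_cases j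
  exacts [differentiableOn_lam.neg, differentiableOn_kk, differentiableOn_lam]

lemma differentiableOn_h1 (x t : ℝ) : DifferentiableOn ℂ (fun z => D.h1 z x t) {z | z ≠ 0} := by
  have hl := differentiableOn_lam (D := D)
  have hk := differentiableOn_kk (D := D)
  unfold h1
  fun_prop

lemma differentiableOn_h2 (x t : ℝ) : DifferentiableOn ℂ (fun z => D.h2 z x t) {z | z ≠ 0} := by
  have hl := differentiableOn_lam (D := D)
  have hk := differentiableOn_kk (D := D)
  unfold h2
  fun_prop

lemma differentiableOn_hh (x t : ℝ) (l : Fin 3) :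
    DifferentiableOn ℂ (fun z => D.hh z x t l) {z | z ≠ 0} := by
  fin_cases l
  exacts [differentiableOn_h1 x t, differentiableOn_h2 x t, (differentiableOn_h1 x t).neg]

lemma differentiableOn_const_div (c : ℂ) : DifferentiableOn ℂ (fun z => c / z) {z | z ≠ 0} :=
  (differentiableOn_const c).div differentiableOn_id fun _ hz => hz

lemma differentiableOn_eigMatrix (v : C2) (i j : Fin 3) :
    DifferentiableOn ℂ (fun z => eigMatrix v z i j) {z | z ≠ 0} := by
  fin_cases i <;> fin_cases j
  exacts [differentiableOn_const _, differentiableOn_const _, differentiableOn_const_div _,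
    differentiableOn_const_div _, differentiableOn_const _, differentiableOn_const _,
    differentiableOn_const_div _, differentiableOn_const _, differentiableOn_const _]

lemma differentiableOn_conj_eigMatrix (v : C2) (i j : Fin 3) :
    DifferentiableOn ℂ (fun z => conj (eigMatrix v (conj z) i j)) {z | z ≠ 0} := by
  intro z hz
  have h : DifferentiableAt ℂ (fun z => eigMatrix v z i j) (conj z) :=
    (differentiableOn_eigMatrix v i j).differentiableAt
      (isOpen_ne.mem_nhds ((map_ne_zero _).2 hz))
  have := h.conj_conj
  rw [Complex.conj_conj] at this
  exact this.differentiableWithinAt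

lemma eigMatrix_inv_apply (hu0 : D.uo ≠ 0) {v : C2} (hv : ‖v‖ = D.u0) (hz : z ≠ 0)
    (hmu : D.mu z ≠ 0) (i j : Fin 3) :
    (eigMatrix v z)⁻¹ i j = (D.dd z i)⁻¹ * conj (eigMatrix v (conj z) j i) := by
  have h : (eigMatrix v z)⁻¹ = Matrix.of fun i j =>
      (D.dd z i)⁻¹ * conj (eigMatrix v (conj z) j i) := by
    refine Matrix.inv_eq_left_inv ?_
    ext i l
    have h1 := adj_dotProduct_eigMatrix hu0 hv hz i l
    rw [Matrix.mul_apply, Matrix.one_apply]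
    simp only [dotProduct, Pi.star_apply, Matrix.transpose_apply, Complex.star_def] at h1
    simp only [Matrix.of_apply, mul_assoc, ← Finset.mul_sum, h1]
    split_ifs
    · exact inv_mul_cancel₀ (dd_ne_zero hmu i)
    · exact mul_zero _
  rw [h, Matrix.of_apply]

lemma differentiableOn_eigMatrix_inv (hu0 : D.uo ≠ 0) {v : C2} (hv : ‖v‖ = D.u0)
    (i j : Fin 3) :
    DifferentiableOn ℂ (fun z => (eigMatrix v z)⁻¹ i j) {z | z ≠ 0 ∧ D.mu z ≠ 0} := by
  have hsub : {z | z ≠ 0 ∧ D.mu z ≠ 0} ⊆ {z : ℂ | z ≠ 0} := fun z hz => hz.1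
  refine DifferentiableOn.congr (((differentiableOn_dd i).mono hsub).inv
    (fun z hz => dd_ne_zero hz.2 i) |>.mul ((differentiableOn_conj_eigMatrix v j i).mono hsub))
    fun z hz => eigMatrix_inv_apply hu0 hv hz.1 hz.2 i j

lemma domM_subset (l : Fin 3) : D.domM l ⊆ {z | z ≠ 0 ∧ D.mu z ≠ 0} := fun _ hz => ⟨hz.1, hz.2.1⟩

lemma domP_subset (l : Fin 3) : D.domP l ⊆ {z | z ≠ 0 ∧ D.mu z ≠ 0} := fun _ hz => ⟨hz.1, hz.2.1⟩

lemma holOn_phiM (hu0 : D.uo ≠ 0) (hu : D.IsSolution) (x t : ℝ) (l i : Fin 3) :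
    HolOn (fun z => D.phiM z x t l i) (D.domM l) := by
  have hsub := D.domM_subset l
  have hsub' : D.domM l ⊆ {z | z ≠ 0} := fun z hz => hz.1
  have hG := fun i j => (differentiableOn_eigMatrix D.um i j).mono hsub'
  have hGi := fun i j => (differentiableOn_eigMatrix_inv hu0 norm_um i j).mono hsub
  have hθ := fun i => (differentiableOn_theta (D := D) i).mono hsub'
  constructor
  · exact continuousOn_pi.1 (continuousOn_leftJost (fun i j => (hG i j).continuousOn)
      (fun i j => (hGi i j).continuousOn) (fun i => (hθ i).continuousOn)
      (fun z hz => (admM_of_mem hu0 hu hz t).adm) x) i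
  · exact differentiableOn_pi.1 (differentiableOn_leftJost isOpen_interior
      (fun i j => (hG i j).mono interior_subset) (fun i j => (hGi i j).mono interior_subset)
      (fun i => (hθ i).mono interior_subset)
      (fun z hz => (admM_of_mem hu0 hu (interior_subset hz) t).adm) x) i

lemma holOn_phiP (hu0 : D.uo ≠ 0) (hu : D.IsSolution) (x t : ℝ) (l i : Fin 3) :
    HolOn (fun z => D.phiP z x t l i) (D.domP l) := by
  have hsub := D.domP_subset l
  have hsub' : D.domP l ⊆ {z | z ≠ 0} := fun z hz => hz.1
  have hG := fun i j => (differentiableOn_eigMatrix D.up i j).mono hsub'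
  have hGi := fun i j => (differentiableOn_eigMatrix_inv hu0 norm_up i j).mono hsub
  have hθ := fun i => ((differentiableOn_theta (D := D) i).mono hsub').neg
  have heq : ∀ z ∈ D.domP l, D.phiP z x t l i = leftJost (eigMatrix D.up z) (-D.theta z)
      (fun y => -(potMatrix (D.u (-y) t) - potMatrix D.up)) l (-x) i := fun z hz => by
    rw [phiP, RightAdmissible.rightJost_eq (admP_of_mem hu0 hu hz t).adm]
  refine HolOn.congr ⟨?_, ?_⟩ heq
  · exact continuousOn_pi.1 (continuousOn_leftJost (fun i j => (hG i j).continuousOn)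
      (fun i j => (hGi i j).continuousOn) (fun i => (hθ i).continuousOn)
      (fun z hz => (admP_of_mem hu0 hu hz t).adm) (-x)) i
  · exact differentiableOn_pi.1 (differentiableOn_leftJost isOpen_interior
      (fun i j => (hG i j).mono interior_subset) (fun i j => (hGi i j).mono interior_subset)
      (fun i => (hθ i).mono interior_subset)
      (fun z hz => (admP_of_mem hu0 hu (interior_subset hz) t).adm) (-x)) i

lemma holOn_adjM (hu0 : D.uo ≠ 0) (hu : D.IsSolution) (x t : ℝ) (l i : Fin 3) :
    HolOn (fun z => D.adjM z x t l i) (D.domP l) := by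
  have h := (holOn_phiM hu0 hu x t l i).conj_conj
  simp only [conj_mem_domM, Set.ofPred_mem_eq] at h
  refine h.congr fun z hz => ?_
  rw [(admM_of_mem hu0 hu (conj_mem_domM.2 hz) t).adjM_eq]
  rfl

lemma holOn_adjP (hu0 : D.uo ≠ 0) (hu : D.IsSolution) (x t : ℝ) (l i : Fin 3) :
    HolOn (fun z => D.adjP z x t l i) (D.domM l) := by
  have h := (holOn_phiP hu0 hu x t l i).conj_conj
  simp only [conj_mem_domP, Set.ofPred_mem_eq] at h
  refine h.congr fun z hz => ?_
  rw [(admP_of_mem hu0 hu (conj_mem_domP.2 hz) t).adjP_eq]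
  rfl

lemma holOn_exp_hh {E : Set ℂ} (hE : E ⊆ {z | z ≠ 0}) (c : ℂ) (x t : ℝ) (l : Fin 3) :
    HolOn (fun z => exp (c * D.hh z x t l)) E :=
  .of_differentiableOn ((((differentiableOn_hh x t l).mono hE).const_mul c).cexp)

lemma holOn_dotProduct {a b : ℂ → C3} {E : Set ℂ} (ha : ∀ i, HolOn (fun z => a z i) E)
    (hb : ∀ i, HolOn (fun z => b z i) E) : HolOn (fun z => a z ⬝ᵥ b z) E := by
  simp only [dotProduct, Fin.sum_univ_three]
  exact (((ha 0).mul (hb 0)).add ((ha 1).mul (hb 1))).add ((ha 2).mul (hb 2))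

lemma holOn_crossProduct {a b : ℂ → C3} {E : Set ℂ} (ha : ∀ i, HolOn (fun z => a z i) E)
    (hb : ∀ i, HolOn (fun z => b z i) E) (i : Fin 3) :
    HolOn (fun z => crossProduct (a z) (b z) i) E := by
  simp only [cross_apply]
  fin_cases i
  exacts [((ha 1).mul (hb 2)).sub ((ha 2).mul (hb 1)),
    ((ha 2).mul (hb 0)).sub ((ha 0).mul (hb 2)), ((ha 0).mul (hb 1)).sub ((ha 1).mul (hb 0))]

lemma holOn_inv_dd {E : Set ℂ} (hE : E ⊆ {z | z ≠ 0 ∧ D.mu z ≠ 0}) (j : Fin 3) :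
    HolOn (fun z => (D.dd z j)⁻¹) E :=
  .of_differentiableOn (((differentiableOn_dd j).mono fun _ hz => (hE hz).1).inv
    fun _ hz => dd_ne_zero (hE hz).2 j)

lemma holOn_s (hu0 : D.uo ≠ 0) (hu : D.IsSolution) (l : Fin 3) : HolOn (D.s l l) (D.domM l) := by
  have h := (holOn_dotProduct (holOn_adjP hu0 hu 0 0 l) (holOn_phiM hu0 hu 0 0 l)).mul
    (holOn_inv_dd (D.domM_subset l) l)
  refine h.congr fun z _ => ?_
  rw [s, adjJostP, jostM, hh_zero, mul_zero, mul_zero, Complex.exp_zero, one_smul, one_smul,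
    div_eq_mul_inv]

lemma holOn_b (hu0 : D.uo ≠ 0) (hu : D.IsSolution) (l : Fin 3) : HolOn (D.b l l) (D.domP l) := by
  have h := (holOn_dotProduct (holOn_adjM hu0 hu 0 0 l) (holOn_phiP hu0 hu 0 0 l)).mul
    (holOn_inv_dd (D.domP_subset l) l)
  refine h.congr fun z _ => ?_
  rw [b, adjJostM, jostP, hh_zero, mul_zero, mul_zero, Complex.exp_zero, one_smul, one_smul,
    div_eq_mul_inv]

end HirotaData

namespace HirotaData

variable {D : HirotaData} {κ t x : ℝ} {z : ℂ} {j l : Fin 3}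

/-! ### Regularity of the matrices of the Riemann-Hilbert problem -/

lemma holOn_adjJostM (hu0 : D.uo ≠ 0) (hu : D.IsSolution) (x t : ℝ) (l i : Fin 3) :
    HolOn (fun z => D.adjJostM z x t l i) (D.domP l) :=
  (holOn_exp_hh (fun _ hz => hz.1) (-I) x t l).mul (holOn_adjM hu0 hu x t l i)

lemma holOn_adjJostP (hu0 : D.uo ≠ 0) (hu : D.IsSolution) (x t : ℝ) (l i : Fin 3) :
    HolOn (fun z => D.adjJostP z x t l i) (D.domM l) :=
  (holOn_exp_hh (fun _ hz => hz.1) (-I) x t l).mul (holOn_adjP hu0 hu x t l i)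

/-- The set on which all ingredients of `M_j` exist; it contains the region `j` and the regular
points of its boundary. -/
def domR (D : HirotaData) : Fin 4 → Set ℂ :=
  ![D.domM 0 ∩ D.domP 1, D.domP 0 ∩ D.domM 1, D.domM 1 ∩ D.domP 2, D.domP 1 ∩ D.domM 2]

lemma holOn_chi (hu0 : D.uo ≠ 0) (hu : D.IsSolution) (x t : ℝ) (j : Fin 4) (i : Fin 3) :
    HolOn (fun z => D.chi z x t j i) (D.domR j) := by
  have hM := fun l i (E : Set ℂ) (hE : E ⊆ D.domP l) => (holOn_adjJostM hu0 hu x t l i).mono hE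
  have hP := fun l i (E : Set ℂ) (hE : E ⊆ D.domM l) => (holOn_adjJostP hu0 hu x t l i).mono hE
  have hne : ∀ {l} {E : Set ℂ}, E ⊆ D.domM l → E ⊆ {z | z ≠ 0} := fun hE z hz => (hE hz).1
  have hi := @Set.inter_subset_left ℂ
  have hi' := @Set.inter_subset_right ℂ
  fin_cases j
  · exact (holOn_exp_hh (hne hi) I x t 0).mul ((holOn_exp_hh (hne hi) I x t 1).mul
      (holOn_crossProduct (fun i => hP 0 i _ hi) (fun i => hM 1 i _ hi') i))
  · exact (holOn_exp_hh (hne hi') I x t 0).mul ((holOn_exp_hh (hne hi') I x t 1).mul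
      (holOn_crossProduct (fun i => hM 0 i _ hi) (fun i => hP 1 i _ hi') i))
  · exact (holOn_exp_hh (hne hi) (-I) x t 0).mul ((holOn_exp_hh (hne hi) I x t 1).mul
      (holOn_crossProduct (fun i => hP 1 i _ hi) (fun i => hM 2 i _ hi') i))
  · exact (holOn_exp_hh (hne hi') (-I) x t 0).mul ((holOn_exp_hh (hne hi') I x t 1).mul
      (holOn_crossProduct (fun i => hM 1 i _ hi) (fun i => hP 2 i _ hi') i))

lemma holOn_den (hu0 : D.uo ≠ 0) (hu : D.IsSolution) (j : Fin 4) (c : Fin 3) :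
    HolOn (fun z => D.den z j c) (D.domR j) := by
  have hs := fun l (E : Set ℂ) (hE : E ⊆ D.domM l) => (holOn_s hu0 hu l).mono hE
  have hb := fun l (E : Set ℂ) (hE : E ⊆ D.domP l) => (holOn_b hu0 hu l).mono hE
  have h1 : ∀ E : Set ℂ, HolOn (fun _ => 1) E := fun E =>
    .of_differentiableOn (differentiableOn_const _)
  have hi := @Set.inter_subset_left ℂ
  have hi' := @Set.inter_subset_right ℂ
  fin_cases j <;> fin_cases c
  exacts [hs 0 _ hi, h1 _, hb 1 _ hi', h1 _, hs 1 _ hi', hb 0 _ hi, hb 2 _ hi', hs 1 _ hi, h1 _,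
    hb 1 _ hi, h1 _, hs 2 _ hi']

/-- The columns of `M_j` without their denominators. -/
def num (D : HirotaData) (z : ℂ) (x t : ℝ) : Fin 4 → Fin 3 → C3 :=
  ![![D.phiM z x t 0, D.phiP z x t 1, D.chi z x t 0],
    ![D.phiP z x t 0, D.phiM z x t 1, D.chi z x t 1],
    ![D.chi z x t 2, D.phiM z x t 1, D.phiP z x t 2],
    ![D.chi z x t 3, D.phiP z x t 1, D.phiM z x t 2]]

lemma M_apply (j : Fin 4) (z : ℂ) (x t : ℝ) (a c : Fin 3) :
    D.M j z x t a c = D.num z x t j c a * (D.den z j c)⁻¹ := by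
  have h1 : ∀ w : ℂ, w = w * (1 : ℂ)⁻¹ := fun w => by rw [inv_one, mul_one]
  fin_cases j <;> fin_cases c
  exacts [mul_comm _ _, h1 _, mul_comm _ _, h1 _, mul_comm _ _, mul_comm _ _, mul_comm _ _,
    mul_comm _ _, h1 _, mul_comm _ _, h1 _, mul_comm _ _]

lemma holOn_num (hu0 : D.uo ≠ 0) (hu : D.IsSolution) (x t : ℝ) (j : Fin 4) (c a : Fin 3) :
    HolOn (fun z => D.num z x t j c a) (D.domR j) := by
  have hM := fun l (E : Set ℂ) (hE : E ⊆ D.domM l) => (holOn_phiM hu0 hu x t l a).mono hE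
  have hP := fun l (E : Set ℂ) (hE : E ⊆ D.domP l) => (holOn_phiP hu0 hu x t l a).mono hE
  have hχ := fun j => holOn_chi hu0 hu x t j a
  have hi := @Set.inter_subset_left ℂ
  have hi' := @Set.inter_subset_right ℂ
  fin_cases j <;> fin_cases c
  exacts [hM 0 _ hi, hP 1 _ hi', hχ 0, hP 0 _ hi, hM 1 _ hi', hχ 1, hχ 2, hM 1 _ hi, hP 2 _ hi',
    hχ 3, hP 1 _ hi, hM 2 _ hi']

/-! ### The regions and their boundaries -/

lemma isOpen_region (j : Fin 4) : IsOpen (D.region j) := by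
  have h1 : IsOpen {z : ℂ | D.u0 < ‖z‖} := isOpen_lt continuous_const continuous_norm
  have h2 : IsOpen {z : ℂ | ‖z‖ < D.u0} := isOpen_lt continuous_norm continuous_const
  have h3 : IsOpen {z : ℂ | 0 < z.im} := isOpen_lt continuous_const Complex.continuous_im
  have h4 : IsOpen {z : ℂ | z.im < 0} := isOpen_lt Complex.continuous_im continuous_const
  fin_cases j
  exacts [h1.inter h3, h1.inter h4, h2.inter h4, h2.inter h3]

/-- The closures of the regions. -/
def closedRegion (D : HirotaData) : Fin 4 → Set ℂ :=
  ![{z | D.u0 ≤ ‖z‖ ∧ 0 ≤ z.im}, {z | D.u0 ≤ ‖z‖ ∧ z.im ≤ 0},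
    {z | ‖z‖ ≤ D.u0 ∧ z.im ≤ 0}, {z | ‖z‖ ≤ D.u0 ∧ 0 ≤ z.im}]

lemma closure_region_subset (j : Fin 4) : closure (D.region j) ⊆ D.closedRegion j := by
  have h1 : IsClosed {z : ℂ | D.u0 ≤ ‖z‖} := isClosed_le continuous_const continuous_norm
  have h2 : IsClosed {z : ℂ | ‖z‖ ≤ D.u0} := isClosed_le continuous_norm continuous_const
  have h3 : IsClosed {z : ℂ | 0 ≤ z.im} := isClosed_le continuous_const Complex.continuous_im
  have h4 : IsClosed {z : ℂ | z.im ≤ 0} := isClosed_le Complex.continuous_im continuous_const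
  fin_cases j
  exacts [closure_minimal (fun z hz => ⟨hz.1.le, hz.2.le⟩) (h1.inter h3),
    closure_minimal (fun z hz => ⟨hz.1.le, hz.2.le⟩) (h1.inter h4),
    closure_minimal (fun z hz => ⟨hz.1.le, hz.2.le⟩) (h2.inter h4),
    closure_minimal (fun z hz => ⟨hz.1.le, hz.2.le⟩) (h2.inter h3)]

lemma closedRegion_subset_domR (hu0 : D.uo ≠ 0) (j : Fin 4) (hz : z ≠ 0) (hmu : D.mu z ≠ 0)
    (h : z ∈ D.closedRegion j) : z ∈ D.domR j := by
  have hpos := u0_pos hu0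
  have hn : 0 < ‖z‖ := norm_pos_iff.2 hz
  have outer : D.u0 ≤ ‖z‖ → 0 ≤ 1 - D.u0 ^ 2 / ‖z‖ ^ 2 := fun h => by
    rw [sub_nonneg, div_le_one (by positivity)]
    exact pow_le_pow_left₀ hpos.le h 2
  have inner : ‖z‖ ≤ D.u0 → 1 - D.u0 ^ 2 / ‖z‖ ^ 2 ≤ 0 := fun h => by
    rw [sub_nonpos, one_le_div (by positivity)]
    exact pow_le_pow_left₀ hn.le h 2
  have hl := D.lam_im z
  fin_cases j
  · have h' : 0 ≤ (D.lam z).im := by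
      rw [hl]
      exact div_nonneg (mul_nonneg h.2 (outer h.1)) two_pos.le
    exact ⟨mem_domM_zero hz hmu h.2 h', mem_domP_one hz hmu h.2⟩
  · have h' : (D.lam z).im ≤ 0 := by
      rw [hl]
      exact div_nonpos_of_nonpos_of_nonneg (mul_nonpos_of_nonpos_of_nonneg h.2 (outer h.1))
        two_pos.le
    exact ⟨mem_domP_zero hz hmu h.2 h', mem_domM_one hz hmu h.2⟩
  · have h' : 0 ≤ (D.lam z).im := by
      rw [hl]
      exact div_nonneg (mul_nonneg_of_nonpos_of_nonpos h.2 (inner h.1)) two_pos.le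
    exact ⟨mem_domM_one hz hmu h.2, mem_domP_two hz hmu h.2 h'⟩
  · have h' : (D.lam z).im ≤ 0 := by
      rw [hl]
      exact div_nonpos_of_nonpos_of_nonneg (mul_nonpos_of_nonneg_of_nonpos h.2 (inner h.1))
        two_pos.le
    exact ⟨mem_domP_one hz hmu h.2, mem_domM_two hz hmu h.2 h'⟩

lemma ne_zero_of_mem_region {j : Fin 4} (h : z ∈ D.region j) : z ≠ 0 := by
  rintro rfl
  fin_cases j
  exacts [lt_irrefl _ h.2, lt_irrefl _ h.2, lt_irrefl _ h.2, lt_irrefl _ h.2]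

lemma norm_eq_of_mu_eq_zero (hz : z ≠ 0) (h : D.mu z = 0) : ‖z‖ = D.u0 := by
  have h1 : z ^ 2 = -(D.u0 : ℂ) ^ 2 := by
    have h2 : D.mu z * z ^ 2 = z ^ 2 + (D.u0 : ℂ) ^ 2 := by
      rw [mu]
      field_simp
    rw [h, zero_mul] at h2
    exact eq_neg_of_add_eq_zero_left h2.symm
  have h3 : ‖z‖ ^ 2 = D.u0 ^ 2 := by
    rw [← norm_pow, h1, norm_neg, norm_pow, Complex.norm_real, Real.norm_eq_abs, sq_abs]
  exact (pow_left_inj₀ (norm_nonneg _) (norm_nonneg _) two_ne_zero).1 h3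

lemma mu_ne_zero_of_mem_region {j : Fin 4} (h : z ∈ D.region j) : D.mu z ≠ 0 := fun h0 => by
  have hn := norm_eq_of_mu_eq_zero (ne_zero_of_mem_region h) h0
  fin_cases j
  exacts [h.1.ne' hn, h.1.ne' hn, h.1.ne hn, h.1.ne hn]

lemma region_subset_domR (hu0 : D.uo ≠ 0) (j : Fin 4) : D.region j ⊆ D.domR j := fun _ h =>
  closedRegion_subset_domR hu0 j (ne_zero_of_mem_region h) (mu_ne_zero_of_mem_region h)
    (closure_region_subset j (subset_closure h))

lemma tendsto_M (hu0 : D.uo ≠ 0) (hu : D.IsSolution) {j : Fin 4} (hz : z ≠ 0) (hmu : D.mu z ≠ 0)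
    (h : z ∈ closure (D.region j)) (hr : D.Regular j z) (x t : ℝ) :
    Tendsto (fun w => D.M j w x t) (𝓝[D.region j] z) (𝓝 (D.M j z x t)) := by
  have hmem := closedRegion_subset_domR hu0 j hz hmu (closure_region_subset j h)
  refine tendsto_pi_nhds.2 fun a => tendsto_pi_nhds.2 fun c => ?_
  simp only [M_apply]
  refine Tendsto.mono_left ?_ (nhdsWithin_mono z (region_subset_domR hu0 j))
  exact ((holOn_num hu0 hu x t j c a).cont z hmem).mul
    (((holOn_den hu0 hu j c).cont z hmem).inv₀ (hr c))

lemma analyticAt_num (hu0 : D.uo ≠ 0) (hu : D.IsSolution) {j : Fin 4} (h : z ∈ D.region j)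
    (x t : ℝ) (c a : Fin 3) : AnalyticAt ℂ (fun z => D.num z x t j c a) z :=
  (holOn_num hu0 hu x t j c a).analyticAt (isOpen_region j) (region_subset_domR hu0 j) h

lemma analyticAt_den (hu0 : D.uo ≠ 0) (hu : D.IsSolution) {j : Fin 4} (h : z ∈ D.region j)
    (c : Fin 3) : AnalyticAt ℂ (fun z => D.den z j c) z :=
  (holOn_den hu0 hu j c).analyticAt (isOpen_region j) (region_subset_domR hu0 j) h

end HirotaData

theorem lemma1 (D : HirotaData) (hu0 : D.uo ≠ 0) (hu : D.IsSolution) :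
    -- the scattering relations, with matrices that do not depend on `x` and `t`
    (∀ z : ℂ, z.im = 0 → z ≠ 0 → ∀ x t : ℝ,
      D.JostM z x t = D.JostP z x t * D.S z ∧ D.JostP z x t = D.JostM z x t * D.B z) ∧
    -- the two expressions for `M_j`
    (∀ (j : Fin 4) (x t : ℝ), ∀ z ∈ D.region j, D.Regular j z →
      D.M j z x t = D.P z x t j * D.expNegH z x t * (Matrix.diagonal (D.den z j))⁻¹) ∧
    -- `M_j` is meromorphic on `Ξ_j`, with poles at most at the zeros of its denominators
    (∀ (j : Fin 4) (x t : ℝ) (a c : Fin 3),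
      MeromorphicOn (fun z => D.M j z x t a c) (D.region j) ∧
      ∀ z ∈ D.region j, D.Regular j z → AnalyticAt ℂ (fun w => D.M j w x t a c) z) ∧
    -- `M^±` are the boundary values of `M`, and satisfy the jump relation on each arc
    (∀ (j : Fin 4) (x t : ℝ), ∀ z ∈ D.arc j, z ≠ 0 → D.mu z ≠ 0 →
      D.Regular (HirotaData.plusSide j) z → D.Regular (HirotaData.minusSide j) z →
      Filter.Tendsto (fun w => D.M (HirotaData.plusSide j) w x t)
        (nhdsWithin z (D.region (HirotaData.plusSide j)))
        (nhds (D.M (HirotaData.plusSide j) z x t)) ∧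
      Filter.Tendsto (fun w => D.M (HirotaData.minusSide j) w x t)
        (nhdsWithin z (D.region (HirotaData.minusSide j)))
        (nhds (D.M (HirotaData.minusSide j) z x t)) ∧
      D.M (HirotaData.plusSide j) z x t =
        D.M (HirotaData.minusSide j) z x t *
          (1 - D.expH z x t * D.V j z * D.expNegH z x t)) ∧
    -- when all Jost eigenfunctions exist on the circle, the remaining two entries of the jump
    -- matrix on the upper semicircle, expressed by reflection coefficients, vanish
    (D.ExpDecay →
      (∀ z : ℂ, ‖z‖ = D.u0 → D.mu z ≠ 0 → ∀ x : ℝ,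
        D.JostM z x 0 = D.JostP z x 0 * D.S z ∧ D.JostP z x 0 = D.JostM z x 0 * D.B z) ∧
      (∀ z ∈ D.arc 3, D.mu z ≠ 0 → D.Regular 0 z → D.Regular 3 z →
        D.Lambda8 z = 0 ∧ D.Lambda9 z = 0)) := by
  refine ⟨fun z him hz x t => ?_, fun j x t z _ hr => ?_, fun j x t a c => ⟨fun z hz => ?_,
    fun z hz hr => ?_⟩, fun j x t z hz hz0 hmu hp hm => ?_, fun he => ⟨fun z hz hmu x => ?_,
    fun z hz hmu hp hm => ?_⟩⟩
  · exact (HirotaData.full_of_im_eq_zero hu0 hu hz him t).scattering hu0 hu x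
  · rw [hr.diagonal_inv, HirotaData.M_eq]
  · simp only [HirotaData.M_apply]
    exact (HirotaData.analyticAt_num hu0 hu hz x t c a).meromorphicAt.mul
      (HirotaData.analyticAt_den hu0 hu hz c).meromorphicAt.inv
  · simp only [HirotaData.M_apply]
    exact (HirotaData.analyticAt_num hu0 hu hz x t c a).mul
      ((HirotaData.analyticAt_den hu0 hu hz c).inv (hr c))
  · have hcl : z ∈ closure (D.region (HirotaData.plusSide j)) ∧
        z ∈ closure (D.region (HirotaData.minusSide j)) := by
      fin_cases j
      exacts [hz, hz.symm, hz, hz.symm]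
    refine ⟨HirotaData.tendsto_M hu0 hu hz0 hmu hcl.1 hp x t,
      HirotaData.tendsto_M hu0 hu hz0 hmu hcl.2 hm x t, ?_⟩
    have h1 := HirotaData.closure_region_subset j hz.1
    have h2 := HirotaData.closure_region_subset (j + 1) hz.2
    fin_cases j
    · exact HirotaData.jump_real_outer hu0 hu hz0 (le_antisymm h2.2 h1.2) hp hm x t
    · exact HirotaData.jump_lower_circle hu0 hu (le_antisymm h2.1 h1.1) hmu h1.2 hp hm x t
    · exact HirotaData.jump_real_inner hu0 hu hz0 (le_antisymm h1.2 h2.2) hp hm x t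
    · exact HirotaData.jump_upper_circle hu0 hu (le_antisymm h1.1 h2.1) hmu h1.2 hp hm x t
  · exact (he.full hu0 hu hz hmu).scattering hu0 hu x
  · have h1 := HirotaData.closure_region_subset 3 hz.1
    have h2 := HirotaData.closure_region_subset (3 + 1) hz.2
    exact HirotaData.lambda_eq_zero he hu0 hu (le_antisymm h1.1 h2.1) hmu hp hm

end
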